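/- Let $\mathbb N=\{1,2,\dots\}$. Let $u_i$ ($i\ge 2$) be independent random variables with $u_i$ uniform on $\{1,\dots,i-1\}$, and let $\epsilon_i$ ($i\ge2$) be i.i.d. standard exponential variables, independent of $(u_i)_{i\ge2}$. Let $\mathbb T$ be the infinite random recursive tree on the vertex set $\mathbb N$ in which every $i\ge 2$ is joined by an edge $e_i$ to its parent $u_i$. The edge $e_i$ is removed at time $\epsilon_i$; let $\Pi(t)$ be the partition of $\mathbb N$ into the sets of vertices that are still connected at time $t$, and let $\Pi(t-)$ be its left limit (the partition obtained when exactly the edges $e_j$ with $\epsilon_j<t$ have been removed). Blocks of a partition are labelled $1,2,\dots$ in the increasing order of their least elements. The space $\mathcal P$ of partitions of $\mathbb N$ carries the Borel $\sigma$-field of the distance $\mathrm d(\pi,\pi')=1/\max\{n:\pi_{|[n]}=\pi'_{|[n]}\}$ (with $\mathrm d(\pi,\pi)=0$), where $\pi_{|[n]}$ is the restriction of $\pi$ to $[n]=\{1,\dots,n\}$. For an infinite set $B\subseteq\mathbb N$ write $B(j)$ for its $j$-th smallest element, and for $\pi\in\mathcal P$ let $B\circ\pi$ be the partition of $B$ into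 the sets $\{B(j):j\in\pi_m\}$, where the $\pi_m$ are the blocks of $\pi$. For $i\ge2$ let $k_i$ be the label of the block $B$ of $\Pi(\epsilon_i-)$ that contains $i$. Removing $e_i$ splits $B$ into two sub-blocks; let $\Delta_i\in\mathcal P$ be the binary partition such that the partition of $B$ into these two sub-blocks is $B\circ\Delta_i$. (Almost surely the $\epsilon_i$ are distinct and all these blocks $B$ are infinite, so $k_i$ and $\Delta_i$ are well defined.) For $k\ge2$ let $\mathbf p_k$ be the law of the random partition of $\mathbb N$ into the black and the red balls of the following urn: balls $1,\dots,k-1$ are black, ball $k$ is red, and, for each $n\ge k$, ball $n+1$ takes the colour of a ball picked uniformly at random from the balls $1,\dots,n$, independently of the previous picks. Put $\mathbf r=\sum_{k\ge2}\mathbf p_k$. Then the random point measure $M=\sum_{i\ge2}\delta_{(\epsilon_i,\Delta_i,k_i)}$ on $\mathbb R_+\times\mathcal P\times\mathbb N$ is a Poisson random measure with intensity $\lambda\otimes\mathbf r\otimes\#$, where $\lambda$ is the Lebesgue measure on $\mathbb R_+$ and $\#$ is the counting measure on $\mathbb N$. -/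

import Mathlib

open MeasureTheory ProbabilityTheory
open scoped ENNReal NNReal

noncomputable section

namespace RecursiveTree

/-- The discrete sigma-field on the positive integers. -/
instance : MeasurableSpace ℕ+ := ⊤

/-- Partitions of `{1, 2, ...}`, as equivalence relations (the blocks are the classes). -/
abbrev Partition : Type := Setoid ℕ+

/-- `π` and `η` have the same restriction to `[n] = {1, ..., n}`. -/
def SameOn (n : ℕ+) (π η : Partition) : Prop :=
  ∀ x y : ℕ+, x ≤ n → y ≤ n → (π x y ↔ η x y)

/-- The Borel sigma-field of the space of partitions. For the distance
`1 / max {n | π and η agree on [n]}` the balls are the sets `{η | η agrees with π on [n]}`;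
there are countably many of them, so they generate the Borel sigma-field. -/
instance : MeasurableSpace Partition :=
  MeasurableSpace.generateFrom {A | ∃ (n : ℕ+) (π : Partition), A = {η | SameOn n π η}}

/-- The block of `π` that contains the vertex `i`. -/
def blockOf (π : Partition) (i : ℕ+) : Set ℕ+ := {j | π i j}

/-- The label of the block of `π` that contains `i`, when the blocks are numbered `1, 2, ...` in
the increasing order of their least elements: one plus the number of the least elements `m` of
blocks such that `m` is smaller than every element of the block of `i`. -/
def blockLabel (π : Partition) (i : ℕ+) : ℕ+ :=
  Nat.succPNat (Set.ncard {m : ℕ+ | (∀ j ∈ blockOf π m, m ≤ j) ∧ ∀ j ∈ blockOf π i, m < j})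

/-- `B(j)`, the `j`-th smallest element of an infinite set `B` of positive integers, `j ≥ 1`.
(`Nat.nth` counts from `0`, hence the shifts.) -/
def enum (B : Set ℕ+) (j : ℕ+) : ℕ+ :=
  Nat.succPNat (Nat.nth (fun n => Nat.succPNat n ∈ B) j.natPred)

/-! ### The destruction of the tree -/

/-- The forest on `{1, 2, ...}` in which every vertex `i ≥ 2` that lies in `S` is joined to its
parent `u i`; that is, of all the edges `e_i`, exactly those with `i ∈ S` are present. -/
def forest (u : ℕ+ → ℕ+) (S : Set ℕ+) : SimpleGraph ℕ+ :=
  SimpleGraph.fromRel (fun i j => 2 ≤ i ∧ i ∈ S ∧ j = u i)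

/-- The partition into connected components of `forest u S`. -/
@[reducible] def clusters (u : ℕ+ → ℕ+) (S : Set ℕ+) : Partition := (forest u S).reachableSetoid

/-- The left limit `Π(t-)`: the clusters formed by the edges which are not removed strictly
before time `t`, the edge `e_j` being removed at time `ε j`. -/
@[reducible] def fragLeft (u : ℕ+ → ℕ+) (ε : ℕ+ → ℝ) (t : ℝ) : Partition := clusters u {j | t ≤ ε j}

/-- `k_i`: the label of the block of `Π(ε_i -)` that contains `i`. -/
def cutLabel (u : ℕ+ → ℕ+) (ε : ℕ+ → ℝ) (i : ℕ+) : ℕ+ :=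
  blockLabel (fragLeft u ε (ε i)) i

/-- `Δ_i`: with `B` the block of `Π(ε_i -)` that contains `i`, removing `e_i` splits `B` into two
sub-blocks, and `Δ_i` is the partition of `{1, 2, ...}` such that `a` and `b` are in the same
block if and only if `B(a)` and `B(b)` are in the same sub-block (that is, the partition of `B`
into the two sub-blocks is `B ∘ Δ_i`). -/
@[reducible] def cutPartition (u : ℕ+ → ℕ+) (ε : ℕ+ → ℝ) (i : ℕ+) : Partition :=
  Setoid.comap (enum (blockOf (fragLeft u ε (ε i)) i)) (clusters u ({j | ε i ≤ ε j} \ {i}))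

/-- The point measure `∑_{i ≥ 2} δ_{(ε_i, Δ_i, k_i)}`. -/
def cutMeasure (u : ℕ+ → ℕ+) (ε : ℕ+ → ℝ) : Measure (ℝ × Partition × ℕ+) :=
  Measure.sum fun i : {i : ℕ+ // 2 ≤ i} =>
    Measure.dirac (ε i, cutPartition u ε i, cutLabel u ε i)

/-! ### The splitting rates -/

/-- The uniform law on `{1, ..., n}`. -/
def uniformUpTo (n : ℕ+) : Measure ℕ+ := uniformOn (Set.Iic n)

instance (n : ℕ+) : IsProbabilityMeasure (uniformUpTo n) :=
  isProbabilityMeasure_uniformOn (Set.finite_Iic n) Set.nonempty_Iic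

/-- The red balls in the urn that starts with the black balls `1, ..., k - 1` and the red ball
`k`: for `n ≥ k`, the ball `n + 1` takes the colour of the ball `w n` drawn from the urn when it
contains the balls `1, ..., n`. -/
inductive IsRed (k : ℕ+) (w : ℕ+ → ℕ+) : ℕ+ → Prop
  | init : IsRed k w k
  | step (n : ℕ+) (hn : k ≤ n) (h : IsRed k w (w n)) : IsRed k w (n + 1)

/-- The partition of the balls into the black ones and the red ones. -/
@[reducible] def urnPartition (k : ℕ+) (w : ℕ+ → ℕ+) : Partition where
  r x y := IsRed k w x ↔ IsRed k w y
  iseqv := ⟨fun _ => Iff.rfl, fun h => h.symm, fun h h' => h.trans h'⟩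

/-- `p_k`, the law of the partition when the draws `w n` are independent and `w n` is uniform on
`{1, ..., n}`. -/
def urnLaw (k : ℕ+) : Measure Partition :=
  (Measure.infinitePi uniformUpTo).map (urnPartition k)

/-- The measure `r = ∑_{k ≥ 2} p_k`. -/
def splittingRate : Measure Partition :=
  Measure.sum fun k : {k : ℕ+ // 2 ≤ k} => urnLaw k

/-! ### Poisson random measures -/

/-- `M` is, under `P`, a Poisson random measure with intensity `μ`. A Poisson variable with
parameter `∞` is almost surely equal to `∞`. -/
structure IsPoissonRandomMeasure {Ω E : Type*} [MeasurableSpace Ω] [MeasurableSpace E]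
    (M : Ω → Measure E) (μ : Measure E) (P : Measure Ω) : Prop where
  measurable : Measurable M
  map_eq_poisson : ∀ A : Set E, MeasurableSet A → μ A ≠ ∞ →
    P.map (fun ω => M ω A) = (poissonMeasure (μ A).toNNReal).map (fun n : ℕ => (n : ℝ≥0∞))
  ae_eq_top : ∀ A : Set E, MeasurableSet A → μ A = ∞ → ∀ᵐ ω ∂P, M ω A = ∞
  indep : ∀ (n : ℕ) (A : Fin n → Set E), (∀ i, MeasurableSet (A i)) →
    Pairwise (fun i j => Disjoint (A i) (A j)) → iIndepFun (fun i ω => M ω (A i)) P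

end RecursiveTree

end

/-! A random measure is Poisson with intensity `μ` as soon as its Laplace functional is `exp (-∫ (1
- exp (-W)) dμ)` for step functions `W` over disjoint sets (`isPoissonRandomMeasure_of_laplace`). By
approximation it is enough to treat weights built from sets that read the partition through finitely
many ranks, cut down to bounded windows (`laplace_of_algebra`).

For such a weight the tree is grown one vertex at a time, with vertices, ranks and labels counted
from zero. Put `g = exp (-W)`. Given the vertices below `n`, the block split by the removal of an
edge `e_i`, `i < n`, is a partly filled urn: a vertex that later enters this block chooses its
parent uniformly in it, so it falls on the separated side with probability equal to the current
proportion of that side. Let `factor` be the mean of `g` over the rest of this urn. A vertex `i`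
that would have rank `j` in the block with label `k` at time `t` has an edge which, if removed then,
creates a fresh urn whose only red ball has rank `j`; the mean of `g` is then `rate`, and
`compensator` integrates `1 - rate` up to `ε_i`. The process `expMart`, the product of the factors
times the exponential of the sum of the compensators, has constant mean one.

The one-step identity behind this (`IsTest.sum_integral_expMart_update`) is as follows. When vertex
`n` joins `v` with an exponential time `τ`, the new factor, the new compensator and the exponential
density combine into the density of a lifetime with hazard rate `vertexRate`. The older factors are
multiplied by ratios, one for each cut that `n` lives to see. Expanding the product of the ratios in
the order of the cut times leaves terms indexed by the cuts. In the term of the cut `i`, only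
vertices `v` of the block of `i` contribute; they were together at all earlier times, so they carry
the same weight, and their ratios average to one because the urn value is harmonic
(`urnValue_harmonic`, `IsTest.sum_factorRatio`).

As `n` grows the sum of the compensators has a deterministic limit: at each time `t > 0` every pair
of a label and a positive rank is occupied by exactly one vertex, whose edge is present
(`place_injective`, `IsGood.exists_place`). Only finitely many cuts matter (`ae_finite_relevant`),
so the product of the factors is eventually the product of the values of `g` at the cuts. Dominated
convergence gives the Laplace functional (`integral_expNeg_tsum`), and the urn computation
(`integral_urnReds`) identifies the limit of the compensators with the integral against `λ ⊗ r ⊗ #`.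
-/

noncomputable section

namespace RecursiveTree

open Filter Topology

/-! ### Laplace transforms of `[0, ∞]`-valued vectors -/

/-- `exp (-x)` for `x ∈ [0, ∞]`, with `exp (-∞) = 0`. -/
def expNeg (x : ℝ≥0∞) : ℝ := (EReal.exp (-(x : EReal))).toReal

@[simp] lemma expNeg_top : expNeg ∞ = 0 := by simp [expNeg]

lemma expNeg_ofReal {r : ℝ} (hr : 0 ≤ r) : expNeg (ENNReal.ofReal r) = Real.exp (-r) := by
  have : ((ENNReal.ofReal r : ℝ≥0∞) : EReal) = (r : EReal) := by
    rw [EReal.coe_ennreal_ofReal, max_eq_left hr]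
  rw [expNeg, this, ← EReal.coe_neg, EReal.exp_coe, ENNReal.toReal_ofReal (Real.exp_nonneg _)]

lemma expNeg_of_ne_top {x : ℝ≥0∞} (hx : x ≠ ∞) : expNeg x = Real.exp (-x.toReal) := by
  conv_lhs => rw [← ENNReal.ofReal_toReal hx]
  exact expNeg_ofReal ENNReal.toReal_nonneg

@[simp] lemma expNeg_zero : expNeg 0 = 1 := by simp [expNeg]

lemma expNeg_nonneg (x : ℝ≥0∞) : 0 ≤ expNeg x := ENNReal.toReal_nonneg

lemma expNeg_add (x y : ℝ≥0∞) : expNeg (x + y) = expNeg x * expNeg y := by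
  by_cases hx : x = ∞
  · simp [hx]
  by_cases hy : y = ∞
  · simp [hy]
  rw [expNeg_of_ne_top hx, expNeg_of_ne_top hy, expNeg_of_ne_top (by simp [hx, hy]),
    ENNReal.toReal_add hx hy, neg_add, Real.exp_add]

lemma expNeg_sum {ι : Type*} (s : Finset ι) (f : ι → ℝ≥0∞) :
    expNeg (∑ i ∈ s, f i) = ∏ i ∈ s, expNeg (f i) := by
  classical
  induction s using Finset.induction_on with
  | empty => simp
  | insert a s ha ih => rw [Finset.sum_insert ha, Finset.prod_insert ha, expNeg_add, ih]

lemma expNeg_antitone : Antitone expNeg := by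
  intro x y h
  by_cases hy : y = ∞
  · simp [hy, expNeg_nonneg]
  rw [expNeg_of_ne_top hy, expNeg_of_ne_top (ne_top_of_le_ne_top hy h)]
  gcongr

lemma expNeg_le_one (x : ℝ≥0∞) : expNeg x ≤ 1 := by
  simpa using expNeg_antitone (zero_le : 0 ≤ x)

lemma expNeg_injective : Function.Injective expNeg := by
  intro x y h
  by_cases hx : x = ∞ <;> by_cases hy : y = ∞
  · rw [hx, hy]
  · rw [hx, expNeg_of_ne_top hy, expNeg_top] at h
    exact absurd h.symm (Real.exp_pos _).ne'
  · rw [hy, expNeg_of_ne_top hx, expNeg_top] at h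
    exact absurd h (Real.exp_pos _).ne'
  · rw [expNeg_of_ne_top hx, expNeg_of_ne_top hy] at h
    have := Real.exp_injective h
    exact (ENNReal.toReal_eq_toReal_iff' hx hy).1 (neg_injective this)

lemma expNeg_eq_zero {x : ℝ≥0∞} : expNeg x = 0 ↔ x = ∞ := by
  rw [← expNeg_top, expNeg_injective.eq_iff]

lemma continuous_expNeg : Continuous expNeg := by
  have h : Continuous fun x : ℝ≥0∞ => EReal.exp (-(x : EReal)) :=
    ENNReal.continuous_exp.comp (continuous_neg.comp continuous_coe_ennreal_ereal)
  rw [continuous_iff_continuousAt]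
  intro x
  refine ENNReal.continuousAt_toReal ?_ |>.comp h.continuousAt
  refine ne_of_lt (lt_of_le_of_lt ?_ ENNReal.one_lt_top)
  simpa using EReal.coe_ennreal_nonneg x

/-- Finite measures on `[0, ∞]ⁿ` are determined by their Laplace transforms at integer points. -/
theorem ext_of_integral_expNeg {ι : Type*} [Fintype ι] (μ ν : Measure (ι → ℝ≥0∞))
    [IsFiniteMeasure μ] [IsFiniteMeasure ν]
    (h : ∀ n : ι → ℕ, ∫ x, expNeg (∑ i, n i * x i) ∂μ = ∫ x, expNeg (∑ i, n i * x i) ∂ν) :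
    μ = ν := by
  classical
  have hc : ∀ n : ι → ℕ, Continuous fun x : ι → ℝ≥0∞ => expNeg (∑ i, n i * x i) := fun n =>
    continuous_expNeg.comp (continuous_finsetSum _ fun i _ =>
      (ENNReal.continuous_const_mul (ENNReal.natCast_ne_top _)).comp (continuous_apply i))
  -- The exponentials at integer points are stable under products, so the algebra they generate is
  -- their linear span. They separate points because `expNeg` is injective on all of `[0, ∞]`, and
  -- Stone-Weierstrass applies since `[0, ∞]^ι` is compact.
  let F : (ι → ℕ) → C(ι → ℝ≥0∞, ℝ) := fun n => ⟨_, hc n⟩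
  let S : Submonoid C(ι → ℝ≥0∞, ℝ) :=
    { carrier := Set.range F
      mul_mem' := by
        rintro _ _ ⟨n, rfl⟩ ⟨m, rfl⟩
        refine ⟨n + m, ?_⟩
        ext x
        simp only [F, ContinuousMap.coe_mk, ContinuousMap.mul_apply, ← expNeg_add,
          ← Finset.sum_add_distrib]
        congr 1
        refine Finset.sum_congr rfl fun i _ => ?_
        simp [add_mul]
      one_mem' := ⟨0, by ext x; simp [F]⟩ }
  have hS : ∀ f ∈ Algebra.adjoin ℝ (S : Set C(ι → ℝ≥0∞, ℝ)), ∫ x, f x ∂μ = ∫ x, f x ∂ν := by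
    intro f hf
    rw [← Subalgebra.mem_toSubmodule, Algebra.adjoin_eq_span_of_subset (R := ℝ)] at hf
    · induction hf using Submodule.span_induction with
      | mem x hx => obtain ⟨n, rfl⟩ := hx; exact h n
      | zero => simp
      | add x y _ _ hx hy =>
        have i1 : ∀ (f : C(ι → ℝ≥0∞, ℝ)) (ρ : Measure (ι → ℝ≥0∞)) [IsFiniteMeasure ρ],
          Integrable f ρ := fun f ρ _ =>
            (BoundedContinuousFunction.mkOfCompact f).integrable ρ
        simp only [ContinuousMap.add_apply]
        rw [integral_add (i1 x μ) (i1 y μ), integral_add (i1 x ν) (i1 y ν), hx, hy]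
      | smul a x _ hx =>
        simp only [ContinuousMap.smul_apply]
        rw [integral_smul, integral_smul, hx]
    · rw [Submonoid.closure_eq]
      exact Submodule.subset_span
  have hsep : (Algebra.adjoin ℝ (S : Set C(ι → ℝ≥0∞, ℝ))).SeparatesPoints := by
    intro x y hxy
    obtain ⟨i, hi⟩ := Function.ne_iff.1 hxy
    refine ⟨F (Pi.single i 1), ⟨F (Pi.single i 1), Algebra.subset_adjoin ⟨_, rfl⟩, rfl⟩, ?_⟩
    have : ∀ z : ι → ℝ≥0∞, F (Pi.single i 1) z = expNeg (z i) := by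
      intro z
      simp only [F, ContinuousMap.coe_mk]
      congr 1
      rw [Finset.sum_eq_single i] <;> simp +contextual
    rw [this, this]
    exact fun h' => hi (expNeg_injective h')
  have htop := ContinuousMap.subalgebra_topologicalClosure_eq_top_of_separatesPoints _ hsep
  refine ext_of_forall_integral_eq_of_IsFiniteMeasure fun f => ?_
  have hclosed : IsClosed {f : C(ι → ℝ≥0∞, ℝ) | ∫ x, f x ∂μ = ∫ x, f x ∂ν} := by
    have hcont : ∀ (ρ : Measure (ι → ℝ≥0∞)) [IsFiniteMeasure ρ],
        Continuous fun f : C(ι → ℝ≥0∞, ℝ) => ∫ x, f x ∂ρ := by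
      intro ρ _
      have i1 : ∀ f : C(ι → ℝ≥0∞, ℝ), Integrable f ρ := fun f =>
        (BoundedContinuousFunction.mkOfCompact f).integrable ρ
      refine (LipschitzWith.of_dist_le_mul (K := (ρ.real Set.univ).toNNReal)
        fun f g => ?_).continuous
      rw [Real.coe_toNNReal _ measureReal_nonneg, dist_eq_norm, ← integral_sub (i1 f) (i1 g),
        mul_comm]
      refine norm_integral_le_of_norm_le_const (.of_forall fun x => ?_)
      rw [← dist_eq_norm]
      exact ContinuousMap.dist_apply_le_dist x
    exact isClosed_eq (hcont μ) (hcont ν)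
  have hmem : (⟨f, f.continuous⟩ : C(ι → ℝ≥0∞, ℝ)) ∈
      (Algebra.adjoin ℝ (S : Set C(ι → ℝ≥0∞, ℝ))).topologicalClosure := by
    rw [htop]; trivial
  exact closure_minimal hS hclosed hmem

/-! ### Poisson random measures from their Laplace functionals -/

lemma abs_exp_neg_sub_le {a b : ℝ} (ha : 0 ≤ a) (hb : 0 ≤ b) :
    |Real.exp (-a) - Real.exp (-b)| ≤ |a - b| := by
  wlog h : a ≤ b generalizing a b
  · rw [abs_sub_comm, abs_sub_comm a b]; exact this hb ha (le_of_not_ge h)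
  rw [abs_of_nonneg (by simpa using h), abs_sub_comm, abs_of_nonneg (by linarith)]
  have h1 : Real.exp (-b) = Real.exp (-a) * Real.exp (-(b - a)) := by
    rw [← Real.exp_add]; ring_nf
  have h2 := Real.add_one_le_exp (-(b - a))
  have h3 : Real.exp (-a) ≤ 1 := by simpa using ha
  have h4 := Real.exp_pos (-a)
  rw [h1]
  nlinarith

lemma abs_measureReal_sub_le {E : Type*} [MeasurableSpace E] (μ : Measure E) {A B : Set E}
    (h : μ (symmDiff A B) ≠ ∞) (hA' : μ A ≠ ∞) (hB' : μ B ≠ ∞) : |μ.real A - μ.real B| ≤ μ.real (symmDiff A B) := by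
  have key : ∀ A B : Set E, μ A ≠ ∞ → μ B ≠ ∞ → μ (symmDiff A B) ≠ ∞ →
      μ.real A ≤ μ.real B + μ.real (symmDiff A B) := by
    intro A B hA hB h
    refine le_trans (measureReal_mono (s₂ := B ∪ symmDiff A B) ?_ ?_) (measureReal_union_le _ _)
    · intro x hx
      by_cases hxB : x ∈ B
      · exact .inl hxB
      · exact .inr (.inl ⟨hx, hxB⟩)
    · exact measure_union_ne_top hB h
  have h1 := key A B hA' hB' h
  have h2 := key B A hB' hA' (by rwa [symmDiff_comm])
  rw [symmDiff_comm] at h2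
  rw [abs_le]; constructor <;> linarith

section

variable {Ω E : Type*} [MeasurableSpace Ω] [mE : MeasurableSpace E]

/-- The Laplace functional formula extends from an algebra of sets to the sigma-field that it
generates, inside a set `D` of finite intensity. -/
lemma laplace_inter_of_algebra (P : Measure Ω) [IsProbabilityMeasure P] {M : Ω → Measure E}
    {μ : Measure E} (hM : Measurable M) {𝒜 : Set (Set E)} (h𝒜 : IsSetAlgebra 𝒜)
    (hgen : mE = MeasurableSpace.generateFrom 𝒜) {D : Set E} (hD : MeasurableSet D)
    (hμD : μ D ≠ ∞) (hMD : ∫⁻ ω, M ω D ∂P ≠ ∞) {r : ℕ} (n : Fin r → ℕ)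
    (hL : ∀ A : Fin r → Set E, (∀ l, A l ∈ 𝒜) →
      ∫ ω, expNeg (∑ l, n l * M ω (A l ∩ D)) ∂P =
        Real.exp (-∫ y in D, (1 - Real.exp (-∑ l, (n l : ℝ) * (A l).indicator (1 : E → ℝ) y)) ∂μ))
    (A : Fin r → Set E) (hA : ∀ l, MeasurableSet (A l)) :
    ∫ ω, expNeg (∑ l, n l * M ω (A l ∩ D)) ∂P =
      Real.exp (-∫ y in D, (1 - Real.exp (-∑ l, (n l : ℝ) * (A l).indicator (1 : E → ℝ) y)) ∂μ) := by
  have hMA : ∀ B, MeasurableSet B → Measurable fun ω => M ω B := fun B hB =>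
    (Measure.measurable_coe hB).comp hM
  have : IsFiniteMeasure (μ.restrict D) := ⟨by simpa using hμD.lt_top⟩
  have hEM : ∀ B, MeasurableSet B → (P.bind M) B = ∫⁻ ω, M ω B ∂P := fun B hB =>
    Measure.bind_apply hB hM.aemeasurable
  have : IsFiniteMeasure ((P.bind M).restrict D) := ⟨by simpa [hEM D hD] using hMD.lt_top⟩
  have hfin : ∀ᵐ ω ∂P, M ω D ≠ ∞ := (ae_lt_top (hMA D hD) hMD).mono fun _ h => h.ne
  -- Approximating for the sum of the intensity and the mean measure gives sets of `𝒜` that are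
  -- close to the `A l` for both sides of the formula at once.
  have hdense := Measure.MeasureDense.of_generateFrom_isSetAlgebra_finite
    (μ.restrict D + (P.bind M).restrict D) h𝒜 hgen
  have happ : ∀ (q : ℕ) (l : Fin r), ∃ B ∈ 𝒜,
      (μ.restrict D + (P.bind M).restrict D) (symmDiff (A l) B) < ENNReal.ofReal (1 / (q + 1)) :=
    fun q l => hdense.approx (A l) (hA l) (measure_ne_top _ _) _ (by positivity)
  choose B hB hAB using happ
  have hBm : ∀ q l, MeasurableSet (B q l) := fun q l => hdense.measurable _ (hB q l)
  have hsm : ∀ q l, MeasurableSet (symmDiff (A l) (B q l)) := fun q l => (hA l).symmDiff (hBm q l)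
  have hμs : ∀ q l, (μ.restrict D).real (symmDiff (A l) (B q l)) ≤ 1 / (q + 1) := fun q l => by
    refine ENNReal.toReal_le_of_le_ofReal (by positivity) (le_trans ?_ (hAB q l).le)
    rw [Measure.add_apply]; exact le_self_add
  have hMs : ∀ q l, ∫ ω, (M ω).real (symmDiff (A l) (B q l) ∩ D) ∂P ≤ 1 / (q + 1) := fun q l => by
    have hle : (P.bind M) (symmDiff (A l) (B q l) ∩ D) ≤ ENNReal.ofReal (1 / (q + 1)) := by
      refine le_trans ?_ (hAB q l).le
      rw [Measure.add_apply, Measure.restrict_apply (hsm q l), Measure.restrict_apply (hsm q l)]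
      exact le_add_self
    rw [hEM _ ((hsm q l).inter hD)] at hle
    simp only [measureReal_def]
    rw [integral_toReal (hMA _ ((hsm q l).inter hD)).aemeasurable]
    · exact ENNReal.toReal_le_of_le_ofReal (by positivity) hle
    · filter_upwards [hfin] with ω hω
      exact (ne_top_of_le_ne_top hω (measure_mono Set.inter_subset_right)).lt_top
  have hMi : ∀ q l, Integrable (fun ω => (M ω).real (symmDiff (A l) (B q l) ∩ D)) P :=
    fun q l => integrable_toReal_of_lintegral_ne_top
      (hMA _ ((hsm q l).inter hD)).aemeasurable
      (ne_top_of_le_ne_top hMD (lintegral_mono fun ω => measure_mono Set.inter_subset_right))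
  -- convergence of the error bound
  have hz : Tendsto (fun q : ℕ => ∑ l : Fin r, (n l : ℝ) * (1 / ((q : ℝ) + 1))) atTop (𝓝 0) := by
    have : Tendsto (fun q : ℕ => ∑ l : Fin r, (n l : ℝ) * (1 / ((q : ℝ) + 1))) atTop
        (𝓝 (∑ l : Fin r, (n l : ℝ) * 0)) :=
      tendsto_finsetSum _ fun l _ => tendsto_one_div_add_atTop_nhds_zero_nat.const_mul _
    simpa using this
  have hXm : ∀ C : Fin r → Set E, (∀ l, MeasurableSet (C l)) →
      Measurable fun ω => expNeg (∑ l, n l * M ω (C l ∩ D)) := fun C hC =>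
    continuous_expNeg.measurable.comp
      (Finset.measurable_sum _ fun l _ => (hMA _ ((hC l).inter hD)).const_mul _)
  have hXi : ∀ C : Fin r → Set E, (∀ l, MeasurableSet (C l)) →
      Integrable (fun ω => expNeg (∑ l, n l * M ω (C l ∩ D))) P := fun C hC =>
    Integrable.of_bound (hXm C hC).aestronglyMeasurable 1 (.of_forall fun ω => by
      rw [Real.norm_of_nonneg (expNeg_nonneg _)]; exact expNeg_le_one _)
  -- Since `exp (-·)` is 1-Lipschitz on `[0, ∞)`, the error is at most the weighted mean mass of the
  -- symmetric differences.
  have hlhs : Tendsto (fun q => ∫ ω, expNeg (∑ l, n l * M ω (B q l ∩ D)) ∂P) atTop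
      (𝓝 (∫ ω, expNeg (∑ l, n l * M ω (A l ∩ D)) ∂P)) := by
    rw [tendsto_iff_norm_sub_tendsto_zero]
    refine squeeze_zero (fun _ => norm_nonneg _) (fun q => ?_) hz
    rw [← integral_sub (hXi _ (hBm q)) (hXi _ hA)]
    calc ‖∫ ω, (expNeg (∑ l, n l * M ω (B q l ∩ D)) - expNeg (∑ l, n l * M ω (A l ∩ D))) ∂P‖
        ≤ ∫ ω, ∑ l, n l * (M ω).real (symmDiff (A l) (B q l) ∩ D) ∂P := by
          refine norm_integral_le_of_norm_le
            (integrable_finsetSum _ fun l _ => (hMi q l).const_mul _) ?_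
          filter_upwards [hfin] with ω hω
          have hne : ∀ C : Set E, M ω (C ∩ D) ≠ ∞ := fun C =>
            ne_top_of_le_ne_top hω (measure_mono Set.inter_subset_right)
          have hsum : ∀ C : Fin r → Set E, ∑ l, (n l : ℝ≥0∞) * M ω (C l ∩ D) ≠ ∞ := fun C =>
            ENNReal.sum_ne_top.2 fun l _ => ENNReal.mul_ne_top (ENNReal.natCast_ne_top _) (hne _)
          have hre : ∀ C : Fin r → Set E, (∑ l, (n l : ℝ≥0∞) * M ω (C l ∩ D)).toReal =
              ∑ l, n l * (M ω).real (C l ∩ D) := fun C => by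
            rw [ENNReal.toReal_sum fun l _ => ENNReal.mul_ne_top (ENNReal.natCast_ne_top _) (hne _)]
            simp [measureReal_def]
          rw [expNeg_of_ne_top (hsum _), expNeg_of_ne_top (hsum _)]
          refine (abs_exp_neg_sub_le ENNReal.toReal_nonneg ENNReal.toReal_nonneg).trans ?_
          rw [hre, hre, ← Finset.sum_sub_distrib]
          refine (Finset.abs_sum_le_sum_abs _ _).trans (Finset.sum_le_sum fun l _ => ?_)
          rw [← mul_sub, abs_mul, Nat.abs_cast]
          refine mul_le_mul_of_nonneg_left ?_ (Nat.cast_nonneg _)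
          have hs : symmDiff (B q l ∩ D) (A l ∩ D) = symmDiff (A l) (B q l) ∩ D := by
            rw [symmDiff_comm, Set.inter_symmDiff_distrib_right]
          rw [← hs]
          exact abs_measureReal_sub_le _ (by rw [hs]; exact hne _) (hne _) (hne _)
      _ = ∑ l, n l * ∫ ω, (M ω).real (symmDiff (A l) (B q l) ∩ D) ∂P := by
          rw [integral_finsetSum _ fun l _ => (hMi q l).const_mul _]
          simp only [integral_const_mul]
      _ ≤ _ := Finset.sum_le_sum fun l _ =>
          mul_le_mul_of_nonneg_left (hMs q l) (Nat.cast_nonneg _)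
  have hFm : ∀ C : Fin r → Set E, (∀ l, MeasurableSet (C l)) →
      Measurable fun y => ∑ l, (n l : ℝ) * (C l).indicator (1 : E → ℝ) y := fun C hC =>
    Finset.measurable_sum _ fun l _ => (measurable_one.indicator (hC l)).const_mul _
  have hF0 : ∀ (C : Fin r → Set E) y, 0 ≤ ∑ l, (n l : ℝ) * (C l).indicator (1 : E → ℝ) y :=
    fun C y => Finset.sum_nonneg fun l _ => mul_nonneg (Nat.cast_nonneg _)
      (Set.indicator_nonneg (fun _ _ => zero_le_one) _)
  have hGi : ∀ C : Fin r → Set E, (∀ l, MeasurableSet (C l)) →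
      Integrable (fun y => 1 - Real.exp (-∑ l, (n l : ℝ) * (C l).indicator (1 : E → ℝ) y))
        (μ.restrict D) := fun C hC =>
    Integrable.of_bound ((measurable_const.sub
      (Real.measurable_exp.comp (hFm C hC).neg)).aestronglyMeasurable) 1 (.of_forall fun y => by
      have h1 : Real.exp (-∑ l, (n l : ℝ) * (C l).indicator (1 : E → ℝ) y) ≤ 1 := by
        simpa using hF0 C y
      have h2 := Real.exp_pos (-∑ l, (n l : ℝ) * (C l).indicator (1 : E → ℝ) y)
      rw [Real.norm_of_nonneg (by linarith)]; linarith)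
  have hrhs : Tendsto (fun q => ∫ y in D, (1 - Real.exp (-∑ l, (n l : ℝ) * (B q l).indicator (1 : E → ℝ) y)) ∂μ)
      atTop (𝓝 (∫ y in D, (1 - Real.exp (-∑ l, (n l : ℝ) * (A l).indicator (1 : E → ℝ) y)) ∂μ)) := by
    rw [tendsto_iff_norm_sub_tendsto_zero]
    refine squeeze_zero (fun _ => norm_nonneg _) (fun q => ?_) hz
    rw [← integral_sub (hGi _ (hBm q)) (hGi _ hA)]
    have hind : ∀ l, Integrable ((symmDiff (A l) (B q l)).indicator (1 : E → ℝ)) (μ.restrict D) :=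
      fun l => (integrable_const (1 : ℝ)).indicator (hsm q l)
    calc _ ≤ ∫ y in D, ∑ l, n l * (symmDiff (A l) (B q l)).indicator (1 : E → ℝ) y ∂μ := by
          refine norm_integral_le_of_norm_le
            (integrable_finsetSum _ fun l _ => (hind l).const_mul _) (.of_forall fun y => ?_)
          rw [sub_sub_sub_cancel_left, Real.norm_eq_abs]
          refine (abs_exp_neg_sub_le (hF0 _ _) (hF0 _ _)).trans ?_
          rw [← Finset.sum_sub_distrib]
          refine (Finset.abs_sum_le_sum_abs _ _).trans (Finset.sum_le_sum fun l _ => ?_)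
          rw [← mul_sub, abs_mul, Nat.abs_cast]
          refine mul_le_mul_of_nonneg_left ?_ (Nat.cast_nonneg _)
          by_cases h1 : y ∈ A l <;> by_cases h2 : y ∈ B q l <;>
            simp [h1, h2, Set.indicator, Set.mem_symmDiff]
      _ = ∑ l, n l * (μ.restrict D).real (symmDiff (A l) (B q l)) := by
          rw [integral_finsetSum _ fun l _ => (hind l).const_mul _]
          refine Finset.sum_congr rfl fun l _ => ?_
          rw [integral_const_mul, integral_indicator_one (hsm q l)]
      _ ≤ _ := Finset.sum_le_sum fun l _ =>
          mul_le_mul_of_nonneg_left (hμs q l) (Nat.cast_nonneg _)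
  refine tendsto_nhds_unique hlhs ?_
  simp only [hL _ (hB _)]
  exact (Real.continuous_exp.tendsto _).comp hrhs.neg

/-- The Laplace functional formula for disjoint sets. -/
lemma laplace_of_algebra (P : Measure Ω) [IsProbabilityMeasure P] {M : Ω → Measure E}
    {μ : Measure E} (hM : Measurable M) {𝒜 : Set (Set E)} (h𝒜 : IsSetAlgebra 𝒜)
    (hgen : mE = MeasurableSpace.generateFrom 𝒜) {D : ℕ → Set E} (hD : ∀ m, MeasurableSet (D m))
    (hmono : Monotone D) (hμD : ∀ m, μ (D m) ≠ ∞) (hMD : ∀ m, ∫⁻ ω, M ω (D m) ∂P ≠ ∞)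
    (hμ0 : μ (⋃ m, D m)ᶜ = 0) (hM0 : ∀ᵐ ω ∂P, M ω (⋃ m, D m)ᶜ = 0)
    (hL : ∀ (m r : ℕ) (n : Fin r → ℕ) (A : Fin r → Set E), (∀ l, A l ∈ 𝒜) →
      ∫ ω, expNeg (∑ l, n l * M ω (A l ∩ D m)) ∂P =
        Real.exp (-∫ y in D m, (1 - Real.exp (-∑ l, (n l : ℝ) * (A l).indicator (1 : E → ℝ) y)) ∂μ))
    {r : ℕ} (n : Fin r → ℕ) (A : Fin r → Set E) (hA : ∀ l, MeasurableSet (A l))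
    (hdisj : Pairwise fun i j => Disjoint (A i) (A j)) :
    ∫ ω, expNeg (∑ l, n l * M ω (A l)) ∂P =
      ∏ l, expNeg (ENNReal.ofReal (1 - Real.exp (-(n l : ℝ))) * μ (A l)) := by
  have hfin : ∀ m, ∫ ω, expNeg (∑ l, n l * M ω (A l ∩ D m)) ∂P =
      ∏ l, expNeg (ENNReal.ofReal (1 - Real.exp (-(n l : ℝ))) * μ (A l ∩ D m)) := by
    intro m
    have : IsFiniteMeasure (μ.restrict (D m)) := ⟨by simpa using (hμD m).lt_top⟩
    rw [laplace_inter_of_algebra P hM h𝒜 hgen (hD m) (hμD m) (hMD m) n (hL m r n) A hA,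
      ← expNeg_sum]
    -- By disjointness at most one indicator is non-zero at `y`, so `1 - exp (-·)` distributes over
    -- the sum.
    have hpt : ∀ y, 1 - Real.exp (-∑ l, (n l : ℝ) * (A l).indicator (1 : E → ℝ) y) =
        ∑ l, (1 - Real.exp (-(n l : ℝ))) * (A l).indicator (1 : E → ℝ) y := by
      intro y
      by_cases hy : ∃ l, y ∈ A l
      · obtain ⟨l, hl⟩ := hy
        have hne : ∀ b, b ≠ l → (A b).indicator (1 : E → ℝ) y = 0 := fun b hb =>
          Set.indicator_of_notMem (fun h => (Set.disjoint_left.1 (hdisj hb) h) hl) _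
        rw [Finset.sum_eq_single l (fun b _ hb => by rw [hne b hb, mul_zero]) (by simp),
          Finset.sum_eq_single l (fun b _ hb => by rw [hne b hb, mul_zero]) (by simp)]
        simp [hl]
      · push Not at hy
        simp [hy]
    have hint : ∫ y in D m, (1 - Real.exp (-∑ l, (n l : ℝ) * (A l).indicator (1 : E → ℝ) y)) ∂μ =
        ∑ l, (1 - Real.exp (-(n l : ℝ))) * μ.real (A l ∩ D m) := by
      simp only [hpt]
      have hind : ∀ l, Integrable ((A l).indicator (1 : E → ℝ)) (μ.restrict (D m)) :=
        fun l => (integrable_const (1 : ℝ)).indicator (hA l)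
      rw [integral_finsetSum _ fun l _ => (hind l).const_mul _]
      refine Finset.sum_congr rfl fun l _ => ?_
      rw [integral_const_mul]
      congr 1
      refine (integral_indicator_one (hA l)).trans ?_
      rw [measureReal_def, measureReal_def, Measure.restrict_apply (hA l)]
    have hne : ∀ l, μ (A l ∩ D m) ≠ ∞ := fun l =>
      ne_top_of_le_ne_top (hμD m) (measure_mono Set.inter_subset_right)
    rw [hint, expNeg_of_ne_top
      (ENNReal.sum_ne_top.2 fun l _ => ENNReal.mul_ne_top ENNReal.ofReal_ne_top (hne l)),
      ENNReal.toReal_sum fun l _ => ENNReal.mul_ne_top ENNReal.ofReal_ne_top (hne l)]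
    congr 2
    refine Finset.sum_congr rfl fun l _ => ?_
    rw [ENNReal.toReal_mul, ENNReal.toReal_ofReal (by simp), measureReal_def]
  have hlim : ∀ (ρ : Measure E), ρ (⋃ m, D m)ᶜ = 0 → ∀ l,
      Tendsto (fun m => ρ (A l ∩ D m)) atTop (𝓝 (ρ (A l))) := by
    intro ρ hρ l
    have h1 : ρ (A l) = ρ (⋃ m, A l ∩ D m) := by
      rw [← Set.inter_iUnion]
      exact (measure_inter_conull hρ).symm
    rw [h1]
    exact tendsto_measure_iUnion_atTop fun i j h => Set.inter_subset_inter_right _ (hmono h)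
  have hlhs : Tendsto (fun m => ∫ ω, expNeg (∑ l, n l * M ω (A l ∩ D m)) ∂P) atTop
      (𝓝 (∫ ω, expNeg (∑ l, n l * M ω (A l)) ∂P)) := by
    refine tendsto_integral_of_dominated_convergence (fun _ => 1) (fun m => ?_)
      (integrable_const _) (fun m => .of_forall fun ω => ?_) ?_
    · exact (continuous_expNeg.measurable.comp (Finset.measurable_sum _ fun l _ =>
        ((Measure.measurable_coe ((hA l).inter (hD m))).comp hM).const_mul _)).aestronglyMeasurable
    · rw [Real.norm_of_nonneg (expNeg_nonneg _)]; exact expNeg_le_one _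
    · filter_upwards [hM0] with ω hω
      refine (continuous_expNeg.tendsto _).comp (tendsto_finsetSum _ fun l _ => ?_)
      exact ENNReal.Tendsto.const_mul (hlim _ hω l) (.inr (ENNReal.natCast_ne_top _))
  refine tendsto_nhds_unique hlhs ?_
  simp only [hfin]
  refine tendsto_finsetProd _ fun l _ => (continuous_expNeg.tendsto _).comp ?_
  exact ENNReal.Tendsto.const_mul (hlim _ hμ0 l) (.inr ENNReal.ofReal_ne_top)

lemma integral_expNeg_poissonMeasure (a : ℝ≥0) (n : ℕ) :
    ∫ k : ℕ, expNeg (n * (k : ℝ≥0∞)) ∂(poissonMeasure a) =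
      Real.exp (-((1 - Real.exp (-(n : ℝ))) * a)) := by
  have h1 : ∀ k : ℕ, expNeg (n * (k : ℝ≥0∞)) = Real.exp (-(n : ℝ)) ^ k := by
    intro k
    rw [expNeg_of_ne_top (ENNReal.mul_ne_top (ENNReal.natCast_ne_top _) (ENNReal.natCast_ne_top _)),
      ← Real.exp_nat_mul]
    simp [mul_comm]
  simp only [integral_poissonMeasure, h1, smul_eq_mul]
  have h2 := (NormedSpace.expSeries_div_hasSum_exp (a * Real.exp (-(n : ℝ)))).mul_left
    (Real.exp (-(a : ℝ)))
  rw [← Real.exp_eq_exp_ℝ, ← Real.exp_add] at h2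
  rw [show -((1 - Real.exp (-(n : ℝ))) * (a : ℝ)) = -a + a * Real.exp (-(n : ℝ)) by ring,
    ← h2.tsum_eq]
  refine tsum_congr fun k => ?_
  rw [mul_pow]
  ring

/-- A random measure whose Laplace functional is that of a Poisson random measure is one. -/
theorem isPoissonRandomMeasure_of_laplace (P : Measure Ω) [IsProbabilityMeasure P]
    {M : Ω → Measure E} {μ : Measure E} (hM : Measurable M)
    (h : ∀ (r : ℕ) (n : Fin r → ℕ) (A : Fin r → Set E), (∀ l, MeasurableSet (A l)) →
      Pairwise (fun i j => Disjoint (A i) (A j)) →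
      ∫ ω, expNeg (∑ l, n l * M ω (A l)) ∂P =
        ∏ l, expNeg (ENNReal.ofReal (1 - Real.exp (-(n l : ℝ))) * μ (A l))) :
    IsPoissonRandomMeasure M μ P := by
  have hMA : ∀ B, MeasurableSet B → Measurable fun ω => M ω B := fun B hB =>
    (Measure.measurable_coe hB).comp hM
  have h1 : ∀ (n : ℕ) (A : Set E), MeasurableSet A → ∫ ω, expNeg (n * M ω A) ∂P =
      expNeg (ENNReal.ofReal (1 - Real.exp (-(n : ℝ))) * μ A) := fun n A hA => by
    simpa using h 1 (fun _ => n) (fun _ => A) (fun _ => hA)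
      (fun i j hij => absurd (Subsingleton.elim i j) hij)
  have hcm : ∀ n : ℕ, Measurable fun x : ℝ≥0∞ => expNeg (n * x) := fun n =>
    continuous_expNeg.measurable.comp (measurable_id.const_mul _)
  refine ⟨hM, fun A hA hμA => ?_, fun A hA hμA => ?_, fun r A hA hdisj => ?_⟩
  · have hcast : Measurable fun n : ℕ => (n : ℝ≥0∞) := measurable_from_nat
    have : IsProbabilityMeasure (P.map fun ω => M ω A) :=
      Measure.isProbabilityMeasure_map (hMA A hA).aemeasurable
    have : IsProbabilityMeasure ((poissonMeasure (μ A).toNNReal).map fun n : ℕ => (n : ℝ≥0∞)) :=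
      Measure.isProbabilityMeasure_map hcast.aemeasurable
    -- The uniqueness theorem is stated for vectors; a scalar is treated as a vector with one
    -- coordinate.
    let e := MeasurableEquiv.funUnique (Fin 1) ℝ≥0∞
    refine (MeasurableEquiv.map_measurableEquiv_injective e.symm) ?_
    have := Measure.isProbabilityMeasure_map (μ := P.map fun ω => M ω A)
      e.symm.measurable.aemeasurable
    have := Measure.isProbabilityMeasure_map
      (μ := (poissonMeasure (μ A).toNNReal).map fun n : ℕ => (n : ℝ≥0∞))
      e.symm.measurable.aemeasurable
    refine ext_of_integral_expNeg _ _ fun n => ?_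
    rw [integral_map_equiv, integral_map_equiv]
    have he : ∀ x : ℝ≥0∞, ∑ i, (n i : ℝ≥0∞) * e.symm x i = n 0 * x := fun x => by
      simp [e, MeasurableEquiv.funUnique]
    simp only [he]
    rw [integral_map (hMA A hA).aemeasurable (hcm _).aestronglyMeasurable,
      integral_map hcast.aemeasurable (hcm _).aestronglyMeasurable, h1 _ _ hA,
      integral_expNeg_poissonMeasure, expNeg_of_ne_top (ENNReal.mul_ne_top ENNReal.ofReal_ne_top hμA),
      ENNReal.toReal_mul, ENNReal.toReal_ofReal (by simp)]
    rfl
  -- For infinite intensity, the mean of the nonnegative variable `exp (-M A)` is zero, which forces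
  -- `M A = ∞` almost surely.
  · have h2 := h1 1 A hA
    rw [hμA, ENNReal.mul_top (by simp), expNeg_top, integral_eq_zero_iff_of_nonneg
      (fun _ => expNeg_nonneg _)] at h2
    · filter_upwards [h2] with ω hω
      simpa [expNeg_eq_zero] using hω
    · exact Integrable.of_bound ((hcm 1).comp (hMA A hA)).aestronglyMeasurable 1
        (.of_forall fun ω => by
          rw [Real.norm_of_nonneg (expNeg_nonneg _)]; exact expNeg_le_one _)
  -- The joint Laplace transform is a product whose factors are the one-set transforms, hence the
  -- transform of the product of the marginal laws.
  · rw [iIndepFun_iff_map_fun_eq_pi_map fun i => (hMA _ (hA i)).aemeasurable]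
    have hp : ∀ i, IsProbabilityMeasure (P.map fun ω => M ω (A i)) := fun i =>
      Measure.isProbabilityMeasure_map (hMA _ (hA i)).aemeasurable
    have hmeas : Measurable fun ω i => M ω (A i) := measurable_pi_lambda _ fun i => hMA _ (hA i)
    have := Measure.isProbabilityMeasure_map (μ := P) hmeas.aemeasurable
    refine ext_of_integral_expNeg _ _ fun n => ?_
    rw [integral_map hmeas.aemeasurable, h r n A hA hdisj]
    · simp only [expNeg_sum]
      rw [integral_fintype_prod_eq_prod (fun i (x : ℝ≥0∞) => expNeg (n i * x))]
      refine Finset.prod_congr rfl fun i _ => ?_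
      rw [integral_map (hMA _ (hA i)).aemeasurable (hcm _).aestronglyMeasurable, h1 _ _ (hA i)]
    · exact (continuous_expNeg.measurable.comp (Finset.measurable_sum _ fun l _ =>
        (measurable_pi_apply l).const_mul _)).aestronglyMeasurable

end

/-! ### Hazard rates -/

/-- The product telescopes when its factors are multiplied in the increasing order of `e`;
injectivity makes this order strict. -/
lemma prod_eq_one_add_sum_of_injOn {ι : Type*} [DecidableEq ι] (I : Finset ι) (e : ι → ℝ)
    (he : Set.InjOn e I) (r : ι → ℝ) :
    ∏ i ∈ I, r i = 1 + ∑ i ∈ I, (r i - 1) * ∏ j ∈ I with e j < e i, r j := by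
  induction I using Finset.induction_on_max_value e with
  | empty => simp
  | insert a s ha hmax ih =>
    rw [Finset.prod_insert ha, Finset.sum_insert ha]
    have hs : ∀ j ∈ s, e j < e a := fun j hj => lt_of_le_of_ne (hmax j hj) fun h => by
      have := he (by simp [hj]) (by simp) h
      exact ha (this ▸ hj)
    have h1 : (insert a s).filter (fun j => e j < e a) = s := by
      ext j
      simp only [Finset.mem_filter, Finset.mem_insert]
      constructor
      · rintro ⟨rfl | h, h'⟩
        · exact absurd h' (lt_irrefl _)
        · exact h
      · exact fun h => ⟨.inr h, hs j h⟩
    have h2 : ∀ i ∈ s, (insert a s).filter (fun j => e j < e i) = s.filter fun j => e j < e i := by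
      intro i hi
      rw [Finset.filter_insert, if_neg (not_lt.2 (hmax i hi))]
    rw [h1, Finset.sum_congr rfl fun i hi => by rw [h2 i hi]]
    have := ih (he.mono (by simp))
    linear_combination this

section Hazard

variable {a : ℝ → ℝ} {c : ℝ}

lemma intervalIntegrable_of_mem_Icc (ha : Measurable a) (hc : 0 < c) (hca : ∀ t, c ≤ a t)
    (ha1 : ∀ t, a t ≤ 1) (s t : ℝ) : IntervalIntegrable a volume s t := by
  refine (intervalIntegrable_const (c := (1 : ℝ))).mono_fun ha.aestronglyMeasurable
    (.of_forall fun t => ?_)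
  simpa [abs_of_nonneg (hc.le.trans (hca t))] using ha1 t

lemma mul_le_integral_hazard (ha : Measurable a) (hc : 0 < c) (hca : ∀ t, c ≤ a t)
    (ha1 : ∀ t, a t ≤ 1) {s t : ℝ} (hst : s ≤ t) : c * (t - s) ≤ ∫ u in s..t, a u := by
  have := intervalIntegral.integral_mono_on hst (intervalIntegrable_const (c := c))
    (intervalIntegrable_of_mem_Icc ha hc hca ha1 s t) fun u _ => hca u
  simpa [mul_comm] using this

lemma measurable_integral_hazard (ha : Measurable a) (hc : 0 < c) (hca : ∀ t, c ≤ a t)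
    (ha1 : ∀ t, a t ≤ 1) : Measurable fun t => ∫ u in (0 : ℝ)..t, a u :=
  (intervalIntegral.continuous_primitive
    (fun s t => intervalIntegrable_of_mem_Icc ha hc hca ha1 s t) 0).measurable

lemma integrableOn_hazard (ha : Measurable a) (hc : 0 < c) (hca : ∀ t, c ≤ a t)
    (ha1 : ∀ t, a t ≤ 1) :
    IntegrableOn (fun t => a t * Real.exp (-∫ u in (0 : ℝ)..t, a u)) (Set.Ioi 0) := by
  refine Integrable.mono' (integrableOn_exp_mul_Ioi (a := -c) (by linarith) 0)
    (ha.mul (Real.measurable_exp.comp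
      (measurable_integral_hazard ha hc hca ha1).neg)).aestronglyMeasurable ?_
  refine (ae_restrict_mem measurableSet_Ioi).mono fun t ht => ?_
  have h0 := hc.le.trans (hca t)
  rw [norm_mul, Real.norm_of_nonneg h0, Real.norm_of_nonneg (Real.exp_nonneg _)]
  have h1 := mul_le_integral_hazard ha hc hca ha1 (le_of_lt ht)
  have h2 : Real.exp (-∫ u in (0 : ℝ)..t, a u) ≤ Real.exp (-c * t) :=
    Real.exp_le_exp.2 (by linarith)
  nlinarith [ha1 t, Real.exp_pos (-∫ u in (0 : ℝ)..t, a u)]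

/-- The density `a exp (-∫ a)` of a lifetime with hazard rate `a`. -/
lemma integral_Ioi_hazard (ha : Measurable a) (hc : 0 < c) (hca : ∀ t, c ≤ a t)
    (ha1 : ∀ t, a t ≤ 1) {s : ℝ} (hs : 0 ≤ s) :
    ∫ t in Set.Ioi s, a t * Real.exp (-∫ u in (0 : ℝ)..t, a u) =
      Real.exp (-∫ u in (0 : ℝ)..s, a u) := by
  set A : ℝ → ℝ := fun t => ∫ u in (0 : ℝ)..t, a u with hA
  have hii := intervalIntegrable_of_mem_Icc ha hc hca ha1
  have hA0 : ∀ t, 0 ≤ t → 0 ≤ A t := fun t ht =>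
    (mul_nonneg hc.le (sub_nonneg.2 ht)).trans (mul_le_integral_hazard ha hc hca ha1 ht)
  have hdiff : ∀ x y, A x - A y = ∫ u in y..x, a u := fun x y => by
    rw [hA]; simp only
    rw [intervalIntegral.integral_interval_sub_left (hii _ _) (hii _ _)]
  -- The rate is merely measurable, so the derivative of `exp (-A)` is known almost everywhere only.
  -- Being Lipschitz where `A ≥ 0`, the function is absolutely continuous, and this is enough for
  -- the fundamental theorem of calculus.
  have hlip : ∀ T, LipschitzOnWith 1 (fun t => Real.exp (-A t)) (Set.uIcc s T ∩ Set.Ici 0) := by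
    intro T
    refine LipschitzOnWith.of_dist_le_mul fun x hx y hy => ?_
    rw [Real.dist_eq, Real.dist_eq, NNReal.coe_one, one_mul]
    refine (abs_exp_neg_sub_le (hA0 x hx.2) (hA0 y hy.2)).trans ?_
    rw [hdiff]
    have := intervalIntegral.norm_integral_le_of_norm_le_const (a := y) (b := x) (f := a) (C := 1)
      fun u _ => by
        rw [Real.norm_of_nonneg (hc.le.trans (hca u))]; exact ha1 u
    simpa using this
  have hfin : ∀ T, s ≤ T → ∫ t in s..T, a t * Real.exp (-A t) =
      Real.exp (-A s) - Real.exp (-A T) := by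
    intro T hT
    have hlipT : LipschitzOnWith 1 (fun t => Real.exp (-A t)) (Set.uIcc s T) := by
      refine (hlip T).mono fun x hx => ⟨hx, ?_⟩
      rw [Set.uIcc_of_le hT] at hx
      exact hs.trans hx.1
    have hac := hlipT.absolutelyContinuousOnInterval
    have h1 := hac.integral_deriv_eq_sub
    have hloc : LocallyIntegrable a volume := by
      refine ((locallyIntegrable_const (1 : ℝ)) : LocallyIntegrable (fun _ : ℝ => (1 : ℝ))
        volume).mono ha.aestronglyMeasurable (.of_forall fun t => ?_)
      rw [Real.norm_of_nonneg (hc.le.trans (hca t))]; simpa using ha1 t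
    have h2 : ∫ t in s..T, deriv (fun t => Real.exp (-A t)) t =
        ∫ t in s..T, -(a t * Real.exp (-A t)) := by
      refine intervalIntegral.integral_congr_ae ?_
      filter_upwards [LocallyIntegrable.ae_hasDerivAt_integral hloc] with t ht _
      refine (((ht 0).neg.exp).deriv).trans ?_
      simp only [hA, Pi.neg_apply]
      ring
    rw [h2, intervalIntegral.integral_neg] at h1
    linarith
  have hint : IntegrableOn (fun t => a t * Real.exp (-A t)) (Set.Ioi s) :=
    (integrableOn_hazard ha hc hca ha1).mono_set (Set.Ioi_subset_Ioi hs)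
  have hlim := intervalIntegral_tendsto_integral_Ioi s hint tendsto_id
  refine tendsto_nhds_unique hlim ?_
  -- The bound `c ≤ a` yields `c T ≤ A T`: no mass escapes to infinity.
  have h0 : Tendsto (fun T => Real.exp (-A T)) atTop (𝓝 0) := by
    refine Real.tendsto_exp_atBot.comp (tendsto_neg_atTop_atBot.comp ?_)
    refine tendsto_atTop_mono' _ ?_ (tendsto_id.const_mul_atTop hc)
    filter_upwards [eventually_ge_atTop 0] with T hT
    simpa using mul_le_integral_hazard ha hc hca ha1 hT
  have h3 : Tendsto (fun T => Real.exp (-A s) - Real.exp (-A T)) atTop (𝓝 (Real.exp (-A s) - 0)) :=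
    tendsto_const_nhds.sub h0
  rw [sub_zero] at h3
  refine h3.congr' ?_
  filter_upwards [eventually_ge_atTop s] with T hT
  rw [id, hfin T hT]

end Hazard

/-- Attaching a walker to a uniformly chosen vertex `v`: the weights `r i v` picked up at the times
`e i` average to one, because each of them does. -/
lemma sum_integral_hazard {V ι : Type*} [DecidableEq ι] (N : Finset V) (I : Finset ι) (e : ι → ℝ)
    (he0 : ∀ i ∈ I, 0 < e i) (he : Set.InjOn e I) (r : ι → V → ℝ) (a : V → ℝ → ℝ) {c : ℝ}
    (hc : 0 < c) (ha : ∀ v ∈ N, Measurable (a v)) (hca : ∀ v ∈ N, ∀ t, c ≤ a v t)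
    (ha1 : ∀ v ∈ N, ∀ t, a v t ≤ 1)
    (hr : ∀ i ∈ I, ∑ v ∈ N, (r i v - 1) * ((∏ j ∈ I with e j < e i, r j v) *
      Real.exp (-∫ u in (0 : ℝ)..e i, a v u)) = 0) :
    ∑ v ∈ N, ∫ τ in Set.Ioi (0 : ℝ), (∏ i ∈ I with e i ≤ τ, r i v) *
      (a v τ * Real.exp (-∫ u in (0 : ℝ)..τ, a v u)) = N.card := by
  have hv : ∀ v ∈ N, ∫ τ in Set.Ioi (0 : ℝ), (∏ i ∈ I with e i ≤ τ, r i v) *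
      (a v τ * Real.exp (-∫ u in (0 : ℝ)..τ, a v u)) =
      1 + ∑ i ∈ I, (r i v - 1) * ((∏ j ∈ I with e j < e i, r j v) *
      Real.exp (-∫ u in (0 : ℝ)..e i, a v u)) := by
    intro v hv
    set q : ℝ → ℝ := fun τ => a v τ * Real.exp (-∫ u in (0 : ℝ)..τ, a v u) with hq
    have hqi : IntegrableOn q (Set.Ioi 0) := integrableOn_hazard (ha v hv) hc (hca v hv) (ha1 v hv)
    -- After the expansion, the term of `i` depends on `τ` only through the density and the
    -- indicator of `e i ≤ τ`. Its integral is therefore governed by the survival function at `e i`.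
    have hpt : ∀ τ, (∏ i ∈ I with e i ≤ τ, r i v) *
        (a v τ * Real.exp (-∫ u in (0 : ℝ)..τ, a v u)) = q τ + ∑ i ∈ I, (r i v - 1) *
        (∏ j ∈ I with e j < e i, r j v) * (Set.Ici (e i)).indicator q τ := by
      intro τ
      change _ * q τ = _
      rw [prod_eq_one_add_sum_of_injOn _ e (he.mono (Finset.coe_subset.2 (Finset.filter_subset _ _)))
        fun i => r i v, add_mul, one_mul,
        Finset.sum_mul, Finset.sum_filter]
      congr 1
      refine Finset.sum_congr rfl fun i _ => ?_
      by_cases h : e i ≤ τ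
      · rw [if_pos h, Set.indicator_of_mem (by exact h), Finset.filter_filter]
        congr 2
        refine Finset.prod_congr (Finset.filter_congr fun j _ => ?_) fun _ _ => rfl
        exact ⟨fun h' => h'.2, fun h' => ⟨h'.le.trans h, h'⟩⟩
      · rw [if_neg h, Set.indicator_of_notMem (by exact h), mul_zero]
    simp only [hpt]
    have hii : ∀ i ∈ I, IntegrableOn (fun τ => (r i v - 1) *
        (∏ j ∈ I with e j < e i, r j v) * (Set.Ici (e i)).indicator q τ) (Set.Ioi 0) := fun i _ =>
      (hqi.indicator measurableSet_Ici).const_mul _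
    rw [integral_add hqi (integrable_finsetSum _ hii), integral_finsetSum _ hii]
    congr 1
    · have := integral_Ioi_hazard (ha v hv) hc (hca v hv) (ha1 v hv) le_rfl
      simpa using this
    · refine Finset.sum_congr rfl fun i hi => ?_
      rw [integral_const_mul, setIntegral_indicator measurableSet_Ici, Set.inter_eq_right.2
        (Set.Ici_subset_Ioi.2 (he0 i hi)), integral_Ici_eq_integral_Ioi,
        integral_Ioi_hazard (ha v hv) hc (hca v hv) (ha1 v hv) (he0 i hi).le, mul_assoc]
  rw [Finset.sum_congr rfl hv, Finset.sum_add_distrib, Finset.sum_comm, Finset.sum_congr rfl hr]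
  simp

/-! ### Recursive trees on `{0, 1, 2, ...}` -/

open Classical in
/-- The least vertex that can be reached from `n` when the edges from `i` to `p i` with `i ∈ S`
are present. -/
def root (p : ℕ → ℕ) (S : Set ℕ) (n : ℕ) : ℕ :=
  if _h : n ∈ S ∧ p n < n then root p S (p n) else n
termination_by n
decreasing_by exact _h.2

section Root

variable {p p' : ℕ → ℕ} {S S' : Set ℕ} {v w i : ℕ}

lemma root_of_mem (h : v ∈ S) (h' : p v < v) : root p S v = root p S (p v) := by
  rw [root, dif_pos ⟨h, h'⟩]

lemma root_of_notMem (h : v ∉ S) : root p S v = v := by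
  rw [root, dif_neg fun h' => h h'.1]

lemma root_le (p : ℕ → ℕ) (S : Set ℕ) (v : ℕ) : root p S v ≤ v := by
  induction v using Nat.strong_induction_on with
  | _ v ih =>
    by_cases h : v ∈ S ∧ p v < v
    · rw [root_of_mem h.1 h.2]; exact (ih _ h.2).trans h.2.le
    · rw [root, dif_neg h]

lemma root_congr (h : ∀ w ≤ v, p w = p' w ∧ (w ∈ S ↔ w ∈ S')) : root p S v = root p' S' v := by
  induction v using Nat.strong_induction_on with
  | _ v ih =>
    by_cases h1 : v ∈ S ∧ p v < v
    · have h2 := h v le_rfl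
      rw [root_of_mem h1.1 h1.2, root_of_mem (h2.2.1 h1.1) (h2.1 ▸ h1.2), ← h2.1]
      exact ih _ h1.2 fun w hw => h w (hw.trans h1.2.le)
    · rw [root, dif_neg h1, root, dif_neg]
      rwa [← (h v le_rfl).1, ← (h v le_rfl).2]

/-- The descent from `v` along the edges of `S` is an initial part of the descent along those of
`S'`. Hence adding edges can only merge blocks. -/
lemma root_root_of_subset (hS : S ⊆ S') (v : ℕ) : root p S' (root p S v) = root p S' v := by
  induction v using Nat.strong_induction_on with
  | _ v ih =>
    by_cases h : v ∈ S ∧ p v < v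
    · rw [root_of_mem h.1 h.2, root_of_mem (hS h.1) h.2, ih _ h.2]
    · rw [root.eq_1 p S, dif_neg h]

lemma root_root (p : ℕ → ℕ) (S : Set ℕ) (v : ℕ) : root p S (root p S v) = root p S v :=
  root_root_of_subset subset_rfl v

lemma root_eq_of_subset (hS : S ⊆ S') (h : root p S v = root p S w) :
    root p S' v = root p S' w := by
  rw [← root_root_of_subset hS v, h, root_root_of_subset hS w]

lemma root_diff_singleton_self : root p (S \ {i}) i = i := root_of_notMem (by simp)

/-- Removing the edge of `i` affects a descent only if it passes through `i`, and then the descent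
stops at `i`. -/
lemma root_diff_singleton (h : root p (S \ {i}) v ≠ i) : root p (S \ {i}) v = root p S v := by
  induction v using Nat.strong_induction_on with
  | _ v ih =>
    have hv : v ≠ i := by rintro rfl; exact h root_diff_singleton_self
    by_cases h1 : v ∈ S ∧ p v < v
    · have h2 : v ∈ S \ {i} := ⟨h1.1, hv⟩
      rw [root_of_mem h2 h1.2] at h ⊢
      rw [root_of_mem h1.1 h1.2, ih _ h1.2 h]
    · rw [root.eq_1 p S, dif_neg h1, root, dif_neg fun h => h1 ⟨h.1.1, h.2⟩]

end Root

/-- A configuration: the parent and the removal time of every vertex. -/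
abbrev Config := ℕ → ℕ × ℝ

/-- The vertices whose edge is present just before time `t`. -/
def alive (x : Config) (t : ℝ) : Set ℕ := {i | t ≤ (x i).2}

/-- The least vertex of the block of `v` just before time `t`. -/
def rootAt (x : Config) (t : ℝ) (v : ℕ) : ℕ := root (fun i => (x i).1) (alive x t) v

/-- The label of the block of `v` just before time `t`, counted from zero. -/
def label (x : Config) (t : ℝ) (v : ℕ) : ℕ := Nat.count (fun m => rootAt x t m = m) (rootAt x t v)

/-- The number of vertices below `n` in the block of `v` just before time `t`. -/
def blockSize (x : Config) (n : ℕ) (t : ℝ) (v : ℕ) : ℕ :=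
  Nat.count (fun w => rootAt x t w = rootAt x t v) n

/-- `w` is in the block which is split at the removal of the edge of `i`. -/
def InBlock (x : Config) (i w : ℕ) : Prop := rootAt x (x i).2 w = rootAt x (x i).2 i

instance (x : Config) (i : ℕ) : DecidablePred (InBlock x i) := fun w =>
  inferInstanceAs (Decidable (rootAt x (x i).2 w = rootAt x (x i).2 i))

/-- `w` is separated from the root of its block at the removal of the edge of `i`. -/
def Cut (x : Config) (i w : ℕ) : Prop :=
  root (fun j => (x j).1) (alive x (x i).2 \ {i}) w = i

instance (x : Config) (i : ℕ) : DecidablePred (Cut x i) := fun w =>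
  inferInstanceAs (Decidable (root (fun j => (x j).1) (alive x (x i).2 \ {i}) w = i))

/-- The ranks, within the block which is split at the removal of the edge of `i`, of the vertices
below `n` which are separated from the root. -/
def cutRanks (x : Config) (i n : ℕ) : Finset ℕ :=
  ((Finset.range n).filter (Cut x i)).image (Nat.count (InBlock x i))

/-! ### Blocks, labels and cuts of a configuration, and their dependence on finitely many vertices.
-/

section Config

variable {x x' : Config} {n i v w : ℕ} {s t τ : ℝ}

lemma rootAt_le (x : Config) (t : ℝ) (v : ℕ) : rootAt x t v ≤ v := root_le _ _ _

lemma rootAt_rootAt (x : Config) (t : ℝ) (v : ℕ) : rootAt x t (rootAt x t v) = rootAt x t v :=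
  root_root _ _ _

lemma alive_anti (h : s ≤ t) : alive x t ⊆ alive x s := fun _ hi => h.trans hi

lemma rootAt_eq_of_le (h : s ≤ t) (hvw : rootAt x t v = rootAt x t w) :
    rootAt x s v = rootAt x s w := root_eq_of_subset (alive_anti h) hvw

lemma label_eq_of_rootAt_eq (h : rootAt x t v = rootAt x t w) : label x t v = label x t w := by
  rw [label, label, h]

lemma blockSize_eq_of_rootAt_eq (h : rootAt x t v = rootAt x t w) :
    blockSize x n t v = blockSize x n t w := by rw [blockSize, blockSize, h]

lemma label_injective (h : label x t v = label x t w) : rootAt x t v = rootAt x t w :=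
  Nat.count_injective (p := fun m => rootAt x t m = m) (rootAt_rootAt x t v)
    (rootAt_rootAt x t w) h

/-- Descents never go up, so all that concerns vertices below `n` is read off the coordinates below
`n`. This is what allows the tree to be grown one vertex at a time. -/
lemma rootAt_congr (h : ∀ j < n, x j = x' j) (hv : v < n) : rootAt x t v = rootAt x' t v :=
  root_congr fun w hw => by
    rw [h w (hw.trans_lt hv)]
    refine ⟨rfl, ?_⟩
    simp only [alive, Set.mem_ofPred_eq, h w (hw.trans_lt hv)]

lemma count_congr {p q : ℕ → Prop} [DecidablePred p] [DecidablePred q]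
    (h : ∀ w < n, p w ↔ q w) : Nat.count p n = Nat.count q n := by
  rw [Nat.count_eq_card_filter_range, Nat.count_eq_card_filter_range]
  congr 1
  exact Finset.filter_congr fun w hw => h w (Finset.mem_range.1 hw)

lemma label_congr (h : ∀ j < n, x j = x' j) (hv : v < n) : label x t v = label x' t v := by
  rw [label, label, rootAt_congr h hv]
  refine count_congr fun w hw => ?_
  rw [rootAt_congr h (hw.trans_le (by
    rw [← rootAt_congr h hv]; exact (rootAt_le x t v).trans hv.le))]

lemma blockSize_congr (h : ∀ j < n, x j = x' j) (hv : v < n) (hw : w ≤ n) :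
    blockSize x w t v = blockSize x' w t v := by
  rw [blockSize, blockSize]
  refine count_congr fun u hu => ?_
  rw [rootAt_congr h (hu.trans_le hw), rootAt_congr h hv]

lemma inBlock_congr (h : ∀ j < n, x j = x' j) (hi : i < n) (hw : w < n) :
    InBlock x i w ↔ InBlock x' i w := by
  rw [InBlock, InBlock, ← h i hi, rootAt_congr h hi, rootAt_congr h hw]

lemma cut_congr (h : ∀ j < n, x j = x' j) (hi : i < n) (hw : w < n) :
    Cut x i w ↔ Cut x' i w := by
  rw [Cut, Cut, ← h i hi]
  rw [root_congr (p' := fun j => (x' j).1) (S' := alive x' (x i).2 \ {i})]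
  intro u hu
  rw [h u (hu.trans_lt hw)]
  refine ⟨rfl, ?_⟩
  simp only [alive, Set.mem_sdiff, Set.mem_ofPred_eq, h u (hu.trans_lt hw)]

lemma cutRanks_congr (h : ∀ j < n, x j = x' j) (hi : i < n) :
    cutRanks x i n = cutRanks x' i n := by
  rw [cutRanks, cutRanks, Finset.filter_congr fun w hw => cut_congr h hi (Finset.mem_range.1 hw)]
  refine Finset.image_congr fun w hw => ?_
  have hw' : w < n := Finset.mem_range.1 (Finset.mem_filter.1 hw).1
  exact count_congr fun u hu => inBlock_congr h hi (hu.trans hw')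

lemma cut_self (x : Config) (i : ℕ) : Cut x i i := root_diff_singleton_self

lemma Cut.inBlock (h : Cut x i w) : InBlock x i w := by
  have h1 : root (fun j => (x j).1) (alive x (x i).2 \ {i}) w =
      root (fun j => (x j).1) (alive x (x i).2 \ {i}) i := by
    rw [h, root_diff_singleton_self]
  exact root_eq_of_subset Set.sdiff_subset h1

lemma Cut.le (h : Cut x i w) : i ≤ w := by
  have := root_le (fun j => (x j).1) (alive x (x i).2 \ {i}) w
  rwa [h] at this

/-- The vertices of a block at a later time are together before. -/
lemma inBlock_iff_of_lt {j : ℕ} (hij : (x j).2 ≤ (x i).2) (hv : InBlock x i v)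
    (hw : InBlock x i w) : InBlock x j v ↔ InBlock x j w := by
  have : rootAt x (x j).2 v = rootAt x (x j).2 w := rootAt_eq_of_le hij (hv.trans hw.symm)
  rw [InBlock, InBlock, this]

/-- Every edge present just before the cut of `i` was also present right after the earlier cut of
`j`, which had already removed the edge of `j`. Thus vertices still together at the later cut fell
on the same side of the earlier one. -/
lemma cut_iff_of_lt {j : ℕ} (hij : (x j).2 < (x i).2) (hv : InBlock x i v)
    (hw : InBlock x i w) : Cut x j v ↔ Cut x j w := by
  have h1 : alive x (x i).2 ⊆ alive x (x j).2 \ {j} := fun k hk => by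
    refine ⟨alive_anti hij.le hk, ?_⟩
    rintro rfl
    exact absurd hij (not_lt.2 hk)
  rw [Cut, Cut, root_eq_of_subset h1 (hv.trans hw.symm)]

lemma card_cutRanks (x : Config) (i n : ℕ) :
    (cutRanks x i n).card = ((Finset.range n).filter (Cut x i)).card := by
  refine Finset.card_image_of_injOn fun v hv w hw h => ?_
  simp only [Finset.coe_filter, Set.mem_ofPred_eq] at hv hw
  exact Nat.count_injective hv.2.inBlock hw.2.inBlock h

lemma card_cutRanks_le (x : Config) (i n : ℕ) :
    (cutRanks x i n).card ≤ Nat.count (InBlock x i) n := by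
  rw [card_cutRanks, Nat.count_eq_card_filter_range]
  exact Finset.card_le_card (Finset.monotone_filter_right _ fun w _ h => Cut.inBlock h)

lemma cutRanks_succ (x : Config) (i n : ℕ) : cutRanks x i (n + 1) =
    if Cut x i n then insert (Nat.count (InBlock x i) n) (cutRanks x i n) else cutRanks x i n := by
  rw [cutRanks, Finset.range_add_one, Finset.filter_insert]
  split_ifs with h
  · rw [Finset.image_insert]; rfl
  · rfl

/-! #### Attaching one more vertex -/

lemma rootAt_update_of_lt (x : Config) (y : ℕ × ℝ) (hv : v < n) :
    rootAt (Function.update x n y) t v = rootAt x t v :=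
  rootAt_congr (n := n) (fun _ hj => Function.update_of_ne hj.ne _ _) hv

lemma rootAt_update_self (hv : v < n) : rootAt (Function.update x n (v, τ)) t n =
    if t ≤ τ then rootAt x t v else n := by
  split_ifs with h
  · rw [rootAt, root_of_mem, ← rootAt_update_of_lt (t := t) x (v, τ) hv, rootAt]
    · simp
    · simp [alive, h]
    · simpa using hv
  · exact root_of_notMem (by simpa [alive] using h)

lemma inBlock_update_self (hi : i < n) (hv : v < n) :
    InBlock (Function.update x n (v, τ)) i n ↔ (x i).2 ≤ τ ∧ InBlock x i v := by
  rw [InBlock, Function.update_of_ne hi.ne, rootAt_update_self hv, rootAt_update_of_lt _ _ hi,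
    InBlock]
  split_ifs with h
  · simp [h]
  · simp only [h, false_and, iff_false]
    -- With its edge gone the new vertex is its own root, whereas the root of the block of `i` is at
    -- most `i < n`.
    exact fun h' => absurd (rootAt_le x (x i).2 i) (not_le.2 (h' ▸ hi))

lemma cut_update_self (hi : i < n) (hv : v < n) :
    Cut (Function.update x n (v, τ)) i n ↔ (x i).2 ≤ τ ∧ Cut x i v := by
  rw [← cut_congr (x := Function.update x n (v, τ)) (x' := x) (n := n)
    (fun _ hj => Function.update_of_ne hj.ne _ _) hi hv, Cut, Cut, Function.update_of_ne hi.ne]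
  by_cases h : (x i).2 ≤ τ
  · rw [root_of_mem]
    · simp [h]
    · simp [alive, h, hi.ne']
    · simpa using hv
  · rw [root_of_notMem]
    · simp [h, hi.ne']
    · simp [alive, h]

end Config

/-! ### Measurability -/

section Measurability

/-- Substituting a measurable index with countably many values only requires measurability for each
fixed index, by splitting over the values. -/
lemma measurable_eval_countable {X ι β : Type*} [MeasurableSpace X] [MeasurableSpace β]
    [Countable ι] [MeasurableSpace ι] [MeasurableSingletonClass ι] {F : X → ι} {H : ι → X → β}
    (hF : Measurable F) (hH : ∀ k, Measurable (H k)) : Measurable fun q => H (F q) q := by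
  intro A hA
  have : (fun q => H (F q) q) ⁻¹' A = ⋃ k, F ⁻¹' {k} ∩ H k ⁻¹' A := by
    ext q; simp
  rw [this]
  exact .iUnion fun k => (hF (measurableSet_singleton k)).inter (hH k hA)

lemma measurable_count {X : Type*} [MeasurableSpace X] {Q : X → ℕ → Prop}
    [∀ q, DecidablePred (Q q)] (hQ : ∀ m, MeasurableSet {q | Q q m}) (n : ℕ) :
    Measurable fun q => Nat.count (Q q) n := by
  induction n with
  | zero => simp
  | succ n ih =>
    simp only [Nat.count_succ]
    exact ih.add (Measurable.ite (hQ n) measurable_const measurable_const)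

variable {X : Type*} [MeasurableSpace X] {Y : X → Config} {T : X → ℝ}

lemma measurable_root {p : X → ℕ → ℕ} {S : X → Set ℕ} (hp : ∀ v, Measurable fun q => p q v)
    (hS : ∀ v, MeasurableSet {q | v ∈ S q}) (v : ℕ) : Measurable fun q => root (p q) (S q) v := by
  classical
  induction v using Nat.strong_induction_on with
  | _ v ih =>
    -- The value is set to `0` when `k ≥ v`, so that the induction hypothesis covers every value of
    -- the random index.
    have h : (fun q => root (p q) (S q) v) = fun q =>
        if v ∈ S q ∧ p q v < v then (fun k q => if k < v then root (p q) (S q) k else 0)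
          (p q v) q
          else v := by
      funext q
      split_ifs with h
      · rw [root_of_mem h.1 h.2]; simp [h.2]
      · rw [root, dif_neg h]
    rw [h]
    refine Measurable.ite ((hS v).inter ?_) ?_ measurable_const
    · exact hp v (Set.to_countable (Set.Iio v)).measurableSet
    · refine measurable_eval_countable (H := fun k q => if k < v then root (p q) (S q) k else 0)
        (hp v) fun k => ?_
      by_cases hk : k < v
      · simpa [hk] using ih k hk
      · simp [hk]

lemma measurable_fst_apply (hY : Measurable Y) (i : ℕ) : Measurable fun q => (Y q i).1 :=
  measurable_fst.comp ((measurable_pi_apply i).comp hY)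

lemma measurable_snd_apply (hY : Measurable Y) (i : ℕ) : Measurable fun q => (Y q i).2 :=
  measurable_snd.comp ((measurable_pi_apply i).comp hY)

lemma measurableSet_mem_alive (hY : Measurable Y) (hT : Measurable T) (i : ℕ) :
    MeasurableSet {q | i ∈ alive (Y q) (T q)} :=
  measurableSet_le hT (measurable_snd_apply hY i)

lemma measurable_rootAt (hY : Measurable Y) (hT : Measurable T) (v : ℕ) :
    Measurable fun q => rootAt (Y q) (T q) v :=
  measurable_root (fun i => measurable_fst_apply hY i)
    (fun i => measurableSet_mem_alive hY hT i) v

lemma measurable_label (hY : Measurable Y) (hT : Measurable T) (v : ℕ) :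
    Measurable fun q => label (Y q) (T q) v :=
  measurable_eval_countable (measurable_rootAt hY hT v)
    (measurable_count fun m => measurable_rootAt hY hT m (measurableSet_singleton m))

lemma measurable_blockSize (hY : Measurable Y) (hT : Measurable T) (n v : ℕ) :
    Measurable fun q => blockSize (Y q) n (T q) v :=
  measurable_count
    (fun w => measurableSet_eq_fun (measurable_rootAt hY hT w) (measurable_rootAt hY hT v)) n

lemma measurableSet_inBlock (hY : Measurable Y) (i w : ℕ) :
    MeasurableSet {q | InBlock (Y q) i w} :=
  measurableSet_eq_fun (measurable_rootAt hY (measurable_snd_apply hY i) w)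
    (measurable_rootAt hY (measurable_snd_apply hY i) i)

lemma measurableSet_cut (hY : Measurable Y) (i w : ℕ) : MeasurableSet {q | Cut (Y q) i w} :=
  measurable_root (fun j => measurable_fst_apply hY j) (fun j =>
    (measurableSet_mem_alive hY (measurable_snd_apply hY i) j).inter
      (MeasurableSet.const (j ∉ ({i} : Set ℕ)))) w (measurableSet_singleton i)

lemma measurable_cutRanks (hY : Measurable Y) (i n : ℕ) :
    @Measurable X (Finset ℕ) _ ⊤ fun q => cutRanks (Y q) i n := by
  let _ : MeasurableSpace (Finset ℕ) := ⊤
  have : MeasurableSingletonClass (Finset ℕ) := ⟨fun _ => trivial⟩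
  induction n with
  | zero => simp [cutRanks]
  | succ n ih =>
    simp only [cutRanks_succ]
    refine Measurable.ite (measurableSet_cut hY i n) ?_ ih
    exact measurable_eval_countable (H := fun k q => insert k (cutRanks (Y q) i n))
      (measurable_count (measurableSet_inBlock hY i) n)
      fun k => Measurable.comp (g := fun R : Finset ℕ => insert k R) (fun _ _ => trivial) ih

end Measurability

/-! ### The urn -/

/-- The mean of `g` applied to the set of red balls after `d` draws from an urn which contains the
balls `0, ..., b - 1`, those in `R` being red. -/
def urnMean (g : Finset ℕ → ℝ) : ℕ → ℕ → Finset ℕ → ℝ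
  | 0, _, R => g R
  | d + 1, b, R => (R.card / b : ℝ) * urnMean g d (b + 1) (insert b R) +
      (1 - R.card / b) * urnMean g d (b + 1) R

/-- The mean of `g` applied to the set of red balls once the urn contains `J` balls. -/
def urnValue (g : Finset ℕ → ℝ) (J b : ℕ) (R : Finset ℕ) : ℝ := urnMean g (J - b) b R

section Urn

variable {g : Finset ℕ → ℝ} {J b : ℕ} {R : Finset ℕ} {c : ℝ}

lemma urnValue_of_le (h : J ≤ b) : urnValue g J b R = g R := by
  rw [urnValue, Nat.sub_eq_zero_of_le h, urnMean]

/-- While the urn has fewer than `J` balls this is the conditioning on the next draw, multiplied by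
`b`; afterwards the next ball is invisible to `g`. This is the only property of the urn that the
martingale argument uses. -/
lemma urnValue_harmonic (hg : ∀ R R' : Finset ℕ, (∀ a < J, a ∈ R ↔ a ∈ R') → g R = g R')
    (hb : 0 < b) : R.card * urnValue g J (b + 1) (insert b R) +
      (b - R.card) * urnValue g J (b + 1) R = b * urnValue g J b R := by
  have hb' : (b : ℝ) ≠ 0 := by positivity
  by_cases h : J ≤ b
  · rw [urnValue_of_le h, urnValue_of_le (by omega), urnValue_of_le (by omega),
      hg (insert b R) R]
    · ring
    · intro a ha
      simp [show a ≠ b by omega]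
  · rw [urnValue, urnValue, urnValue, show J - b = (J - (b + 1)) + 1 by omega, urnMean]
    field_simp

/-- Each draw takes a convex combination, the proportion `R.card / b` being at most one. -/
lemma urnMean_mem_Icc (hc : ∀ R, c ≤ g R) (h1 : ∀ R, g R ≤ 1) (d : ℕ) :
    ∀ (b : ℕ) (R : Finset ℕ), R.card ≤ b → c ≤ urnMean g d b R ∧ urnMean g d b R ≤ 1 := by
  induction d with
  | zero => exact fun b R _ => ⟨hc R, h1 R⟩
  | succ d ih =>
    intro b R hR
    have hq0 : (0 : ℝ) ≤ R.card / b := by positivity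
    have hq1 : (R.card / b : ℝ) ≤ 1 := div_le_one_of_le₀ (by exact_mod_cast hR) (by positivity)
    have i1 := ih (b + 1) (insert b R) ((Finset.card_insert_le _ _).trans (by omega))
    have i2 := ih (b + 1) R (by omega)
    rw [urnMean]
    constructor <;> nlinarith

lemma le_urnValue (hc : ∀ R, c ≤ g R) (h1 : ∀ R, g R ≤ 1) (hR : R.card ≤ b) :
    c ≤ urnValue g J b R := (urnMean_mem_Icc hc h1 _ _ _ hR).1

lemma urnValue_le_one (hc : ∀ R, c ≤ g R) (h1 : ∀ R, g R ≤ 1) (hR : R.card ≤ b) :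
    urnValue g J b R ≤ 1 := (urnMean_mem_Icc hc h1 _ _ _ hR).2

lemma urnMean_eq_one (h : ∀ R, g R = 1) (d b : ℕ) (R : Finset ℕ) : urnMean g d b R = 1 := by
  induction d generalizing b R with
  | zero => exact h R
  | succ d ih => rw [urnMean, ih, ih]; ring

lemma measurable_urnValue {X : Type*} [MeasurableSpace X] {G : X → Finset ℕ → ℝ}
    (hG : ∀ R, Measurable fun q => G q R) (J b : ℕ) (R : Finset ℕ) :
    Measurable fun q => urnValue (G q) J b R := by
  simp only [urnValue]
  generalize J - b = d
  induction d generalizing b R with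
  | zero => exact hG R
  | succ d ih => exact ((ih _ _).const_mul _).add ((ih _ _).const_mul _)

end Urn

/-! ### The exponential martingale -/

/-- Test functions of the removal time, the label and the set of ranks of the separated vertices,
which depend only on the first `J` ranks and are equal to one off a bounded region. -/
structure IsTest (g : ℝ → ℕ → Finset ℕ → ℝ) (J : ℕ) (c : ℝ) : Prop where
  pos : 0 < c
  le : ∀ t k R, c ≤ g t k R
  le_one : ∀ t k R, g t k R ≤ 1
  meas : ∀ k R, Measurable fun t => g t k R
  congr : ∀ t k (R R' : Finset ℕ), (∀ a < J, a ∈ R ↔ a ∈ R') → g t k R = g t k R'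
  one_of_time : ∀ t k R, t ∉ Set.Icc (0 : ℝ) J → g t k R = 1
  one_of_label : ∀ t k R, J ≤ k → g t k R = 1
  one_of_red : ∀ t k (R : Finset ℕ), (∀ a < J, a ∉ R) → g t k R = 1

/-- The mean of `g` for a cut at time `t` which separates the vertex of rank `j`, in the block with
label `k`, from the vertices of lower ranks. -/
def rate (g : ℝ → ℕ → Finset ℕ → ℝ) (J : ℕ) (t : ℝ) (k j : ℕ) : ℝ :=
  urnValue (g t k) J (j + 1) {j}

/-- The rate seen by the vertex `n` when it is attached to `v`. -/
def vertexRate (g : ℝ → ℕ → Finset ℕ → ℝ) (J : ℕ) (x : Config) (n v : ℕ) (t : ℝ) : ℝ :=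
  rate g J t (label x t v) (blockSize x n t v)

/-- The conditional mean of `g` at the removal of the edge of `i`, given the vertices below `n`. -/
def factor (g : ℝ → ℕ → Finset ℕ → ℝ) (J : ℕ) (x : Config) (i n : ℕ) : ℝ :=
  urnValue (g (x i).2 (label x (x i).2 i)) J (Nat.count (InBlock x i) n) (cutRanks x i n)

/-- The compensator of the vertex `i`. -/
def compensator (g : ℝ → ℕ → Finset ℕ → ℝ) (J : ℕ) (x : Config) (i : ℕ) : ℝ :=
  ∫ t in (0 : ℝ)..(x i).2, (1 - vertexRate g J x i (x i).1 t)

/-- The exponential martingale. -/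
def expMart (g : ℝ → ℕ → Finset ℕ → ℝ) (J : ℕ) (x : Config) (n : ℕ) : ℝ :=
  (∏ i ∈ Finset.Ico 1 n, factor g J x i n) *
    Real.exp (∑ i ∈ Finset.Ico 1 n, compensator g J x i)

section Mart

variable {g : ℝ → ℕ → Finset ℕ → ℝ} {J : ℕ} {c : ℝ} {x x' : Config} {n i v : ℕ}

namespace IsTest

lemma rate_mem (hg : IsTest g J c) (t : ℝ) (k j : ℕ) : c ≤ rate g J t k j ∧ rate g J t k j ≤ 1 :=
  ⟨le_urnValue (hg.le t k) (hg.le_one t k) (by simp),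
    urnValue_le_one (hg.le t k) (hg.le_one t k) (by simp)⟩

/-- All the separated vertices then have rank at least `J`, out of sight of the test function. With
`rate_eq_one_of_label`, this leaves finitely many relevant places. -/
lemma rate_eq_one_of_rank (hg : IsTest g J c) (t : ℝ) (k : ℕ) {j : ℕ} (hj : J ≤ j) :
    rate g J t k j = 1 := by
  rw [rate, urnValue_of_le (by omega)]
  exact hg.one_of_red _ _ _ fun a ha => by simp; omega

lemma rate_eq_one_of_label (hg : IsTest g J c) (t : ℝ) {k : ℕ} (hk : J ≤ k) (j : ℕ) :
    rate g J t k j = 1 := urnMean_eq_one (fun R => hg.one_of_label t k R hk) _ _ _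

lemma rate_eq_one_of_time (hg : IsTest g J c) {t : ℝ} (ht : t ∉ Set.Icc (0 : ℝ) J) (k j : ℕ) :
    rate g J t k j = 1 := urnMean_eq_one (fun R => hg.one_of_time t k R ht) _ _ _

lemma factor_mem (hg : IsTest g J c) (x : Config) (i n : ℕ) :
    c ≤ factor g J x i n ∧ factor g J x i n ≤ 1 :=
  ⟨le_urnValue (hg.le _ _) (hg.le_one _ _) (card_cutRanks_le x i n),
    urnValue_le_one (hg.le _ _) (hg.le_one _ _) (card_cutRanks_le x i n)⟩

lemma measurable_rate (hg : IsTest g J c) (k j : ℕ) : Measurable fun t => rate g J t k j :=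
  measurable_urnValue (fun R => hg.meas k R) _ _ _

lemma measurable_vertexRate' {X : Type*} [MeasurableSpace X] {Y : X → Config} {T : X → ℝ}
    (hg : IsTest g J c) (hY : Measurable Y) (hT : Measurable T) (n v : ℕ) :
    Measurable fun q => vertexRate g J (Y q) n v (T q) :=
  measurable_eval_countable (H := fun k q => rate g J (T q) k (blockSize (Y q) n (T q) v))
    (measurable_label hY hT v) fun k =>
      measurable_eval_countable (H := fun j q => rate g J (T q) k j)
        (measurable_blockSize hY hT n v) fun j => (hg.measurable_rate k j).comp hT

lemma measurable_vertexRate (hg : IsTest g J c) (x : Config) (n v : ℕ) :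
    Measurable (vertexRate g J x n v) :=
  hg.measurable_vertexRate' measurable_const measurable_id n v

lemma measurable_factor (hg : IsTest g J c) (i n : ℕ) :
    Measurable fun x => factor g J x i n := by
  let _ : MeasurableSpace (Finset ℕ) := ⊤
  have : MeasurableSingletonClass (Finset ℕ) := ⟨fun _ => trivial⟩
  have hY : Measurable fun x : Config => x := measurable_id
  refine measurable_eval_countable (H := fun R x => urnValue (g (x i).2 (label x (x i).2 i)) J
    (Nat.count (InBlock x i) n) R) (measurable_cutRanks hY i n) fun R => ?_
  refine measurable_eval_countable (H := fun b x => urnValue (g (x i).2 (label x (x i).2 i)) J b R)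
    (measurable_count (measurableSet_inBlock hY i) n) fun b => ?_
  refine measurable_eval_countable (H := fun k (x : Config) => urnValue (g (x i).2 k) J b R)
    (measurable_label hY (measurable_snd_apply hY i) i) fun k => ?_
  exact measurable_urnValue (fun R => (hg.meas k R).comp (measurable_snd_apply hY i)) _ _ _

lemma measurable_compensator (hg : IsTest g J c) (i : ℕ) :
    Measurable fun x => compensator g J x i := by
  have hY : Measurable fun q : Config × ℝ => q.1 := measurable_fst
  have h1 : Measurable fun q : Config × ℝ => 1 - vertexRate g J q.1 i (q.1 i).1 q.2 :=
    measurable_const.sub (measurable_eval_countable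
      (H := fun v (q : Config × ℝ) => vertexRate g J q.1 i v q.2) (measurable_fst_apply hY i)
      fun v => hg.measurable_vertexRate' hY measurable_snd i v)
  -- The removal time of an arbitrary configuration may be negative, so both halves of the oriented
  -- integral are needed.
  simp only [compensator, intervalIntegral, ← integral_indicator measurableSet_Ioc]
  refine Measurable.sub ?_ ?_
  · refine (StronglyMeasurable.integral_prod_right (f := fun (x : Config) (t : ℝ) =>
      (Set.Ioc 0 (x i).2).indicator (fun t => 1 - vertexRate g J x i (x i).1 t) t) ?_).measurable
    refine (Measurable.ite (p := fun q : Config × ℝ => q.2 ∈ Set.Ioc 0 (q.1 i).2) ?_ h1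
      measurable_const).stronglyMeasurable
    exact (measurableSet_lt measurable_const measurable_snd).inter
      (measurableSet_le measurable_snd (measurable_snd_apply hY i))
  · refine (StronglyMeasurable.integral_prod_right (f := fun (x : Config) (t : ℝ) =>
      (Set.Ioc (x i).2 0).indicator (fun t => 1 - vertexRate g J x i (x i).1 t) t) ?_).measurable
    refine (Measurable.ite (p := fun q : Config × ℝ => q.2 ∈ Set.Ioc (q.1 i).2 0) ?_ h1
      measurable_const).stronglyMeasurable
    exact (measurableSet_lt (measurable_snd_apply hY i) measurable_snd).inter
      (measurableSet_le measurable_snd measurable_const)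

lemma measurable_expMart (hg : IsTest g J c) (n : ℕ) : Measurable fun x => expMart g J x n :=
  (Finset.measurable_prod _ fun i _ => hg.measurable_factor i n).mul
    (Real.measurable_exp.comp (Finset.measurable_sum _ fun i _ => hg.measurable_compensator i))

end IsTest

lemma vertexRate_congr (h : ∀ j < n, x j = x' j) (hv : v < n) :
    vertexRate g J x n v = vertexRate g J x' n v := by
  funext t
  rw [vertexRate, vertexRate, label_congr h hv, blockSize_congr h hv le_rfl]

/-- The ratio by which the factor of `i` changes when the next vertex joins `v`. -/
def factorRatio (g : ℝ → ℕ → Finset ℕ → ℝ) (J : ℕ) (x : Config) (n i v : ℕ) : ℝ :=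
  if InBlock x i v then
    urnValue (g (x i).2 (label x (x i).2 i)) J (Nat.count (InBlock x i) n + 1)
      (if Cut x i v then insert (Nat.count (InBlock x i) n) (cutRanks x i n)
        else cutRanks x i n) / factor g J x i n
  else 1

namespace IsTest

/-- At the cut of `i` the new vertex belongs to the split block exactly when its edge is still
present and its parent `v` belongs to that block; it then lies on the side of `v`. So it acts as the
next ball of the urn, or not at all. -/
lemma factor_update (hg : IsTest g J c) (hi : i < n) (hv : v < n) (τ : ℝ) :
    factor g J (Function.update x n (v, τ)) i (n + 1) =
      factor g J x i n * if (x i).2 ≤ τ then factorRatio g J x n i v else 1 := by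
  have hpos : factor g J x i n ≠ 0 := (hg.pos.trans_le (hg.factor_mem x i n).1).ne'
  have hc : ∀ j < n, Function.update x n (v, τ) j = x j :=
    fun j hj => Function.update_of_ne hj.ne _ _
  rw [factor, Function.update_of_ne hi.ne, label_congr hc hi, Nat.count_succ, cutRanks_succ,
    cutRanks_congr hc hi, count_congr fun w hw => inBlock_congr hc hi hw]
  simp only [inBlock_update_self hi hv, cut_update_self hi hv, factorRatio]
  by_cases h1 : (x i).2 ≤ τ
  · by_cases h2 : InBlock x i v
    · simp only [h1, h2, true_and, if_true]
      field_simp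
    · have h3 : ¬ Cut x i v := fun h => h2 h.inBlock
      simp [h1, h2, h3, factor]
  · simp [h1, factor]

/-- Among the `b` vertices of the block, `R.card` are on the separated side. A uniform `v` in the
block is thus a draw from the urn, and harmonicity of the urn value says that the ratio has mean
one. -/
lemma sum_factorRatio (hg : IsTest g J c) (hi : i < n) :
    ∑ v ∈ (Finset.range n).filter (InBlock x i), (factorRatio g J x n i v - 1) = 0 := by
  have hpos : factor g J x i n ≠ 0 := (hg.pos.trans_le (hg.factor_mem x i n).1).ne'
  set b := Nat.count (InBlock x i) n with hb
  set R := cutRanks x i n with hR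
  set G := g (x i).2 (label x (x i).2 i) with hG
  have hfac : factor g J x i n = urnValue G J b R := rfl
  -- The block contains `i` itself, and `i < n`.
  have hb0 : 0 < b := by
    have : Nat.count (InBlock x i) i < b := Nat.count_strict_mono (p := InBlock x i) rfl hi
    omega
  have hterm : ∀ v ∈ (Finset.range n).filter (InBlock x i), factorRatio g J x n i v =
      if Cut x i v then urnValue G J (b + 1) (insert b R) / factor g J x i n
        else urnValue G J (b + 1) R / factor g J x i n := by
    intro v hv
    rw [factorRatio, if_pos (Finset.mem_filter.1 hv).2]
    split_ifs <;> rfl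
  have hcardb : ((Finset.range n).filter (InBlock x i)).card = b := by
    rw [hb, Nat.count_eq_card_filter_range]
  have hcardR : (((Finset.range n).filter (InBlock x i)).filter (Cut x i)).card = R.card := by
    rw [hR, card_cutRanks, Finset.filter_filter]
    congr 1
    exact Finset.filter_congr fun w _ => ⟨fun h => h.2, fun h => ⟨h.inBlock, h⟩⟩
  have hcardN : ((((Finset.range n).filter (InBlock x i)).filter fun w => ¬ Cut x i w).card : ℝ) =
      b - R.card := by
    have := Finset.card_filter_add_card_filter_not (s := (Finset.range n).filter (InBlock x i))
      (Cut x i)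
    rw [hcardb, hcardR] at this
    rw [← this]; push_cast; ring
  rw [Finset.sum_sub_distrib, Finset.sum_congr rfl hterm, Finset.sum_ite, Finset.sum_const,
    Finset.sum_const, Finset.sum_const, nsmul_eq_mul, nsmul_eq_mul, nsmul_eq_mul, hcardb, hcardN,
    hcardR]
  have hh := urnValue_harmonic (R := R) (hg.congr (x i).2 (label x (x i).2 i)) hb0
  rw [hfac] at hpos ⊢
  rw [mul_div_assoc', mul_div_assoc', ← add_div, hh, mul_div_assoc, div_self hpos]
  ring

/-- The one-step identity for the exponential martingale. -/
theorem sum_integral_expMart_update (hg : IsTest g J c) (hn : 1 ≤ n)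
    (hpar : ∀ i ∈ Finset.Ico 1 n, (x i).1 < i) (hpos : ∀ i ∈ Finset.Ico 1 n, 0 < (x i).2)
    (hinj : Set.InjOn (fun i => (x i).2) (Finset.Ico 1 n : Finset ℕ)) :
    ∑ v ∈ Finset.range n, ∫ τ in Set.Ioi (0 : ℝ),
      Real.exp (-τ) * expMart g J (Function.update x n (v, τ)) (n + 1) =
      n * expMart g J x n := by
  have hrate : ∀ v t, c ≤ vertexRate g J x n v t ∧ vertexRate g J x n v t ≤ 1 :=
    fun v t => hg.rate_mem _ _ _
  have hii : ∀ v s t, IntervalIntegrable (vertexRate g J x n v) volume s t := fun v s t =>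
    intervalIntegrable_of_mem_Icc (hg.measurable_vertexRate x n v) hg.pos
      (fun t => (hrate v t).1) (fun t => (hrate v t).2) s t
  -- The new compensator is `τ` minus the integrated rate, so `exp (-τ)` cancels. With the new
  -- factor, what remains is the density at `τ` of a lifetime with hazard rate `vertexRate`.
  have key : ∀ v ∈ Finset.range n, ∀ τ ∈ Set.Ioi (0 : ℝ),
      Real.exp (-τ) * expMart g J (Function.update x n (v, τ)) (n + 1) =
      expMart g J x n * ((∏ i ∈ Finset.Ico 1 n with (x i).2 ≤ τ, factorRatio g J x n i v) *
        (vertexRate g J x n v τ * Real.exp (-∫ u in (0 : ℝ)..τ, vertexRate g J x n v u))) := by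
    intro v hv τ hτ
    rw [Finset.mem_range] at hv
    set x' := Function.update x n (v, τ) with hx'
    have hc : ∀ j < n, x' j = x j := fun j hj => Function.update_of_ne hj.ne _ _
    have hxn : x' n = (v, τ) := Function.update_self _ _ _
    have hprod : ∏ i ∈ Finset.Ico 1 n, factor g J x' i (n + 1) =
        (∏ i ∈ Finset.Ico 1 n, factor g J x i n) *
          ∏ i ∈ Finset.Ico 1 n with (x i).2 ≤ τ, factorRatio g J x n i v := by
      rw [Finset.prod_filter, ← Finset.prod_mul_distrib]
      exact Finset.prod_congr rfl fun i hi => hg.factor_update (Finset.mem_Ico.1 hi).2 hv τ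
    -- At its own cut the new vertex is alone on the separated side, and its rank is the number of
    -- older vertices in the block of `v`: this is the initial state of the urn in `rate`.
    have hlast : factor g J x' n (n + 1) = vertexRate g J x n v τ := by
      have hroot : rootAt x' τ n = rootAt x τ v := by rw [hx', rootAt_update_self hv, if_pos le_rfl]
      have hcount : Nat.count (InBlock x' n) n = blockSize x n τ v := by
        refine count_congr fun w hw => ?_
        rw [InBlock, hxn, hroot, rootAt_congr hc hw]
      have hcut : ∀ w < n, ¬ Cut x' n w := fun w hw h => absurd h.le (not_le.2 hw)
      have hranks : cutRanks x' n n = ∅ := by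
        rw [cutRanks, Finset.filter_eq_empty_iff.2 fun w hw => hcut w (Finset.mem_range.1 hw)]
        rfl
      have hlabel : label x' τ n = label x τ v := by
        rw [← label_congr hc hv]
        exact label_eq_of_rootAt_eq (by rw [hroot, rootAt_congr hc hv])
      rw [factor, hxn, Nat.count_succ, if_pos (show InBlock x' n n from rfl), cutRanks_succ,
        if_pos (cut_self x' n), hranks, hcount, hlabel]
      rfl
    have hcomp : ∀ i ∈ Finset.Ico 1 n, compensator g J x' i = compensator g J x i := by
      intro i hi
      have hin := (Finset.mem_Ico.1 hi).2
      rw [compensator, compensator, hc i hin]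
      rw [vertexRate_congr (fun j hj => hc j (hj.trans hin)) (hpar i hi)]
    have hcompn : compensator g J x' n = τ - ∫ u in (0 : ℝ)..τ, vertexRate g J x n v u := by
      rw [compensator, hxn, vertexRate_congr hc hv,
        intervalIntegral.integral_sub intervalIntegrable_const (hii v 0 τ)]
      simp
    rw [expMart, expMart, Finset.prod_Ico_succ_top hn, Finset.sum_Ico_succ_top hn, hprod, hlast,
      Finset.sum_congr rfl hcomp, hcompn, sub_eq_add_neg, Real.exp_add, Real.exp_add]
    have : Real.exp (-τ) * Real.exp τ = 1 := by rw [← Real.exp_add]; simp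
    linear_combination ((∏ i ∈ Finset.Ico 1 n, factor g J x i n) *
      (∏ i ∈ Finset.Ico 1 n with (x i).2 ≤ τ, factorRatio g J x n i v) * vertexRate g J x n v τ *
      Real.exp (∑ i ∈ Finset.Ico 1 n, compensator g J x i) *
      Real.exp (-∫ u in (0 : ℝ)..τ, vertexRate g J x n v u)) * this
  have hsum := sum_integral_hazard (Finset.range n) (Finset.Ico 1 n) (fun i => (x i).2) hpos hinj
    (fun i v => factorRatio g J x n i v) (fun v => vertexRate g J x n v) hg.pos
    (fun v _ => hg.measurable_vertexRate x n v) (fun v _ t => (hrate v t).1)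
    (fun v _ t => (hrate v t).2) ?_
  · rw [Finset.card_range] at hsum
    rw [← hsum, Finset.sum_mul]
    refine Finset.sum_congr rfl fun v hv => ?_
    rw [setIntegral_congr_fun measurableSet_Ioi (key v hv), integral_const_mul, mul_comm]
  · intro i hi
    have hin := (Finset.mem_Ico.1 hi).2
    rw [← Finset.sum_filter_add_sum_filter_not _ (InBlock x i)]
    have h0 : ∀ v ∈ (Finset.range n).filter (fun v => ¬ InBlock x i v),
        (factorRatio g J x n i v - 1) * ((∏ j ∈ Finset.Ico 1 n with (x j).2 < (x i).2,
          factorRatio g J x n j v) *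
          Real.exp (-∫ u in (0 : ℝ)..(x i).2, vertexRate g J x n v u)) = 0 := by
      intro v hv
      rw [factorRatio, if_neg (Finset.mem_filter.1 hv).2, sub_self, zero_mul]
    -- Vertices of the block split at the cut of `i` were together at all earlier times. The earlier
    -- ratios and the hazard rate up to that cut are therefore the same for `v` and `i`, and the
    -- common weight comes out of the sum.
    have h1 : ∀ v ∈ (Finset.range n).filter (InBlock x i),
        (factorRatio g J x n i v - 1) * ((∏ j ∈ Finset.Ico 1 n with (x j).2 < (x i).2,
          factorRatio g J x n j v) *
          Real.exp (-∫ u in (0 : ℝ)..(x i).2, vertexRate g J x n v u)) =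
        (factorRatio g J x n i v - 1) * ((∏ j ∈ Finset.Ico 1 n with (x j).2 < (x i).2,
          factorRatio g J x n j i) *
          Real.exp (-∫ u in (0 : ℝ)..(x i).2, vertexRate g J x n i u)) := by
      intro v hv
      have hvB : InBlock x i v := (Finset.mem_filter.1 hv).2
      have hiB : InBlock x i i := rfl
      congr 2
      · refine Finset.prod_congr rfl fun j hj => ?_
        have hji := (Finset.mem_filter.1 hj).2
        simp only [factorRatio, inBlock_iff_of_lt hji.le hvB hiB, cut_iff_of_lt hji hvB hiB]
      · congr 2
        refine intervalIntegral.integral_congr fun t ht => ?_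
        rw [Set.uIcc_of_le (hpos i hi).le] at ht
        have hr := rootAt_eq_of_le ht.2 hvB
        simp only [vertexRate, label_eq_of_rootAt_eq hr, blockSize_eq_of_rootAt_eq hr]
    rw [Finset.sum_congr rfl h0, Finset.sum_congr rfl h1, ← Finset.sum_mul,
      hg.sum_factorRatio hin]
    simp

end IsTest

end Mart

/-! ### The law of a configuration -/

instance : IsProbabilityMeasure (expMeasure 1) := isProbabilityMeasure_expMeasure one_pos

lemma expMeasure_one_eq : expMeasure 1 =
    (volume.restrict (Set.Ioi (0 : ℝ))).withDensity fun t => ENNReal.ofReal (Real.exp (-t)) := by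
  rw [← withDensity_indicator measurableSet_Ioi]
  refine withDensity_congr_ae ?_
  -- The two densities differ at `0` only, where the exponential density equals one.
  have : ∀ᵐ t : ℝ, t ≠ 0 := by simp [ae_iff, measure_singleton]
  filter_upwards [this] with t ht
  change exponentialPDF 1 t = _
  rw [exponentialPDF_eq]
  rcases lt_or_gt_of_ne ht with h | h
  · rw [if_neg (not_le.2 h), Set.indicator_of_notMem (by simpa using h.le), ENNReal.ofReal_zero]
  · rw [if_pos h.le, Set.indicator_of_mem (by exact h)]; simp

lemma measurable_ofReal_exp_neg : Measurable fun t : ℝ => ENNReal.ofReal (Real.exp (-t)) :=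
  (Real.measurable_exp.comp measurable_neg).ennreal_ofReal

lemma lintegral_expMeasure {f : ℝ → ℝ≥0∞} (hf : Measurable f) :
    ∫⁻ t, f t ∂(expMeasure 1) = ∫⁻ t in Set.Ioi 0, ENNReal.ofReal (Real.exp (-t)) * f t := by
  rw [expMeasure_one_eq, lintegral_withDensity_eq_lintegral_mul _ measurable_ofReal_exp_neg hf]
  rfl

lemma integral_expMeasure (f : ℝ → ℝ) :
    ∫ t, f t ∂(expMeasure 1) = ∫ t in Set.Ioi 0, Real.exp (-t) * f t := by
  rw [expMeasure_one_eq, integral_withDensity_eq_integral_toReal_smul measurable_ofReal_exp_neg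
    (.of_forall fun _ => ENNReal.ofReal_lt_top)]
  refine integral_congr_ae (.of_forall fun t => ?_)
  simp [ENNReal.toReal_ofReal (Real.exp_nonneg _)]

lemma expMeasure_Ici_pos (s : ℝ) : 0 < expMeasure 1 (Set.Ici s) := by
  rw [expMeasure_one_eq, withDensity_apply _ measurableSet_Ici, Measure.restrict_restrict
    measurableSet_Ici, setLIntegral_pos_iff measurable_ofReal_exp_neg]
  have : Function.support (fun t : ℝ => ENNReal.ofReal (Real.exp (-t))) = Set.univ := by
    ext t; simp [Real.exp_pos]
  rw [this, Set.univ_inter]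
  refine lt_of_lt_of_le ?_ (measure_mono (s := Set.Ioi (max s 0)) fun t (ht : max s 0 < t) =>
    ⟨(le_max_left s 0).trans ht.le, (le_max_right s 0).trans_lt ht⟩)
  simp

lemma expMeasure_Iio_pos {s : ℝ} (hs : 0 < s) : 0 < expMeasure 1 (Set.Iio s) := by
  rw [expMeasure_one_eq, withDensity_apply _ measurableSet_Iio, Measure.restrict_restrict
    measurableSet_Iio, setLIntegral_pos_iff measurable_ofReal_exp_neg]
  have : Function.support (fun t : ℝ => ENNReal.ofReal (Real.exp (-t))) = Set.univ := by
    ext t; simp [Real.exp_pos]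
  rw [this, Set.univ_inter, Set.Iio_inter_Ioi]
  simpa using hs

instance : NullSingletonClass (expMeasure 1) := by
  rw [expMeasure_one_eq]; infer_instance

instance (n : ℕ) : IsProbabilityMeasure (uniformOn (Set.Iio (n + 1))) :=
  isProbabilityMeasure_uniformOn (Set.finite_Iio _) ⟨0, by simp⟩

lemma uniformOn_Iio_eq (n : ℕ) : uniformOn (Set.Iio n) =
    (n : ℝ≥0∞)⁻¹ • Measure.count.restrict (Finset.range n : Set ℕ) := by
  rw [uniformOn, ProbabilityTheory.cond, Finset.coe_range]
  congr 2
  rw [← Finset.coe_range, Measure.count_apply_finset, Finset.card_range]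

lemma lintegral_uniformOn_Iio (n : ℕ) (f : ℕ → ℝ≥0∞) :
    ∫⁻ v, f v ∂(uniformOn (Set.Iio n)) = (n : ℝ≥0∞)⁻¹ * ∑ v ∈ Finset.range n, f v := by
  rw [uniformOn_Iio_eq, lintegral_smul_measure, lintegral_finset]
  simp

lemma integral_uniformOn_Iio (n : ℕ) (f : ℕ → ℝ) :
    ∫ v, f v ∂(uniformOn (Set.Iio n)) = (n : ℝ)⁻¹ * ∑ v ∈ Finset.range n, f v := by
  rw [uniformOn_Iio_eq, integral_smul_measure, setIntegral_finset]
  · simp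
  · have : IsFiniteMeasure (Measure.count.restrict (Finset.range n : Set ℕ)) := ⟨by simp⟩
    refine Integrable.of_bound measurable_from_nat.aestronglyMeasurable
      (∑ v ∈ Finset.range n, ‖f v‖) ((ae_restrict_mem (Finset.measurableSet _)).mono fun v hv => ?_)
    exact Finset.single_le_sum (f := fun v => ‖f v‖) (fun _ _ => norm_nonneg _) hv

/-- The law of the parent and the removal time of a vertex. -/
def vertexLaw : ℕ → Measure (ℕ × ℝ)
  | 0 => Measure.dirac (0, 0)
  | n + 1 => (uniformOn (Set.Iio (n + 1))).prod (expMeasure 1)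

instance (n : ℕ) : IsProbabilityMeasure (vertexLaw n) := by
  cases n <;> unfold vertexLaw <;> infer_instance

/-- The law of a configuration. -/
def configLaw : Measure Config := Measure.infinitePi vertexLaw

instance : IsProbabilityMeasure configLaw := by unfold configLaw; infer_instance

lemma vertexLaw_of_pos {n : ℕ} (hn : 1 ≤ n) :
    vertexLaw n = (uniformOn (Set.Iio n)).prod (expMeasure 1) := by
  obtain ⟨m, rfl⟩ : ∃ m, n = m + 1 := ⟨n - 1, by omega⟩
  rfl

lemma isProbabilityMeasure_uniformOn_Iio {n : ℕ} (hn : 1 ≤ n) :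
    IsProbabilityMeasure (uniformOn (Set.Iio n)) :=
  isProbabilityMeasure_uniformOn (Set.finite_Iio _) ⟨0, hn⟩

lemma lintegral_vertexLaw {n : ℕ} (hn : 1 ≤ n) {F : ℕ × ℝ → ℝ≥0∞} (hF : Measurable F) :
    ∫⁻ y, F y ∂(vertexLaw n) =
      (n : ℝ≥0∞)⁻¹ * ∑ v ∈ Finset.range n, ∫⁻ τ, F (v, τ) ∂(expMeasure 1) := by
  have := isProbabilityMeasure_uniformOn_Iio hn
  rw [vertexLaw_of_pos hn, lintegral_prod _ hF.aemeasurable, lintegral_uniformOn_Iio]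

lemma integral_vertexLaw {n : ℕ} (hn : 1 ≤ n) {F : ℕ × ℝ → ℝ} (hF : Integrable F (vertexLaw n)) :
    ∫ y, F y ∂(vertexLaw n) =
      (n : ℝ)⁻¹ * ∑ v ∈ Finset.range n, ∫ τ, F (v, τ) ∂(expMeasure 1) := by
  have := isProbabilityMeasure_uniformOn_Iio hn
  rw [vertexLaw_of_pos hn] at hF ⊢
  rw [integral_prod _ hF, integral_uniformOn_Iio]

/-- Resampling one coordinate does not change a product law. -/
lemma infinitePi_map_update {ι : Type*} [DecidableEq ι] {X : ι → Type*}
    [∀ i, MeasurableSpace (X i)] (ν : ∀ i, Measure (X i)) [∀ i, IsProbabilityMeasure (ν i)] (j : ι) :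
    ((Measure.infinitePi ν).prod (ν j)).map
      (fun q : (∀ i, X i) × X j => Function.update q.1 j q.2) = Measure.infinitePi ν := by
  have hm : Measurable fun q : (∀ i, X i) × X j => Function.update q.1 j q.2 := by
    refine measurable_pi_lambda _ fun i => ?_
    by_cases h : i = j
    · subst h; simpa using measurable_snd
    · simp only [Function.update_of_ne h]; exact (measurable_pi_apply i).comp measurable_fst
  refine Measure.eq_infinitePi ν fun s t ht => ?_
  rw [Measure.map_apply hm (MeasurableSet.pi s.countable_toSet fun i _ => ht i)]
  by_cases hj : j ∈ s
  · have : (fun q : (∀ i, X i) × X j => Function.update q.1 j q.2) ⁻¹' (Set.pi s t) =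
        (Set.pi (s.erase j) t) ×ˢ (t j) := by
      ext q
      simp only [Set.mem_preimage, Set.mem_pi, Set.mem_prod, Finset.mem_coe, Finset.mem_erase]
      constructor
      · intro h
        refine ⟨fun i hi => by simpa [hi.1] using h i hi.2, by simpa using h j hj⟩
      · rintro ⟨h1, h2⟩ i hi
        by_cases h : i = j
        · subst h; simpa using h2
        · simpa [h] using h1 i ⟨h, hi⟩
    rw [this, Measure.prod_prod, Measure.infinitePi_pi _ fun i _ => ht i, Finset.prod_erase_mul _ _ hj]
  · have : (fun q : (∀ i, X i) × X j => Function.update q.1 j q.2) ⁻¹' (Set.pi s t) =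
        (Set.pi s t) ×ˢ Set.univ := by
      ext q
      simp only [Set.mem_preimage, Set.mem_pi, Set.mem_prod, Finset.mem_coe, Set.mem_univ, and_true]
      refine forall₂_congr fun i hi => ?_
      have : i ≠ j := fun h => hj (h ▸ hi)
      simp [this]
    rw [this, Measure.prod_prod, Measure.infinitePi_pi _ fun i _ => ht i, measure_univ, mul_one]

lemma measurable_update_config (n : ℕ) :
    Measurable fun q : Config × (ℕ × ℝ) => Function.update q.1 n q.2 := by
  refine measurable_pi_lambda _ fun i => ?_
  by_cases h : i = n
  · subst h; simpa using measurable_snd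
  · simp only [Function.update_of_ne h]; exact (measurable_pi_apply i).comp measurable_fst

/-- Integrating over a fresh copy of the coordinate `n` plays the part of conditioning on all the
others. -/
lemma lintegral_configLaw_update (n : ℕ) {F : Config → ℝ≥0∞} (hF : Measurable F) :
    ∫⁻ x, F x ∂configLaw = ∫⁻ x, ∫⁻ y, F (Function.update x n y) ∂(vertexLaw n) ∂configLaw := by
  conv_lhs => rw [configLaw, ← infinitePi_map_update vertexLaw n,
    lintegral_map hF (measurable_update_config n)]
  exact lintegral_prod _ (hF.comp (measurable_update_config n)).aemeasurable

lemma integral_configLaw_update (n : ℕ) {F : Config → ℝ} (hF : Measurable F) {C : ℝ}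
    (hC : ∀ x, ‖F x‖ ≤ C) :
    ∫ x, F x ∂configLaw = ∫ x, ∫ y, F (Function.update x n y) ∂(vertexLaw n) ∂configLaw := by
  conv_lhs => rw [configLaw, ← infinitePi_map_update vertexLaw n,
    integral_map (measurable_update_config n).aemeasurable hF.aestronglyMeasurable]
  exact integral_prod _ (Integrable.of_bound
    (hF.comp (measurable_update_config n)).aestronglyMeasurable C (.of_forall fun q => hC _))

/-- The properties of a typical configuration. -/
structure IsGood (x : Config) : Prop where
  parent_lt : ∀ n, 1 ≤ n → (x n).1 < n
  time_pos : ∀ n, 1 ≤ n → 0 < (x n).2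
  time_inj : Set.InjOn (fun n => (x n).2) (Set.Ici 1)
  infinite_children : ∀ (v : ℕ) (s : ℝ), {w | (x w).1 = v ∧ s ≤ (x w).2}.Infinite
  infinite_early : ∀ s : ℝ, 0 < s → {w | (x w).2 < s}.Infinite

/-! ### Almost sure properties of a configuration. -/

lemma ae_configLaw_apply (n : ℕ) {Q : ℕ × ℝ → Prop} (h : ∀ᵐ y ∂(vertexLaw n), Q y) :
    ∀ᵐ x ∂configLaw, Q (x n) :=
  (measurePreserving_eval_infinitePi vertexLaw n).quasiMeasurePreserving.ae h

/-- The second Borel-Cantelli lemma for the coordinates. -/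
lemma ae_infinite_of_tsum_eq_top {A : ℕ → Set (ℕ × ℝ)} (hA : ∀ n, MeasurableSet (A n))
    (h : ∑' n, vertexLaw n (A n) = ∞) : ∀ᵐ x ∂configLaw, {n | x n ∈ A n}.Infinite := by
  have hind : iIndepFun (fun (n : ℕ) (x : Config) => x n) configLaw :=
    iIndepFun_infinitePi (X := fun _ y => y) fun _ => measurable_id
  have hset : iIndepSet (fun n => (fun x : Config => x n) ⁻¹' A n) configLaw := by
    rw [iIndepSet_iff_meas_biInter fun n => measurable_pi_apply n (hA n)]
    intro s
    exact (iIndepFun_iff_measure_inter_preimage_eq_mul.1 hind) s fun n _ => hA n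
  have hlaw : ∀ n, configLaw ((fun x : Config => x n) ⁻¹' A n) = vertexLaw n (A n) := fun n =>
    (measurePreserving_eval_infinitePi vertexLaw n).measure_preimage (hA n).nullMeasurableSet
  have h1 := measure_limsup_eq_one (fun n => measurable_pi_apply n (hA n)) hset
    (by simpa only [hlaw] using h)
  have hms : MeasurableSet (limsup (fun n => (fun x : Config => x n) ⁻¹' A n) atTop) :=
    MeasurableSet.measurableSet_limsup fun n => measurable_pi_apply n (hA n)
  filter_upwards [(mem_ae_iff_prob_eq_one hms).2 h1] with x hx
  rw [mem_limsup_iff_frequently_mem] at hx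
  exact Nat.frequently_atTop_iff_infinite.1 hx

/-- For `n > v` the term is a positive constant divided by `n`, and the harmonic series diverges. -/
lemma tsum_vertexLaw_child (v N : ℕ) :
    ∑' n, vertexLaw n ({v} ×ˢ Set.Ici (N : ℝ)) = ∞ := by
  have h1 : ∀ n, v < n → vertexLaw n ({v} ×ˢ Set.Ici (N : ℝ)) =
      (n : ℝ≥0∞)⁻¹ * expMeasure 1 (Set.Ici (N : ℝ)) := by
    intro n hn
    have := isProbabilityMeasure_uniformOn_Iio (n := n) (by omega)
    rw [vertexLaw_of_pos (by omega), Measure.prod_prod, uniformOn_Iio_eq]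
    congr 1
    simp [Measure.restrict_apply, hn]
  by_contra hne
  have h2 : ∑' n : ℕ, (((n + (v + 1) : ℕ) : ℝ≥0∞)⁻¹ * expMeasure 1 (Set.Ici (N : ℝ))) ≠ ∞ := by
    refine ne_top_of_le_ne_top hne ?_
    rw [tsum_congr fun n => (h1 (n + (v + 1)) (by omega)).symm]
    exact ENNReal.tsum_comp_le_tsum_of_injective (add_left_injective (v + 1)) _
  rw [ENNReal.tsum_mul_right] at h2
  have h3 : ∑' n : ℕ, ((n + (v + 1) : ℕ) : ℝ≥0∞)⁻¹ ≠ ∞ := fun h => h2 (by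
    rw [h, ENNReal.top_mul (expMeasure_Ici_pos _).ne'])
  have h4 := ENNReal.summable_toReal h3
  have h5 : Summable fun n : ℕ => ((n + (v + 1) : ℕ) : ℝ)⁻¹ := by
    refine h4.congr fun n => ?_
    rw [ENNReal.toReal_inv, ENNReal.toReal_natCast]
  exact Real.not_summable_natCast_inv
    ((summable_nat_add_iff (f := fun n : ℕ => (n : ℝ)⁻¹) (v + 1)).1 h5)

/-- The terms with `n ≥ 1` are all equal to the same positive constant. -/
lemma tsum_vertexLaw_early {s : ℝ} (hs : 0 < s) :
    ∑' n, vertexLaw n (Set.univ ×ˢ Set.Iio s) = ∞ := by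
  by_contra hne
  have h2 : ∑' _n : ℕ, expMeasure 1 (Set.Iio s) ≠ ∞ := by
    refine ne_top_of_le_ne_top hne (le_trans (le_of_eq ?_)
      (ENNReal.tsum_comp_le_tsum_of_injective (add_left_injective 1) _))
    refine tsum_congr fun n => ?_
    have := isProbabilityMeasure_uniformOn_Iio (n := n + 1) (by omega)
    rw [vertexLaw_of_pos (by omega), Measure.prod_prod, measure_univ, one_mul]
  exact h2 (ENNReal.tsum_const_eq_top_of_ne_zero (expMeasure_Iio_pos hs).ne')

theorem ae_isGood : ∀ᵐ x ∂configLaw, IsGood x := by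
  have h1 : ∀ᵐ x ∂configLaw, ∀ n, 1 ≤ n → (x n).1 < n := by
    rw [ae_all_iff]; intro n
    rw [eventually_imp_distrib_left]; intro hn
    refine ae_configLaw_apply n (Q := fun y => y.1 < n) ?_
    have := isProbabilityMeasure_uniformOn_Iio hn
    rw [vertexLaw_of_pos hn]
    refine Measure.quasiMeasurePreserving_fst.ae (p := fun v => v < n) ?_
    rw [ae_iff, uniformOn_eq_zero_iff (Set.finite_Iio _)]
    ext; simp
  have h2 : ∀ᵐ x ∂configLaw, ∀ n, 1 ≤ n → 0 < (x n).2 := by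
    rw [ae_all_iff]; intro n
    rw [eventually_imp_distrib_left]; intro hn
    refine ae_configLaw_apply n (Q := fun y => 0 < y.2) ?_
    have := isProbabilityMeasure_uniformOn_Iio hn
    rw [vertexLaw_of_pos hn]
    refine Measure.quasiMeasurePreserving_snd.ae (p := fun t => (0 : ℝ) < t) ?_
    rw [expMeasure_one_eq]
    exact (withDensity_absolutelyContinuous _ _).ae_le (ae_restrict_mem measurableSet_Ioi)
  have h3 : ∀ᵐ x ∂configLaw, ∀ n m, 1 ≤ n → 1 ≤ m → n ≠ m → (x n).2 ≠ (x m).2 := by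
    rw [ae_all_iff]; intro n
    rw [ae_all_iff]; intro m
    simp only [eventually_imp_distrib_left]
    intro hn hm hnm
    have hmap := Measure.infinitePi_map_eval_prod (P := vertexLaw) hnm
    have hpair : ∀ᵐ z ∂((vertexLaw n).prod (vertexLaw m)), z.1.2 ≠ z.2.2 := by
      have hms : MeasurableSet {z : (ℕ × ℝ) × (ℕ × ℝ) | z.1.2 ≠ z.2.2} :=
        (measurableSet_eq_fun (measurable_snd.comp measurable_fst)
          (measurable_snd.comp measurable_snd)).compl
      rw [Measure.ae_prod_iff_ae_ae hms]
      refine .of_forall fun y => ?_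
      have := isProbabilityMeasure_uniformOn_Iio hm
      rw [vertexLaw_of_pos hm]
      refine Measure.quasiMeasurePreserving_snd.ae (p := fun t => y.2 ≠ t) ?_
      rw [ae_iff]
      simp
    rw [← hmap] at hpair
    exact ae_of_ae_map (f := fun x : Config => (x n, x m))
      (p := fun z => z.1.2 ≠ z.2.2) (by fun_prop) hpair
  -- Integer thresholds keep the union of null sets countable; monotonicity in the threshold gives
  -- the real ones.
  have h4 : ∀ᵐ x ∂configLaw, ∀ v N : ℕ, {w | x w ∈ ({v} : Set ℕ) ×ˢ Set.Ici (N : ℝ)}.Infinite := by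
    rw [ae_all_iff]; intro v
    rw [ae_all_iff]; intro N
    exact ae_infinite_of_tsum_eq_top (fun _ => (measurableSet_singleton v).prod measurableSet_Ici)
      (tsum_vertexLaw_child v N)
  have h5 : ∀ᵐ x ∂configLaw, ∀ N : ℕ,
      {w | x w ∈ (Set.univ : Set ℕ) ×ˢ Set.Iio (1 / ((N : ℝ) + 1))}.Infinite := by
    rw [ae_all_iff]; intro N
    exact ae_infinite_of_tsum_eq_top (fun _ => MeasurableSet.univ.prod measurableSet_Iio)
      (tsum_vertexLaw_early (by positivity))
  filter_upwards [h1, h2, h3, h4, h5] with x h1 h2 h3 h4 h5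
  refine ⟨h1, h2, fun n hn m hm h => ?_, fun v s => ?_, fun s hs => ?_⟩
  · by_contra hnm
    exact h3 n m hn hm hnm h
  · obtain ⟨N, hN⟩ := exists_nat_ge s
    refine (h4 v N).mono fun w hw => ?_
    exact ⟨hw.1, hN.trans hw.2⟩
  · obtain ⟨N, hN⟩ := exists_nat_one_div_lt hs
    refine (h5 N).mono fun w hw => ?_
    exact lt_trans hw.2 hN

/-! ### The vertices present at a given time -/

/-- The label of the block and the rank in the block of the vertex `i` just before `t`. -/
def place (x : Config) (t : ℝ) (i : ℕ) : ℕ × ℕ := (label x t i, blockSize x i t i)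

section Place

variable {x : Config} {t : ℝ} {i v : ℕ}

lemma IsGood.rootAt_of_alive (hx : IsGood x) (hi : 1 ≤ i) (ht : t ≤ (x i).2) :
    rootAt x t i = rootAt x t (x i).1 := root_of_mem ht (hx.parent_lt i hi)

lemma rootAt_of_lt (ht : (x i).2 < t) : rootAt x t i = i :=
  root_of_notMem (by simpa [alive] using ht)

/-- While its edge is present, `i` shares the block of its parent; `blockSize x i` counts only
vertices below `i`. So the place of `i` can be read off its parent and the vertices older than `i`.
-/
lemma IsGood.place_eq (hx : IsGood x) (hi : 1 ≤ i) (ht : t ≤ (x i).2) :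
    (label x t (x i).1, blockSize x i t (x i).1) = place x t i := by
  have h := hx.rootAt_of_alive hi ht
  rw [place, label_eq_of_rootAt_eq h, blockSize_eq_of_rootAt_eq h]

/-- The label determines the root of the block, and the rank then determines the vertex within it.
-/
lemma place_injective (x : Config) (t : ℝ) : Function.Injective (place x t) := by
  intro i j h
  have h1 : rootAt x t i = rootAt x t j := label_injective (congrArg Prod.fst h)
  have h2 : blockSize x i t i = blockSize x j t j := congrArg Prod.snd h
  rw [blockSize_eq_of_rootAt_eq h1] at h2
  exact Nat.count_injective (p := fun w => rootAt x t w = rootAt x t j) h1 rfl h2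

lemma IsGood.infinite_block (hx : IsGood x) (t : ℝ) (v : ℕ) :
    {w | rootAt x t w = rootAt x t v}.Infinite := by
  refine ((hx.infinite_children v t).sdiff (Set.finite_singleton 0)).mono fun w hw => ?_
  have hw1 : 1 ≤ w := Nat.one_le_iff_ne_zero.2 hw.2
  have := hx.rootAt_of_alive hw1 hw.1.2
  rwa [hw.1.1] at this

/-- Every vertex whose edge is removed before `t` is the least one of its block. -/
lemma IsGood.infinite_roots (hx : IsGood x) (ht : 0 < t) : {m | rootAt x t m = m}.Infinite :=
  (hx.infinite_early t ht).mono fun _ hw => rootAt_of_lt hw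

lemma IsGood.infinite_inBlock (hx : IsGood x) (i : ℕ) : {w | InBlock x i w}.Infinite :=
  hx.infinite_block _ i

/-- The parent is an older vertex of the same block. -/
lemma blockSize_pos (hi : 1 ≤ i) (ht : t ≤ (x i).2) (hx : IsGood x) : 1 ≤ blockSize x i t i := by
  have h := hx.rootAt_of_alive hi ht
  have h1 : Nat.count (fun w => rootAt x t w = rootAt x t i) (x i).1 <
      Nat.count (fun w => rootAt x t w = rootAt x t i) i :=
    Nat.count_strict_mono h.symm (hx.parent_lt i hi)
  rw [blockSize]; omega

/-- Every place of positive rank is occupied. -/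
lemma IsGood.exists_place (hx : IsGood x) (ht : 0 < t) (k : ℕ) {j : ℕ} (hj : 1 ≤ j) :
    ∃ i, 1 ≤ i ∧ t ≤ (x i).2 ∧ place x t i = (k, j) := by
  classical
  set r := Nat.nth (fun m => rootAt x t m = m) k with hr
  have hroot : rootAt x t r = r := Nat.nth_mem_of_infinite (hx.infinite_roots ht) k
  have hcr : Nat.count (fun m => rootAt x t m = m) r = k :=
    Nat.count_nth_of_infinite (hx.infinite_roots ht) k
  set i := Nat.nth (fun w => rootAt x t w = rootAt x t r) j with hi
  have hir : rootAt x t i = rootAt x t r := Nat.nth_mem_of_infinite (hx.infinite_block t r) j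
  have hci : Nat.count (fun w => rootAt x t w = rootAt x t r) i = j :=
    Nat.count_nth_of_infinite (hx.infinite_block t r) j
  -- The root is the least vertex of its block, so it has rank zero, which `1 ≤ j` excludes.
  have hne : rootAt x t i ≠ i := by
    intro h
    have h0 : Nat.count (fun w => rootAt x t w = rootAt x t r) i = 0 := by
      rw [Nat.count_eq_card_filter_range, Finset.card_eq_zero, Finset.filter_eq_empty_iff]
      intro w hw hw'
      have := rootAt_le x t w
      rw [hw', ← hir, h] at this
      exact absurd (Finset.mem_range.1 hw) (not_lt.2 this)
    omega
  refine ⟨i, ?_, ?_, ?_⟩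
  · rcases Nat.eq_zero_or_pos i with h0 | h0
    · exact absurd (by rw [h0]; exact Nat.le_zero.1 (rootAt_le x t 0)) hne
    · exact h0
  · by_contra h
    exact hne (rootAt_of_lt (not_le.1 h))
  · rw [place, label, blockSize_eq_of_rootAt_eq hir, blockSize, hci, hir, hroot, hcr]

end Place

/-! ### The deterministic limit of the sum of the compensators. -/

section Compensator

variable {g : ℝ → ℕ → Finset ℕ → ℝ} {J : ℕ} {c : ℝ} {x : Config}

/-- The places which are relevant for a test function. -/
def places (J : ℕ) : Finset (ℕ × ℕ) := Finset.range J ×ˢ Finset.Ico 1 J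

/-- The total intensity seen by a test function at time `t`. -/
def totalRate (g : ℝ → ℕ → Finset ℕ → ℝ) (J : ℕ) (t : ℝ) : ℝ :=
  ∑ q ∈ places J, (1 - rate g J t q.1 q.2)

/-- The intensity at time `t` of the places occupied by the vertices below `n`. -/
def partialRate (g : ℝ → ℕ → Finset ℕ → ℝ) (J : ℕ) (x : Config) (n : ℕ) (t : ℝ) : ℝ :=
  ∑ i ∈ Finset.Ico 1 n with t ≤ (x i).2, (1 - rate g J t (place x t i).1 (place x t i).2)

/-- Distinct vertices have distinct places, so the sum over vertices becomes a sum over occupied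
places; those outside `places J` contribute zero because the rate there is one. -/
lemma partialRate_eq (hg : IsTest g J c) (hx : IsGood x) (n : ℕ) (t : ℝ) :
    partialRate g J x n t = ∑ q ∈ places J with
      q ∈ ((Finset.Ico 1 n).filter fun i => t ≤ (x i).2).image (place x t),
        (1 - rate g J t q.1 q.2) := by
  classical
  rw [partialRate, ← Finset.sum_image (f := fun q : ℕ × ℕ => 1 - rate g J t q.1 q.2)
    (s := (Finset.Ico 1 n).filter fun i => t ≤ (x i).2) (g := place x t)
    fun _ _ _ _ h => place_injective x t h]
  symm
  refine Finset.sum_subset_zero_on_sdiff (fun q hq => (Finset.mem_filter.1 hq).2)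
    (fun q hq => ?_) fun _ _ => rfl
  rw [Finset.mem_sdiff, Finset.mem_filter, not_and'] at hq
  have hq2 := hq.2 hq.1
  obtain ⟨i, hi, rfl⟩ := Finset.mem_image.1 hq.1
  have hi1 : 1 ≤ i := (Finset.mem_Ico.1 (Finset.mem_filter.1 hi).1).1
  have hpos : 1 ≤ (place x t i).2 := blockSize_pos hi1 (Finset.mem_filter.1 hi).2 hx
  rw [places, Finset.mem_product, Finset.mem_range, Finset.mem_Ico] at hq2
  by_cases h1 : (place x t i).1 < J
  · rw [hg.rate_eq_one_of_rank, sub_self]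
    by_contra h2
    exact hq2 ⟨h1, hpos, not_le.1 h2⟩
  · rw [hg.rate_eq_one_of_label _ (not_lt.1 h1), sub_self]

lemma partialRate_mem (hg : IsTest g J c) (hx : IsGood x) (n : ℕ) (t : ℝ) :
    0 ≤ partialRate g J x n t ∧ partialRate g J x n t ≤ totalRate g J t := by
  rw [partialRate_eq hg hx]
  have h0 : ∀ q : ℕ × ℕ, 0 ≤ 1 - rate g J t q.1 q.2 := fun q =>
    sub_nonneg.2 (hg.rate_mem t q.1 q.2).2
  exact ⟨Finset.sum_nonneg fun q _ => h0 q,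
    Finset.sum_le_sum_of_subset_of_nonneg (Finset.filter_subset _ _) fun q _ _ => h0 q⟩

/-- The sequence is eventually constant: each of the finitely many relevant places is occupied by
some vertex. -/
lemma tendsto_partialRate (hg : IsTest g J c) (hx : IsGood x) {t : ℝ} (ht : 0 < t) :
    Tendsto (fun n => partialRate g J x n t) atTop (𝓝 (totalRate g J t)) := by
  refine tendsto_const_nhds.congr' ?_
  have hall : ∀ᶠ n in atTop, ∀ q ∈ places J,
      q ∈ ((Finset.Ico 1 n).filter fun i => t ≤ (x i).2).image (place x t) := by
    rw [eventually_all_finset]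
    intro q hq
    obtain ⟨i, hi, hti, hpi⟩ := hx.exists_place ht q.1
      (Finset.mem_Ico.1 (Finset.mem_product.1 hq).2).1
    filter_upwards [eventually_gt_atTop i] with n hn
    exact Finset.mem_image.2 ⟨i, Finset.mem_filter.2 ⟨Finset.mem_Ico.2 ⟨hi, hn⟩, hti⟩, hpi⟩
  filter_upwards [hall] with n hn
  rw [partialRate_eq hg hx, totalRate, Finset.filter_true_of_mem hn]

lemma totalRate_mem (hg : IsTest g J c) (t : ℝ) :
    0 ≤ totalRate g J t ∧ totalRate g J t ≤ (places J).card := by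
  refine ⟨Finset.sum_nonneg fun q _ => sub_nonneg.2 (hg.rate_mem t q.1 q.2).2, ?_⟩
  refine (Finset.sum_le_card_nsmul _ _ 1 fun q _ => ?_).trans (by simp)
  linarith [(hg.rate_mem t q.1 q.2).1, hg.pos]

lemma measurable_totalRate (hg : IsTest g J c) : Measurable (totalRate g J) :=
  Finset.measurable_sum _ fun q _ => measurable_const.sub (hg.measurable_rate q.1 q.2)

/-- Beyond time `J` the rate is one and the integrand vanishes, so all compensators are integrals
over the common interval `(0, J]` and can be summed under the integral. -/
lemma compensator_eq (hg : IsTest g J c) (hx : IsGood x) {i : ℕ} (hi : 1 ≤ i) :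
    compensator g J x i = ∫ t in Set.Ioc (0 : ℝ) J,
      if t ≤ (x i).2 then 1 - rate g J t (place x t i).1 (place x t i).2 else 0 := by
  rw [compensator, intervalIntegral.integral_of_le (hx.time_pos i hi).le]
  have h1 : ∫ t in Set.Ioc 0 (x i).2, (1 - vertexRate g J x i (x i).1 t) =
      ∫ t in Set.Ioi 0,
        if t ≤ (x i).2 then 1 - rate g J t (place x t i).1 (place x t i).2 else 0 := by
    rw [← Set.Ioi_inter_Iic, ← setIntegral_indicator measurableSet_Iic]
    refine setIntegral_congr_fun measurableSet_Ioi fun t _ => ?_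
    by_cases ht : t ≤ (x i).2
    · simp only [Set.indicator_of_mem (show t ∈ Set.Iic (x i).2 from ht), if_pos ht, vertexRate,
        ← hx.place_eq hi ht]
    · simp only [Set.indicator_of_notMem (show t ∉ Set.Iic (x i).2 from ht), if_neg ht]
  rw [h1]
  refine setIntegral_eq_of_subset_of_forall_sdiff_eq_zero measurableSet_Ioi
    (fun t ht => ht.1) fun t ht => ?_
  rw [hg.rate_eq_one_of_time, sub_self, ite_self]
  exact fun h => ht.2 ⟨ht.1, h.2⟩

lemma measurable_place_rate (hg : IsTest g J c) (x : Config) (i : ℕ) : Measurable fun t =>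
    if t ≤ (x i).2 then 1 - rate g J t (place x t i).1 (place x t i).2 else 0 :=
  Measurable.ite measurableSet_Iic
    (measurable_const.sub (hg.measurable_vertexRate x i i)) measurable_const

lemma integrableOn_place_rate (hg : IsTest g J c) (x : Config) (i : ℕ) : IntegrableOn (fun t =>
    if t ≤ (x i).2 then 1 - rate g J t (place x t i).1 (place x t i).2 else 0)
      (Set.Ioc (0 : ℝ) J) := by
  refine Integrable.of_bound (measurable_place_rate hg x i).aestronglyMeasurable 1
    (.of_forall fun t => ?_)
  have h := hg.rate_mem t (place x t i).1 (place x t i).2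
  have := hg.pos
  split_ifs
  · rw [Real.norm_of_nonneg (by linarith)]; linarith
  · simp

lemma sum_compensator_eq (hg : IsTest g J c) (hx : IsGood x) (n : ℕ) :
    ∑ i ∈ Finset.Ico 1 n, compensator g J x i =
      ∫ t in Set.Ioc (0 : ℝ) J, partialRate g J x n t := by
  simp only [partialRate, Finset.sum_filter]
  rw [integral_finsetSum _ fun i _ => integrableOn_place_rate hg x i]
  exact Finset.sum_congr rfl fun i hi => compensator_eq hg hx (Finset.mem_Ico.1 hi).1

lemma measurable_partialRate (hg : IsTest g J c) (x : Config) (n : ℕ) :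
    Measurable (partialRate g J x n) := by
  have : partialRate g J x n = fun t => ∑ i ∈ Finset.Ico 1 n,
      if t ≤ (x i).2 then 1 - rate g J t (place x t i).1 (place x t i).2 else 0 := by
    funext t; rw [partialRate, Finset.sum_filter]
  rw [this]
  exact Finset.measurable_sum _ fun i _ => measurable_place_rate hg x i

/-- This is where independence from the past enters: the limit is the same for every good
configuration, so it leaves the expectation as a constant. -/
lemma tendsto_sum_compensator (hg : IsTest g J c) (hx : IsGood x) :
    Tendsto (fun n => ∑ i ∈ Finset.Ico 1 n, compensator g J x i) atTop
      (𝓝 (∫ t in Set.Ioc (0 : ℝ) J, totalRate g J t)) := by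
  simp only [sum_compensator_eq hg hx]
  refine tendsto_integral_of_dominated_convergence (fun _ => ((places J).card : ℝ))
    (fun n => (measurable_partialRate hg x n).aestronglyMeasurable) (integrable_const _)
    (fun n => .of_forall fun t => ?_)
    ((ae_restrict_mem measurableSet_Ioc).mono fun t ht => tendsto_partialRate hg hx ht.1)
  have h := partialRate_mem hg hx n t
  rw [Real.norm_of_nonneg h.1]
  exact h.2.trans (totalRate_mem hg t).2

/-- The bound does not depend on `n`; it provides the constant that dominates the exponential
martingale. -/
lemma sum_compensator_le (hg : IsTest g J c) (hx : IsGood x) (n : ℕ) :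
    ∑ i ∈ Finset.Ico 1 n, compensator g J x i ≤ (places J).card * J := by
  rw [sum_compensator_eq hg hx]
  have := norm_setIntegral_le_of_norm_le_const (μ := volume) (s := Set.Ioc (0 : ℝ) J)
    (f := partialRate g J x n) (C := (places J).card) (by simp) fun t _ => by
      have h := partialRate_mem hg hx n t
      rw [Real.norm_of_nonneg h.1]
      exact h.2.trans (totalRate_mem hg t).2
  refine (le_abs_self _).trans (this.trans ?_)
  simp [measureReal_def]

end Compensator

/-! ### The mean of the exponential martingale -/

section Mean

variable {g : ℝ → ℕ → Finset ℕ → ℝ} {J : ℕ} {c : ℝ} {x : Config} {n : ℕ}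

/-- Valid for every configuration, good or not, at the price of a bound on the sum that grows with
`n`. It serves for integrability at fixed `n`. -/
lemma compensator_le (hg : IsTest g J c) (x : Config) (i : ℕ) : compensator g J x i ≤ J := by
  have h01 : ∀ t, 0 ≤ 1 - vertexRate g J x i (x i).1 t ∧ 1 - vertexRate g J x i (x i).1 t ≤ 1 :=
    fun t => by
      have := hg.rate_mem t (label x t (x i).1) (blockSize x i t (x i).1)
      rw [vertexRate]; constructor <;> linarith [hg.pos]
  have hii : ∀ s t, IntervalIntegrable (fun t => 1 - vertexRate g J x i (x i).1 t) volume s t :=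
    fun s t => intervalIntegrable_const.sub (intervalIntegrable_of_mem_Icc
      (hg.measurable_vertexRate x i _) hg.pos (fun t => (hg.rate_mem _ _ _).1)
      (fun t => (hg.rate_mem _ _ _).2) s t)
  rw [compensator]
  rcases le_total (x i).2 0 with h | h
  · rw [intervalIntegral.integral_symm]
    have := intervalIntegral.integral_nonneg (μ := volume) h fun t _ => (h01 t).1
    have hJ : (0 : ℝ) ≤ J := Nat.cast_nonneg _
    linarith
  · rcases le_total (x i).2 J with h2 | h2
    · have := intervalIntegral.integral_mono_on h (hii 0 (x i).2)
        (intervalIntegrable_const (c := (1 : ℝ))) fun t _ => (h01 t).2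
      simp at this
      linarith
    · rw [← intervalIntegral.integral_add_adjacent_intervals (hii 0 J) (hii J (x i).2)]
      have h3 := intervalIntegral.integral_mono_on (Nat.cast_nonneg J) (hii 0 J)
        (intervalIntegrable_const (c := (1 : ℝ))) fun t _ => (h01 t).2
      have h4 : ∫ t in (J : ℝ)..(x i).2, (1 - vertexRate g J x i (x i).1 t) = 0 := by
        rw [intervalIntegral.integral_of_le h2]
        refine setIntegral_eq_zero_of_forall_eq_zero fun t ht => ?_
        rw [vertexRate, hg.rate_eq_one_of_time, sub_self]
        exact fun h' => absurd h'.2 (not_le.2 ht.1)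
      simp at h3
      linarith

lemma expMart_nonneg (hg : IsTest g J c) (x : Config) (n : ℕ) : 0 ≤ expMart g J x n :=
  mul_nonneg (Finset.prod_nonneg fun i _ => hg.pos.le.trans (hg.factor_mem x i n).1)
    (Real.exp_nonneg _)

lemma expMart_le_exp (hg : IsTest g J c) (x : Config) (n : ℕ) :
    expMart g J x n ≤ Real.exp (∑ i ∈ Finset.Ico 1 n, compensator g J x i) :=
  mul_le_of_le_one_left (Real.exp_nonneg _) (Finset.prod_le_one
    (fun i _ => hg.pos.le.trans (hg.factor_mem x i n).1) fun i _ => (hg.factor_mem x i n).2)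

lemma norm_expMart_le (hg : IsTest g J c) (x : Config) (n : ℕ) :
    ‖expMart g J x n‖ ≤ Real.exp ((Finset.Ico 1 n).card * J) := by
  rw [Real.norm_of_nonneg (expMart_nonneg hg x n)]
  refine (expMart_le_exp hg x n).trans (Real.exp_le_exp.2 ?_)
  refine (Finset.sum_le_card_nsmul _ _ (J : ℝ) fun i _ => compensator_le hg x i).trans ?_
  rw [nsmul_eq_mul]

/-- Resampling the vertex `n` turns the one-step identity, a sum over parents and an integral over
the removal time, into equality of means. -/
lemma integral_expMart_succ (hg : IsTest g J c) (hn : 1 ≤ n) :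
    ∫ x, expMart g J x (n + 1) ∂configLaw = ∫ x, expMart g J x n ∂configLaw := by
  rw [integral_configLaw_update n (hg.measurable_expMart (n + 1))
    fun x => norm_expMart_le hg x (n + 1)]
  refine integral_congr_ae ?_
  filter_upwards [ae_isGood] with x hx
  have hmeas : Measurable fun y => expMart g J (Function.update x n y) (n + 1) :=
    (hg.measurable_expMart (n + 1)).comp
      ((measurable_update_config n).comp measurable_prodMk_left)
  rw [integral_vertexLaw hn (Integrable.of_bound hmeas.aestronglyMeasurable _
    (.of_forall fun y => norm_expMart_le hg _ _))]
  simp only [integral_expMeasure]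
  rw [hg.sum_integral_expMart_update hn (fun i hi => hx.parent_lt i (Finset.mem_Ico.1 hi).1)
    (fun i hi => hx.time_pos i (Finset.mem_Ico.1 hi).1)
    (hx.time_inj.mono fun i hi => (Finset.mem_Ico.1 hi).1)]
  have : (n : ℝ) ≠ 0 := by positivity
  field_simp

lemma integral_expMart (hg : IsTest g J c) (hn : 1 ≤ n) :
    ∫ x, expMart g J x n ∂configLaw = 1 := by
  induction n, hn using Nat.le_induction with
  | base => simp [expMart]
  | succ n hn ih => rw [integral_expMart_succ hg hn, ih]

end Mean

/-! ### The number of relevant cuts -/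

/-- The cut of `i` lies in the region where test functions may differ from one. -/
def Relevant (J : ℕ) (x : Config) (i : ℕ) : Prop :=
  1 ≤ i ∧ (x i).2 ∈ Set.Ioc (0 : ℝ) J ∧ place x (x i).2 i ∈ places J

lemma expMeasure_Ici {t : ℝ} (ht : 0 < t) :
    expMeasure 1 (Set.Ici t) = ENNReal.ofReal (Real.exp (-t)) := by
  rw [expMeasure_one_eq, withDensity_apply _ measurableSet_Ici, Measure.restrict_restrict
    measurableSet_Ici, Set.inter_eq_left.2 (Set.Ici_subset_Ioi.2 ht),
    ← ofReal_integral_eq_lintegral_ofReal, integral_Ici_eq_integral_Ioi, integral_exp_neg_Ioi]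
  · exact (integrableOn_Ici_iff_integrableOn_Ioi (by simp)).2 (integrableOn_exp_neg_Ioi t)
  · exact .of_forall fun _ => Real.exp_nonneg _

/-- The compensator formula for one exponential time. -/
lemma lintegral_expMeasure_eq_compensator {h : ℝ → ℝ≥0∞} (hh : Measurable h) :
    ∫⁻ τ, h τ ∂(expMeasure 1) =
      ∫⁻ τ, (∫⁻ t in Set.Ioi (0 : ℝ), (Set.Iic τ).indicator h t) ∂(expMeasure 1) := by
  -- By Tonelli each `t > 0` receives the weight `expMeasure 1 (Ici t) = exp (-t)`, which is also
  -- the density at `t`.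
  rw [lintegral_lintegral_swap]
  · rw [lintegral_expMeasure hh]
    refine setLIntegral_congr_fun measurableSet_Ioi fun t ht => ?_
    have : ∀ τ, (Set.Iic τ).indicator h t = (Set.Ici t).indicator (fun _ => h t) τ := fun τ => by
      by_cases htτ : t ≤ τ <;> simp [Set.indicator, htτ]
    simp only [this]
    rw [lintegral_indicator_const (measurableSet_Ici : MeasurableSet (Set.Ici t)), expMeasure_Ici ht, mul_comm]
  · have : (Function.uncurry fun (τ t : ℝ) => (Set.Iic τ).indicator h t) =
        {q : ℝ × ℝ | q.2 ≤ q.1}.indicator fun q => h q.2 := by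
      ext q; simp [Function.uncurry, Set.indicator]
    rw [this]
    exact ((hh.comp measurable_snd).indicator
      (measurableSet_le measurable_snd measurable_fst)).aemeasurable

/-- The indicator that, just before time `t`, the vertex `i` attached to `v` has a relevant
place. -/
def hit (J i v : ℕ) (x : Config) (t : ℝ) : ℝ≥0∞ :=
  (Set.Ioc (0 : ℝ) J).indicator
    (fun t => (places J : Set (ℕ × ℕ)).indicator 1 (label x t v, blockSize x i t v)) t

lemma measurable_hit (J i v : ℕ) : Measurable fun q : Config × ℝ => hit J i v q.1 q.2 := by
  have : (fun q : Config × ℝ => hit J i v q.1 q.2) = {q | q.2 ∈ Set.Ioc (0 : ℝ) J}.indicator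
      fun q => (places J : Set (ℕ × ℕ)).indicator 1 (label q.1 q.2 v, blockSize q.1 i q.2 v) := by
    ext q; simp [hit, Set.indicator]
  rw [this]
  refine Measurable.indicator ?_ (measurable_snd measurableSet_Ioc)
  exact (Measurable.of_discrete (f := (places J : Set (ℕ × ℕ)).indicator (1 : ℕ × ℕ → ℝ≥0∞))).comp
    ((measurable_label measurable_fst measurable_snd v).prodMk
      (measurable_blockSize measurable_fst measurable_snd i v))

lemma hit_congr {J i v : ℕ} {x x' : Config} (h : ∀ j < i, x j = x' j) (hv : v < i) :
    hit J i v x = hit J i v x' := by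
  funext t
  simp only [hit, label_congr h hv, blockSize_congr h hv le_rfl]

/-- Given the parent and the older vertices, `hit` is a fixed function of time, unaffected by the
removal time of `i`. So the compensator formula for one exponential variable applies. -/
lemma lintegral_hit {i : ℕ} (J : ℕ) (hi : 1 ≤ i) :
    ∫⁻ x, hit J i (x i).1 x (x i).2 ∂configLaw =
      ∫⁻ x, (∫⁻ t in Set.Ioi (0 : ℝ), (Set.Iic (x i).2).indicator (hit J i (x i).1 x) t)
        ∂configLaw := by
  have hid : Measurable fun x : Config => x := measurable_id
  have hm1 : Measurable fun x : Config => hit J i (x i).1 x (x i).2 :=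
    measurable_eval_countable (H := fun v (x : Config) => hit J i v x (x i).2)
      (measurable_fst_apply hid i)
      fun v => (measurable_hit J i v).comp (hid.prodMk (measurable_snd_apply hid i))
  have hm2 : Measurable fun x : Config =>
      ∫⁻ t in Set.Ioi (0 : ℝ), (Set.Iic (x i).2).indicator (hit J i (x i).1 x) t := by
    refine Measurable.lintegral_prod_right' (f := fun (q : Config × ℝ) =>
      (Set.Iic (q.1 i).2).indicator (hit J i (q.1 i).1 q.1) q.2) ?_
    have : (fun q : Config × ℝ => (Set.Iic (q.1 i).2).indicator (hit J i (q.1 i).1 q.1) q.2) =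
        {q | q.2 ≤ (q.1 i).2}.indicator fun q => hit J i (q.1 i).1 q.1 q.2 := by
      ext q; simp [Set.indicator]
    rw [this]
    exact (measurable_eval_countable (H := fun v (q : Config × ℝ) => hit J i v q.1 q.2)
      (measurable_fst_apply measurable_fst i) fun v => measurable_hit J i v).indicator
      (measurableSet_le measurable_snd (measurable_snd_apply measurable_fst i))
  rw [lintegral_configLaw_update i hm1, lintegral_configLaw_update i hm2]
  refine lintegral_congr fun x => ?_
  have hmu : Measurable fun y : ℕ × ℝ => Function.update x i y :=
    (measurable_update_config i).comp measurable_prodMk_left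
  refine (lintegral_vertexLaw hi (hm1.comp hmu)).trans
    (Eq.trans ?_ (lintegral_vertexLaw hi (hm2.comp hmu)).symm)
  simp only [Function.comp_apply]
  congr 1
  refine Finset.sum_congr rfl fun v hv => ?_
  have hv' := Finset.mem_range.1 hv
  have hc : ∀ τ, hit J i v (Function.update x i (v, τ)) = hit J i v x := fun τ =>
    hit_congr (fun j hj => Function.update_of_ne hj.ne _ _) hv'
  simp only [Function.update_self, hc]
  exact lintegral_expMeasure_eq_compensator ((measurable_hit J i v).comp measurable_prodMk_left)

open Classical in
lemma IsGood.indicator_relevant {x : Config} (hx : IsGood x) {J i : ℕ} (hi : 1 ≤ i) :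
    (if Relevant J x i then 1 else 0 : ℝ≥0∞) = hit J i (x i).1 x (x i).2 := by
  have hp := hx.place_eq hi le_rfl
  simp only [hit, hp, Relevant, Set.indicator, Finset.mem_coe, hi, true_and, Pi.one_apply]
  split_ifs <;> simp_all

open Classical in
/-- The mean number of relevant cuts is finite. -/
theorem lintegral_tsum_relevant (J : ℕ) :
    ∫⁻ x, ∑' i, (if Relevant J x (i + 1) then 1 else 0 : ℝ≥0∞) ∂configLaw ≤
      (places J).card * J := by
  have hid : Measurable fun x : Config => x := measurable_id
  have hm1 : ∀ i, Measurable fun x : Config => hit J i (x i).1 x (x i).2 := fun i =>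
    measurable_eval_countable (H := fun v (x : Config) => hit J i v x (x i).2)
      (measurable_fst_apply hid i)
      fun v => (measurable_hit J i v).comp (hid.prodMk (measurable_snd_apply hid i))
  calc _ = ∫⁻ x, ∑' i, hit J (i + 1) (x (i + 1)).1 x (x (i + 1)).2 ∂configLaw := by
        refine lintegral_congr_ae ?_
        filter_upwards [ae_isGood] with x hx
        exact tsum_congr fun i => hx.indicator_relevant (by omega)
    _ = ∑' i, ∫⁻ x, (∫⁻ t in Set.Ioi (0 : ℝ),
          (Set.Iic (x (i + 1)).2).indicator (hit J (i + 1) (x (i + 1)).1 x) t) ∂configLaw := by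
        rw [lintegral_tsum fun i => (hm1 (i + 1)).aemeasurable]
        exact tsum_congr fun i => lintegral_hit J (by omega)
    _ = ∫⁻ x, (∑' i, ∫⁻ t in Set.Ioi (0 : ℝ),
          (Set.Iic (x (i + 1)).2).indicator (hit J (i + 1) (x (i + 1)).1 x) t) ∂configLaw := by
        rw [lintegral_tsum]
        intro i
        refine Measurable.aemeasurable ?_
        refine Measurable.lintegral_prod_right' (f := fun (q : Config × ℝ) =>
          (Set.Iic (q.1 (i + 1)).2).indicator (hit J (i + 1) (q.1 (i + 1)).1 q.1) q.2) ?_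
        have : (fun q : Config × ℝ =>
            (Set.Iic (q.1 (i + 1)).2).indicator (hit J (i + 1) (q.1 (i + 1)).1 q.1) q.2) =
            {q | q.2 ≤ (q.1 (i + 1)).2}.indicator
              fun q => hit J (i + 1) (q.1 (i + 1)).1 q.1 q.2 := by
          ext q; simp [Set.indicator]
        rw [this]
        exact (measurable_eval_countable (H := fun v (q : Config × ℝ) => hit J (i + 1) v q.1 q.2)
          (measurable_fst_apply measurable_fst _) fun v => measurable_hit J _ v).indicator
          (measurableSet_le measurable_snd (measurable_snd_apply measurable_fst _))
    _ ≤ ∫⁻ _x, (places J).card * J ∂configLaw := by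
        refine lintegral_mono_ae ?_
        filter_upwards [ae_isGood] with x hx
        rw [← lintegral_tsum]
        · calc _ ≤ ∫⁻ t in Set.Ioi (0 : ℝ), (Set.Ioc (0 : ℝ) J).indicator
                (fun _ => ((places J).card : ℝ≥0∞)) t := by
                refine lintegral_mono fun t => ?_
                by_cases ht : t ∈ Set.Ioc (0 : ℝ) J
                · rw [Set.indicator_of_mem ht]
                  -- At a given time distinct vertices occupy distinct places, so at most `(places
                  -- J).card` of them are counted.
                  have hinj : Function.Injective fun i => place x t (i + 1) :=
                    (place_injective x t).comp (add_left_injective 1)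
                  calc _ ≤ ∑' i, (places J : Set (ℕ × ℕ)).indicator (1 : ℕ × ℕ → ℝ≥0∞)
                        (place x t (i + 1)) := by
                        refine ENNReal.tsum_le_tsum fun i => ?_
                        by_cases h : t ≤ (x (i + 1)).2
                        · rw [Set.indicator_of_mem (show t ∈ Set.Iic (x (i + 1)).2 from h), hit,
                            Set.indicator_of_mem ht, hx.place_eq (by omega) h]
                        · rw [Set.indicator_of_notMem (show t ∉ Set.Iic (x (i + 1)).2 from h)]
                          exact zero_le
                    _ ≤ ∑' q, (places J : Set (ℕ × ℕ)).indicator (1 : ℕ × ℕ → ℝ≥0∞) q :=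
                        ENNReal.tsum_comp_le_tsum_of_injective hinj _
                    _ = (places J).card := by
                        rw [tsum_eq_sum (s := places J) fun q hq => by simp [hq]]
                        simp +contextual [Set.indicator]
                · rw [Set.indicator_of_notMem ht]
                  simp [hit, ht]
            _ = (places J).card * J := by
                rw [lintegral_indicator_const measurableSet_Ioc, Measure.restrict_apply
                  measurableSet_Ioc, Set.inter_eq_left.2 fun t ht => ht.1]
                simp
        · intro i
          exact (((measurable_hit J (i + 1) _).comp measurable_prodMk_left).indicator
            measurableSet_Iic).aemeasurable
    _ = _ := by simp

open Classical in
lemma aemeasurable_tsum_relevant (J : ℕ) : AEMeasurable (fun x : Config =>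
    ∑' i, (if Relevant J x (i + 1) then 1 else 0 : ℝ≥0∞)) configLaw := by
  have hid : Measurable fun x : Config => x := measurable_id
  refine AEMeasurable.congr (f := fun x : Config =>
    ∑' i, hit J (i + 1) (x (i + 1)).1 x (x (i + 1)).2) ?_ ?_
  · exact (Measurable.tsum fun i => measurable_eval_countable
      (H := fun v (x : Config) => hit J (i + 1) v x (x (i + 1)).2)
      (measurable_fst_apply hid (i + 1)) fun v => (measurable_hit J _ v).comp
        (hid.prodMk (measurable_snd_apply hid (i + 1)))).aemeasurable
  · filter_upwards [ae_isGood] with x hx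
    exact tsum_congr fun i => (hx.indicator_relevant (by omega)).symm

theorem ae_finite_relevant (J : ℕ) : ∀ᵐ x ∂configLaw, {i | Relevant J x i}.Finite := by
  classical
  have hne := ne_top_of_le_ne_top (by finiteness) (lintegral_tsum_relevant J)
  filter_upwards [ae_lt_top' (aemeasurable_tsum_relevant J) hne] with x hx
  have h1 := ENNReal.finite_const_le_of_tsum_ne_top hx.ne one_ne_zero
  refine (h1.image (· + 1)).subset fun i hi => ?_
  refine ⟨i - 1, ?_, Nat.sub_add_cancel hi.1⟩
  have : Relevant J x (i - 1 + 1) := by rw [Nat.sub_add_cancel hi.1]; exact hi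
  simp [this]

/-! ### The Laplace functional -/

/-- The ranks below `J`, in the block split at the removal of the edge of `i`, of the vertices
which are separated from the root. -/
def cutFin (J : ℕ) (x : Config) (i : ℕ) : Finset ℕ :=
  (Finset.range J).filter fun a => Cut x i (Nat.nth (InBlock x i) a)

section Limit

variable {g : ℝ → ℕ → Finset ℕ → ℝ} {J : ℕ} {c : ℝ} {x : Config} {n i : ℕ}

/-- The test function evaluated at the cut of `i`. -/
def cutValue (g : ℝ → ℕ → Finset ℕ → ℝ) (J : ℕ) (x : Config) (i : ℕ) : ℝ :=
  g (x i).2 (label x (x i).2 i) (cutFin J x i)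

/-- The block is infinite, so its first `J` ranks are eventually filled; nothing is then left to
average. -/
lemma eventually_factor_eq (hg : IsTest g J c) (hx : IsGood x) (i : ℕ) :
    ∀ᶠ n in atTop, factor g J x i n = cutValue g J x i := by
  have hinf := hx.infinite_inBlock i
  filter_upwards [eventually_ge_atTop (Nat.nth (InBlock x i) J)] with n hn
  have hJ : J ≤ Nat.count (InBlock x i) n := by
    rw [← Nat.count_nth_of_infinite hinf J]
    exact Nat.count_monotone _ hn
  rw [factor, urnValue_of_le hJ, cutValue]
  refine hg.congr _ _ _ _ fun a ha => ?_
  rw [cutRanks, cutFin, Finset.mem_image, Finset.mem_filter]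
  constructor
  · rintro ⟨w, hw, rfl⟩
    have hw' := (Finset.mem_filter.1 hw).2
    exact ⟨Finset.mem_range.2 ha, by rwa [Nat.nth_count hw'.inBlock]⟩
  · rintro ⟨_, h⟩
    refine ⟨_, Finset.mem_filter.2 ⟨Finset.mem_range.2 ?_, h⟩, Nat.count_nth_of_infinite hinf a⟩
    exact Nat.nth_lt_of_lt_count (ha.trans_le hJ)

/-- A cut fails to be relevant through its time, its label or its rank, and in each case the test
function is one whatever the urn does later. -/
lemma factor_eq_one (hg : IsTest g J c) (hx : IsGood x) (hi : 1 ≤ i) (hin : i < n)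
    (h : ¬ Relevant J x i) : factor g J x i n = 1 := by
  by_cases h1 : (x i).2 ∈ Set.Icc (0 : ℝ) J
  swap
  · exact urnMean_eq_one (fun R => hg.one_of_time _ _ R h1) _ _ _
  by_cases h2 : J ≤ label x (x i).2 i
  · exact urnMean_eq_one (fun R => hg.one_of_label _ _ R h2) _ _ _
  -- The remaining case is a rank of `i` at least `J`. Every separated vertex is at least `i`, so
  -- its rank is at least `J` too.
  have h3 : J ≤ Nat.count (InBlock x i) i := by
    by_contra h3
    refine h ⟨hi, ⟨hx.time_pos i hi, h1.2⟩, Finset.mem_product.2 ⟨Finset.mem_range.2 (not_le.1 h2),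
      Finset.mem_Ico.2 ⟨blockSize_pos hi le_rfl hx, ?_⟩⟩⟩
    exact not_le.1 h3
  rw [factor, urnValue_of_le (h3.trans (Nat.count_monotone _ hin.le))]
  refine hg.one_of_red _ _ _ fun a ha hmem => ?_
  obtain ⟨w, hw, rfl⟩ := Finset.mem_image.1 hmem
  have hiw := (Finset.mem_filter.1 hw).2.le
  exact absurd (h3.trans (Nat.count_monotone (InBlock x i) hiw)) (not_le.2 ha)

/-- The number of factors grows with `n`, so pointwise convergence is not enough: finiteness of the
relevant cuts gives a common threshold for those that differ from one. -/
lemma eventually_prod_factor_eq (hg : IsTest g J c) (hx : IsGood x)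
    (hfin : {i | Relevant J x i}.Finite) : ∀ᶠ n in atTop,
    ∏ i ∈ Finset.Ico 1 n, factor g J x i n = ∏ i ∈ Finset.Ico 1 n, cutValue g J x i := by
  have h1 : ∀ᶠ n in atTop, ∀ i ∈ {i | Relevant J x i}, factor g J x i n = cutValue g J x i :=
    (hfin.eventually_all).2 fun i _ => eventually_factor_eq hg hx i
  filter_upwards [h1] with n hn
  refine Finset.prod_congr rfl fun i hi => ?_
  by_cases h : Relevant J x i
  · exact hn i h
  · obtain ⟨hi1, hin⟩ := Finset.mem_Ico.1 hi
    rw [factor_eq_one hg hx hi1 hin h]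
    -- The value at an irrelevant cut is one as well, being the eventual value of a factor that
    -- equals one.
    obtain ⟨m, hm, hm'⟩ := ((eventually_factor_eq hg hx i).and (eventually_gt_atTop i)).exists
    rw [← hm, factor_eq_one hg hx hi1 hm' h]

end Limit

/-- The Laplace functional of the point measure of the cuts, for test functions which depend on
finitely many ranks. -/
theorem integral_expNeg_tsum {L : ℝ → ℕ → Finset ℕ → ℝ≥0∞} {J : ℕ} {c : ℝ}
    (hg : IsTest (fun t k R => expNeg (L t k R)) J c) :
    ∫ x, expNeg (∑' i, L (x (i + 1)).2 (label x (x (i + 1)).2 (i + 1)) (cutFin J x (i + 1)))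
      ∂configLaw =
      Real.exp (-∫ t in Set.Ioc (0 : ℝ) J, totalRate (fun t k R => expNeg (L t k R)) J t) := by
  set g : ℝ → ℕ → Finset ℕ → ℝ := fun t k R => expNeg (L t k R) with hgdef
  set Λ := ∫ t in Set.Ioc (0 : ℝ) J, totalRate g J t with hΛ
  have hlim : ∀ᵐ x ∂configLaw, Tendsto (fun n => expMart g J x (n + 1)) atTop
      (𝓝 (expNeg (∑' i, L (x (i + 1)).2 (label x (x (i + 1)).2 (i + 1)) (cutFin J x (i + 1))) *
        Real.exp Λ)) := by
    filter_upwards [ae_isGood, ae_finite_relevant J] with x hx hfin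
    have h1 : Tendsto (fun n => ∏ i ∈ Finset.Ico 1 (n + 1), cutValue g J x i) atTop
        (𝓝 (expNeg (∑' i, L (x (i + 1)).2 (label x (x (i + 1)).2 (i + 1))
          (cutFin J x (i + 1))))) := by
      have h2 : ∀ n, ∏ i ∈ Finset.Ico 1 (n + 1), cutValue g J x i =
          expNeg (∑ i ∈ Finset.range n, L (x (i + 1)).2 (label x (x (i + 1)).2 (i + 1))
            (cutFin J x (i + 1))) := by
        intro n
        rw [Finset.prod_Ico_eq_prod_range, expNeg_sum]
        refine Finset.prod_congr (by simp) fun i _ => ?_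
        rw [add_comm]; rfl
      simp only [h2]
      exact (continuous_expNeg.tendsto _).comp (ENNReal.tendsto_nat_tsum _)
    have h3 : Tendsto (fun n => expMart g J x n) atTop (𝓝 (expNeg (∑' i, L (x (i + 1)).2
        (label x (x (i + 1)).2 (i + 1)) (cutFin J x (i + 1))) * Real.exp Λ)) := by
      refine Tendsto.mul ?_ ((Real.continuous_exp.tendsto _).comp (tendsto_sum_compensator hg hx))
      refine (((tendsto_add_atTop_iff_nat (f := fun n =>
        ∏ i ∈ Finset.Ico 1 n, cutValue g J x i) 1).1 h1)).congr' ?_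
      filter_upwards [eventually_prod_factor_eq hg hx hfin] with n hn using hn.symm
    exact (tendsto_add_atTop_iff_nat (f := fun n => expMart g J x n) 1).2 h3
  -- The means are all one, and the limit is the wanted exponential times the constant `exp Λ`;
  -- hence its mean is `exp (-Λ)`.
  have hconv := tendsto_integral_of_dominated_convergence
    (fun _ => Real.exp ((places J).card * J))
    (fun n => (hg.measurable_expMart (n + 1)).aestronglyMeasurable) (integrable_const _)
    (fun n => by
      filter_upwards [ae_isGood] with x hx
      rw [Real.norm_of_nonneg (expMart_nonneg hg x _)]
      exact (expMart_le_exp hg x _).trans (Real.exp_le_exp.2 (sum_compensator_le hg hx _))) hlim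
  simp only [integral_expMart hg (Nat.le_add_left 1 _)] at hconv
  have h1 := tendsto_nhds_unique tendsto_const_nhds hconv
  rw [integral_mul_const] at h1
  rw [Real.exp_neg]
  exact eq_inv_of_mul_eq_one_left h1.symm

/-! ### The law of the urn -/

instance : DiscreteMeasurableSpace ℕ+ := ⟨fun _ => trivial⟩

/-- The shift from the natural numbers to the positive integers, as a measurable equivalence. -/
def shiftEquiv : ℕ ≃ᵐ ℕ+ where
  toEquiv := Equiv.pnatEquivNat.symm
  measurable_toFun := measurable_from_nat
  measurable_invFun := .of_discrete

lemma uniformOn_map_equiv {α β : Type*} [MeasurableSpace α] [MeasurableSpace β]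
    [MeasurableSingletonClass α] [MeasurableSingletonClass β] (e : α ≃ᵐ β) (s : Set α) :
    (uniformOn s).map e = uniformOn (e '' s) := by
  have hc : (Measure.count : Measure α).map e = Measure.count := by
    ext A hA
    rw [e.map_apply, ← e.image_symm, Measure.count_injective_image e.symm.injective]
  ext A hA
  have h1 : e ⁻¹' (e '' s) = s := e.injective.preimage_image s
  rw [e.map_apply, uniformOn, uniformOn, ProbabilityTheory.cond, ProbabilityTheory.cond, ← hc,
    e.map_apply, h1, Measure.smul_apply, Measure.smul_apply, e.restrict_map, e.map_apply, h1]

lemma succPNat_image_Iio (n : ℕ) : Nat.succPNat '' Set.Iio (n + 1) = Set.Iic n.succPNat := by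
  ext m
  constructor
  · rintro ⟨a, ha, rfl⟩
    exact Nat.succPNat_le_succPNat.2 (Nat.lt_succ_iff.1 ha)
  · intro hm
    refine ⟨m.natPred, ?_, PNat.succPNat_natPred m⟩
    have : m.natPred.succPNat ≤ n.succPNat := by rwa [PNat.succPNat_natPred]
    exact Nat.lt_succ_iff.2 (Nat.succPNat_le_succPNat.1 this)

lemma uniformUpTo_succPNat (n : ℕ) :
    uniformUpTo n.succPNat = (uniformOn (Set.Iio (n + 1))).map Nat.succPNat := by
  rw [uniformUpTo, ← succPNat_image_Iio]
  exact (uniformOn_map_equiv shiftEquiv _).symm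

lemma integral_uniformUpTo (n : ℕ) (f : ℕ+ → ℝ) :
    ∫ v, f v ∂(uniformUpTo n.succPNat) =
      ((n + 1 : ℕ) : ℝ)⁻¹ * ∑ v ∈ Finset.range (n + 1), f v.succPNat := by
  rw [uniformUpTo_succPNat, integral_map measurable_from_nat.aemeasurable
    (Measurable.of_discrete).aestronglyMeasurable, integral_uniformOn_Iio]

lemma isRed_iff {k m : ℕ+} {w : ℕ+ → ℕ+} :
    IsRed k w m ↔ m = k ∨ ∃ n, k ≤ n ∧ m = n + 1 ∧ IsRed k w (w n) := by
  constructor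
  · rintro (_ | ⟨n, hn, h⟩)
    · exact .inl rfl
    · exact .inr ⟨n, hn, rfl, h⟩
  · rintro (rfl | ⟨n, hn, rfl, h⟩)
    · exact .init
    · exact .step n hn h

lemma IsRed.le {k m : ℕ+} {w : ℕ+ → ℕ+} (h : IsRed k w m) : k ≤ m := by
  rcases isRed_iff.1 h with rfl | ⟨n, hn, rfl, -⟩
  · exact le_rfl
  · exact hn.trans (PNat.lt_add_right n 1).le

lemma isRed_add_one_iff {k n : ℕ+} {w : ℕ+ → ℕ+} (hn : k ≤ n) :
    IsRed k w (n + 1) ↔ IsRed k w (w n) := by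
  rw [isRed_iff]
  constructor
  · rintro (h | ⟨m, -, h, h'⟩)
    · exact absurd (hn.trans_lt (PNat.lt_add_right n 1)) (h ▸ lt_irrefl _)
    · rwa [add_right_cancel h]
  · exact fun h => .inr ⟨n, hn, rfl, h⟩

lemma measurableSet_isRed (k m : ℕ+) : MeasurableSet {w : ℕ+ → ℕ+ | IsRed k w m} := by
  -- `F d m` collects the draws for which `m` is shown to be red in at most `d` steps. Induction on
  -- the ball itself is not available, as arbitrary draws need not satisfy `w n ≤ n`.
  let F : ℕ → ℕ+ → Set (ℕ+ → ℕ+) := fun d => Nat.rec (fun m => {_w | m = k})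
    (fun _ F m => {w | m = k ∨ ∃ n, k ≤ n ∧ m = n + 1 ∧ w ∈ F (w n)}) d
  have hF : ∀ d m, MeasurableSet (F d m) := by
    intro d
    induction d with
    | zero => exact fun m => .const _
    | succ d ih =>
      intro m
      have : F (d + 1) m = {_w | m = k} ∪ ⋃ (n : ℕ+) (v : ℕ+),
          {_w | k ≤ n ∧ m = n + 1} ∩ ({w | w n = v} ∩ F d v) := by
        ext w
        simp only [F, Set.mem_ofPred_eq, Set.mem_union, Set.mem_iUnion, Set.mem_inter_iff]
        grind
      rw [this]
      exact (MeasurableSet.const _).union (.iUnion fun n => .iUnion fun v =>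
        (MeasurableSet.const _).inter
          ((measurableSet_eq_fun (measurable_pi_apply n) measurable_const).inter (ih v)))
  have h1 : ∀ d m, F d m ⊆ F (d + 1) m := by
    intro d
    induction d with
    | zero => exact fun m w h => .inl h
    | succ d ih =>
      rintro m w (h | ⟨n, h1, h2, h3⟩)
      · exact .inl h
      · exact .inr ⟨n, h1, h2, ih _ h3⟩
  have : {w : ℕ+ → ℕ+ | IsRed k w m} = ⋃ d, F d m := by
    ext w
    simp only [Set.mem_ofPred_eq, Set.mem_iUnion]
    constructor
    · intro h
      induction h with
      | init => exact ⟨0, rfl⟩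
      | step n hn h ih => exact ih.imp' (· + 1) fun d hd => .inr ⟨n, hn, rfl, hd⟩
    · rintro ⟨d, hd⟩
      induction d generalizing m with
      | zero => rw [show m = k from hd]; exact .init
      | succ d ih =>
        rcases hd with rfl | ⟨n, hn, rfl, h⟩
        · exact .init
        · exact .step n hn (ih _ h)
  rw [this]
  exact .iUnion fun d => hF d m

open Classical in
/-- The red balls among the first `b` balls, numbered from zero, when the first red ball is the
ball `j`. -/
def urnReds (j : ℕ) (w : ℕ+ → ℕ+) (b : ℕ) : Finset ℕ :=
  (Finset.range b).filter fun a => IsRed j.succPNat w a.succPNat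

open Classical in
lemma urnReds_succ (j : ℕ) (w : ℕ+ → ℕ+) (b : ℕ) : urnReds j w (b + 1) =
    if IsRed j.succPNat w b.succPNat then insert b (urnReds j w b) else urnReds j w b := by
  rw [urnReds, Finset.range_add_one, Finset.filter_insert]
  rfl

lemma urnReds_card_le (j : ℕ) (w : ℕ+ → ℕ+) (b : ℕ) : (urnReds j w b).card ≤ b := by
  classical
  exact (Finset.card_filter_le _ _).trans (Finset.card_range b).le

lemma urnReds_of_le {j b : ℕ} (h : b ≤ j) (w : ℕ+ → ℕ+) : urnReds j w b = ∅ := by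
  classical
  refine Finset.filter_eq_empty_iff.2 fun a ha hr => ?_
  exact absurd ((Finset.mem_range.1 ha).trans_le h)
    (not_lt.2 (Nat.succPNat_le_succPNat.1 hr.le))

lemma urnReds_init (j : ℕ) (w : ℕ+ → ℕ+) : urnReds j w (j + 1) = {j} := by
  rw [urnReds_succ, if_pos .init, urnReds_of_le le_rfl]
  rfl

lemma measurable_urnReds (j b : ℕ) :
    @Measurable _ (Finset ℕ) _ ⊤ fun w => urnReds j w b := by
  classical
  let _ : MeasurableSpace (Finset ℕ) := ⊤
  induction b with
  | zero => simp [urnReds]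
  | succ b ih =>
    simp only [urnReds_succ]
    exact Measurable.ite (measurableSet_isRed _ _)
      (Measurable.comp (g := fun R : Finset ℕ => insert b R) (fun _ _ => trivial) ih) ih

lemma measurable_comp_urnReds (j b : ℕ) (f : Finset ℕ → ℝ) :
    Measurable fun w => f (urnReds j w b) := by
  let _ : MeasurableSpace (Finset ℕ) := ⊤
  exact Measurable.comp (g := f) (fun _ _ => trivial) (measurable_urnReds j b)

/-- When every draw picks a ball already in the urn, the colour of `m` is traced back through the
draws with index below `m` only. -/
lemma isRed_congr {k m : ℕ+} {w w' : ℕ+ → ℕ+} (hw : ∀ n, w n ≤ n) (h : ∀ n < m, w n = w' n) :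
    IsRed k w m ↔ IsRed k w' m := by
  induction m using PNat.strongInductionOn with
  | _ m ih =>
    rw [isRed_iff, isRed_iff (w := w')]
    refine or_congr_right (exists_congr fun n => and_congr_right fun _ =>
      and_congr_right fun hm => ?_)
    have hn : n < m := hm ▸ PNat.lt_add_right n 1
    rw [← h n hn]
    exact ih _ ((hw n).trans_lt hn) fun l hl => h l (hl.trans_le ((hw n).trans hn.le))

/-- The law of the draws. -/
abbrev drawLaw : Measure (ℕ+ → ℕ+) := Measure.infinitePi uniformUpTo

lemma ae_draw_le : ∀ᵐ w ∂drawLaw, ∀ n, w n ≤ n := by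
  rw [ae_all_iff]
  intro n
  have h := (measurePreserving_eval_infinitePi uniformUpTo n).map_eq
  have h2 : ∀ᵐ v ∂(uniformUpTo n), v ≤ n := by
    rw [uniformUpTo]
    exact ae_cond_mem (Set.finite_Iic n).measurableSet
  rw [← h] at h2
  exact ae_of_ae_map (measurable_pi_apply n).aemeasurable h2

lemma integral_drawLaw_update (n : ℕ+) {F : (ℕ+ → ℕ+) → ℝ} (hF : Measurable F) {C : ℝ}
    (hC : ∀ w, ‖F w‖ ≤ C) :
    ∫ w, F w ∂drawLaw = ∫ w, ∫ v, F (Function.update w n v) ∂(uniformUpTo n) ∂drawLaw := by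
  have hm : Measurable fun q : (ℕ+ → ℕ+) × ℕ+ => Function.update q.1 n q.2 := by
    refine measurable_pi_lambda _ fun i => ?_
    by_cases h : i = n
    · subst h; simpa using measurable_snd
    · simp only [Function.update_of_ne h]; exact (measurable_pi_apply i).comp measurable_fst
  conv_lhs => rw [drawLaw, ← infinitePi_map_update uniformUpTo n,
    integral_map hm.aemeasurable hF.aestronglyMeasurable]
  exact integral_prod _ (Integrable.of_bound
    (hF.comp hm).aestronglyMeasurable C (.of_forall fun q => hC _))

section

variable {g : Finset ℕ → ℝ} {J : ℕ} {c : ℝ}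

/-- Along the actual urn the value function is a martingale: averaging over the next draw is exactly
`urnValue_harmonic`. -/
lemma integral_urnValue_succ (hc0 : 0 ≤ c) (hc : ∀ R, c ≤ g R) (h1 : ∀ R, g R ≤ 1)
    (hg : ∀ R R' : Finset ℕ, (∀ a < J, a ∈ R ↔ a ∈ R') → g R = g R') {j b : ℕ} (hj : j ≤ b) :
    ∫ w, urnValue g J (b + 2) (urnReds j w (b + 2)) ∂drawLaw =
      ∫ w, urnValue g J (b + 1) (urnReds j w (b + 1)) ∂drawLaw := by
  classical
  have hbd : ∀ w, ‖urnValue g J (b + 2) (urnReds j w (b + 2))‖ ≤ 1 := fun w => by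
    rw [Real.norm_of_nonneg (hc0.trans (le_urnValue hc h1 (urnReds_card_le j w _)))]
    exact urnValue_le_one hc h1 (urnReds_card_le j w _)
  -- The draw with index `b + 1`, made when there are `b + 1` balls, colours the ball that has
  -- number `b + 1` when counting from zero.
  rw [integral_drawLaw_update b.succPNat (measurable_comp_urnReds j (b + 2) _) hbd]
  refine integral_congr_ae ?_
  filter_upwards [ae_draw_le] with w hw
  rw [integral_uniformUpTo]
  have hR : ∀ v, urnReds j (Function.update w b.succPNat v) (b + 1) = urnReds j w (b + 1) := by
    intro v
    refine Finset.filter_congr fun a ha => ?_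
    refine (isRed_congr hw fun n hn => ?_).symm
    have : n ≠ b.succPNat := ((hn.trans_le (Nat.succPNat_le_succPNat.2
      (Nat.lt_succ_iff.1 (Finset.mem_range.1 ha)))).ne)
    rw [Function.update_of_ne this]
  have hstep : ∀ v ∈ Finset.range (b + 1),
      urnValue g J (b + 2)
        (urnReds j (Function.update w b.succPNat v.succPNat) (b + 2)) =
      (if v ∈ urnReds j w (b + 1) then urnValue g J (b + 2) (insert (b + 1) (urnReds j w (b + 1)))
        else urnValue g J (b + 2) (urnReds j w (b + 1))) := by
    intro v hv
    have hv' := Finset.mem_range.1 hv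
    have e : (b + 1).succPNat = b.succPNat + 1 := rfl
    have : IsRed j.succPNat (Function.update w b.succPNat v.succPNat) (b + 1).succPNat ↔
        v ∈ urnReds j w (b + 1) := by
      rw [e, isRed_add_one_iff (Nat.succPNat_le_succPNat.2 hj), Function.update_self, ← hR v.succPNat,
        urnReds, Finset.mem_filter]
      simp [hv']
    rw [urnReds_succ j _ (b + 1), hR]
    simp only [this]
    split_ifs <;> rfl
  rw [Finset.sum_congr rfl hstep, Finset.sum_ite, Finset.sum_const, Finset.sum_const]
  have hsub : urnReds j w (b + 1) ⊆ Finset.range (b + 1) := Finset.filter_subset _ _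
  have e1 : (Finset.range (b + 1)).filter (· ∈ urnReds j w (b + 1)) = urnReds j w (b + 1) := by
    rw [Finset.filter_mem_eq_inter, Finset.inter_eq_right.2 hsub]
  have e2 : (((Finset.range (b + 1)).filter (· ∉ urnReds j w (b + 1))).card : ℝ) =
      ((b + 1 : ℕ) : ℝ) - (urnReds j w (b + 1)).card := by
    have := Finset.card_filter_add_card_filter_not (s := Finset.range (b + 1))
      (· ∈ urnReds j w (b + 1))
    rw [e1, Finset.card_range] at this
    exact eq_sub_of_add_eq' (by exact_mod_cast this)
  rw [nsmul_eq_mul, nsmul_eq_mul, e1, e2, urnValue_harmonic hg (Nat.succ_pos b), ← mul_assoc,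
    inv_mul_cancel₀ (by positivity), one_mul]

/-- The mean of a function of the red balls among the first `J` balls. -/
theorem integral_urnReds (hc0 : 0 ≤ c) (hc : ∀ R, c ≤ g R) (h1 : ∀ R, g R ≤ 1)
    (hg : ∀ R R' : Finset ℕ, (∀ a < J, a ∈ R ↔ a ∈ R') → g R = g R') (j : ℕ) :
    ∫ w, g (urnReds j w J) ∂drawLaw = urnValue g J (j + 1) {j} := by
  have h2 : ∀ d, ∫ w, urnValue g J (j + d + 1) (urnReds j w (j + d + 1)) ∂drawLaw =
      urnValue g J (j + 1) {j} := by
    intro d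
    induction d with
    | zero => simp [urnReds_init]
    | succ d ih =>
      rw [← ih]
      exact integral_urnValue_succ hc0 hc h1 hg (Nat.le_add_right j d)
  -- After `J` further draws the urn holds `j + J + 1 ≥ J` balls, so its value is `g` itself, and
  -- the balls from number `J` on do not affect `g`.
  rw [← h2 J]
  refine integral_congr_ae (.of_forall fun w => ?_)
  simp only
  rw [urnValue_of_le (by omega)]
  refine hg _ _ fun a ha => ?_
  simp only [urnReds, Finset.mem_filter, Finset.mem_range]
  grind

end

/-! ### Measurability of the point measure -/

section MeasurableCut

variable {Ω : Type*} [MeasurableSpace Ω]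

lemma measurableSet_reachable {V : Type*} [Countable V] {G : Ω → SimpleGraph V}
    (hG : ∀ a b, MeasurableSet {ω | (G ω).Adj a b}) (a b : V) :
    MeasurableSet {ω | (G ω).Reachable a b} := by
  -- `F d b` is the event that `b` is reached from `a` in at most `d` steps.
  let F : ℕ → V → Set Ω := fun d => Nat.rec (fun b => {_ω | a = b})
    (fun _ F b => F b ∪ ⋃ c, F c ∩ {ω | (G ω).Adj c b}) d
  have hF : ∀ d b, MeasurableSet (F d b) := by
    intro d
    induction d with
    | zero => exact fun b => .const _
    | succ d ih => exact fun b => (ih b).union (.iUnion fun c => (ih c).inter (hG c b))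
  have : {ω | (G ω).Reachable a b} = ⋃ d, F d b := by
    ext ω
    simp only [Set.mem_ofPred_eq, Set.mem_iUnion, SimpleGraph.reachable_iff_reflTransGen]
    constructor
    · intro h
      induction h with
      | refl => exact ⟨0, rfl⟩
      | @tail b c _ h ih => exact ih.imp' (· + 1) fun d hd => .inr (Set.mem_iUnion.2 ⟨b, hd, h⟩)
    · rintro ⟨d, hd⟩
      induction d generalizing b with
      | zero => rw [show a = b from hd]
      | succ d ih =>
        rcases hd with h | h
        · exact ih b h
        · obtain ⟨c, hc, hc'⟩ := Set.mem_iUnion.1 h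
          exact (ih c hc).tail hc'
  rw [this]
  exact .iUnion fun d => hF d b

lemma measurableSet_clusters {u : ℕ+ → Ω → ℕ+} {S : Ω → Set ℕ+}
    (hu : ∀ i, 2 ≤ i → Measurable (u i)) (hS : ∀ i, 2 ≤ i → MeasurableSet {ω | i ∈ S ω})
    (a b : ℕ+) : MeasurableSet {ω | clusters (fun i => u i ω) (S ω) a b} := by
  refine measurableSet_reachable (G := fun ω => forest (fun i => u i ω) (S ω)) (fun a b => ?_) a b
  have h : ∀ a b : ℕ+, MeasurableSet {ω | 2 ≤ a ∧ a ∈ S ω ∧ b = u a ω} := fun a b => by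
    by_cases ha : 2 ≤ a
    · simp only [ha, true_and]
      exact (hS a ha).inter (measurableSet_eq_fun measurable_const (hu a ha))
    · simp [ha]
  simp only [forest, SimpleGraph.fromRel_adj]
  exact (MeasurableSet.const _).inter ((h a b).union (h b a))

lemma measurable_partition {f : Ω → Partition} (h : ∀ a b, MeasurableSet {ω | f ω a b}) :
    Measurable f := by
  refine measurable_generateFrom ?_
  rintro _ ⟨n, π, rfl⟩
  have : f ⁻¹' {η | SameOn n π η} = ⋂ (a : ℕ+) (b : ℕ+),
      {ω | a ≤ n → b ≤ n → (π a b ↔ f ω a b)} := by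
    ext ω; simp [SameOn]
  rw [this]
  refine .iInter fun a => .iInter fun b => ?_
  have e : {ω | a ≤ n → b ≤ n → (π a b ↔ f ω a b)} =
      {_ω | a ≤ n}ᶜ ∪ ({_ω | b ≤ n}ᶜ ∪ (({_ω | π a b} ∩ {ω | f ω a b}) ∪
        ({_ω | π a b}ᶜ ∩ {ω | f ω a b}ᶜ))) := by
    ext ω; simp only [Set.mem_ofPred_eq, Set.mem_union, Set.mem_compl_iff, Set.mem_inter_iff]; tauto
  rw [e]
  exact (MeasurableSet.const _).compl.union ((MeasurableSet.const _).compl.union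
    (((MeasurableSet.const _).inter (h a b)).union
      ((MeasurableSet.const _).compl.inter (h a b).compl)))

lemma SameOn.trans {n : ℕ+} {π η θ : Partition} (h : SameOn n π η) (h' : SameOn n η θ) :
    SameOn n π θ := fun x y hx hy => (h x y hx hy).trans (h' x y hx hy)

/-- A set of partitions which depends only on the restriction to `[n]` is measurable. -/
lemma measurableSet_of_sameOn {n : ℕ+} {A : Set Partition}
    (hA : ∀ π η, SameOn n π η → (π ∈ A ↔ η ∈ A)) : MeasurableSet A := by
  classical
  -- The restriction to `[n]` is coded by a finite set of pairs. Codes are countable in number, so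
  -- the set is a countable union of balls.
  let T : Partition → Finset (ℕ+ × ℕ+) := fun π =>
    (Finset.Icc 1 n ×ˢ Finset.Icc 1 n).filter fun q => π q.1 q.2
  have hT : ∀ π η, T π = T η → SameOn n π η := fun π η h x y hx hy => by
    have := Finset.ext_iff.1 h (x, y)
    simpa [T, hx, hy] using this
  have : A = ⋃ B ∈ T '' A, {η | T η = B} := by
    ext η
    simp only [Set.mem_iUnion, Set.mem_image, Set.mem_ofPred_eq, exists_prop]
    constructor
    · exact fun h => ⟨T η, ⟨η, h, rfl⟩, rfl⟩
    · rintro ⟨_, ⟨π, hπ, rfl⟩, h⟩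
      exact (hA π η (hT _ _ h.symm)).1 hπ
  rw [this]
  refine .biUnion (Set.to_countable _) ?_
  rintro _ ⟨π, -, rfl⟩
  have : {η | T η = T π} = {η | SameOn n π η} := by
    ext η
    refine ⟨fun h => hT _ _ h.symm, fun h => ?_⟩
    refine Finset.filter_congr fun q hq => ?_
    simp only [Finset.mem_product, Finset.mem_Icc] at hq
    exact (h _ _ hq.1.2 hq.2.2).symm
  rw [this]
  exact MeasurableSpace.measurableSet_generateFrom ⟨n, π, rfl⟩

lemma measurableSet_rel {f : Ω → Partition} (hf : Measurable f) (a b : ℕ+) :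
    MeasurableSet {ω | f ω a b} :=
  hf (measurableSet_of_sameOn (n := max a b) (A := {π : Partition | π a b}) fun _ _ h =>
    h a b (le_max_left _ _) (le_max_right _ _))

lemma measurable_blockLabel (i : ℕ+) : Measurable fun π : Partition => blockLabel π i := by
  classical
  have hr := fun a b => measurableSet_rel (measurable_id (α := Partition)) a b
  let Q : Partition → ℕ+ → Prop := fun π m =>
    (∀ j ∈ blockOf π m, m ≤ j) ∧ ∀ j ∈ blockOf π i, m < j
  have hQ : ∀ m, MeasurableSet {π | Q π m} := fun m => by
    have h : ∀ a j (p : Prop), MeasurableSet {π : Partition | j ∈ blockOf π a → p} := fun a j p => by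
      have : {π : Partition | j ∈ blockOf π a → p} = {π | π a j}ᶜ ∪ {_π | p} := by
        ext π; simp only [blockOf, Set.mem_ofPred_eq, Set.mem_union, Set.mem_compl_iff]; tauto
      rw [this]
      exact (hr a j).compl.union (.const _)
    have : {π | Q π m} = (⋂ j, {π : Partition | j ∈ blockOf π m → m ≤ j}) ∩
        ⋂ j, {π : Partition | j ∈ blockOf π i → m < j} := by
      ext π; simp [Q]
    rw [this]
    exact (MeasurableSet.iInter fun j => h _ _ _).inter (.iInter fun j => h _ _ _)
  -- Any `m` that is counted is smaller than `i`, since `i` is in its own block; the cardinality is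
  -- a finite sum of indicators.
  have hcard : ∀ π : Partition, Set.ncard {m | Q π m} =
      ∑ m ∈ Finset.Iio i, if Q π m then 1 else 0 := fun π => by
    rw [← Finset.card_filter, ← Set.ncard_coe_finset]
    congr 1
    ext m
    simp only [Set.mem_ofPred_eq, Finset.coe_filter, Finset.mem_Iio]
    exact ⟨fun h => ⟨h.2 i (π.refl i), h⟩, fun h => h.2⟩
  have : (fun π : Partition => blockLabel π i) = fun π =>
      Nat.succPNat (∑ m ∈ Finset.Iio i, if Q π m then 1 else 0) := by
    funext π
    rw [← hcard]
    rfl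
  rw [this]
  refine (measurable_from_nat (f := Nat.succPNat)).comp (Finset.measurable_sum _ fun m _ => ?_)
  exact Measurable.ite (hQ m) measurable_const measurable_const

lemma measurable_nth {p : Ω → ℕ → Prop} (hp : ∀ m, MeasurableSet {ω | p ω m}) (n : ℕ) :
    Measurable fun ω => Nat.nth (p ω) n := by
  classical
  have hm : ∀ m, MeasurableSet {ω | p ω m ∧ Nat.count (p ω) m = n} := fun m =>
    (hp m).inter (measurable_count hp m (measurableSet_singleton n))
  -- `Nat.nth` takes the default value `0` when there is no element of that index, whence the second
  -- alternative.
  have key : ∀ ω m, Nat.nth (p ω) n = m ↔ (p ω m ∧ Nat.count (p ω) m = n) ∨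
      (m = 0 ∧ ∀ l, ¬ (p ω l ∧ Nat.count (p ω) l = n)) := by
    intro ω m
    by_cases h : ∃ l, p ω l ∧ Nat.count (p ω) l = n
    · obtain ⟨l, hl, hln⟩ := h
      have h0 : Nat.nth (p ω) n = l := by rw [← hln, Nat.nth_count hl]
      rw [h0]
      constructor
      · rintro rfl; exact .inl ⟨hl, hln⟩
      · rintro (⟨h1, h2⟩ | ⟨-, h2⟩)
        · exact Nat.count_injective hl h1 (hln.trans h2.symm)
        · exact absurd ⟨hl, hln⟩ (h2 l)
    · have h0 : Nat.nth (p ω) n = 0 := by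
        by_contra hne
        have hlt : ∀ hf : (Set.ofPred (p ω)).Finite, n < hf.toFinset.card := fun hf => by
          by_contra hle
          exact hne (Nat.nth_of_card_le hf (not_lt.1 hle))
        exact h ⟨_, Nat.nth_mem n hlt, Nat.count_nth hlt⟩
      rw [h0]
      push Not at h
      grind
  refine measurable_to_countable' fun m => ?_
  have : (fun ω => Nat.nth (p ω) n) ⁻¹' {m} = {ω | p ω m ∧ Nat.count (p ω) m = n} ∪
      ({_ω | m = 0} ∩ ⋂ l, {ω | p ω l ∧ Nat.count (p ω) l = n}ᶜ) := by
    ext ω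
    simp only [Set.mem_preimage, Set.mem_singleton_iff, key, Set.mem_union, Set.mem_inter_iff,
      Set.mem_iInter, Set.mem_compl_iff, Set.mem_ofPred_eq]
  rw [this]
  exact (hm m).union ((MeasurableSet.const _).inter (.iInter fun l => (hm l).compl))

variable {u : ℕ+ → Ω → ℕ+} {ε : ℕ+ → Ω → ℝ}

lemma measurable_fragLeft (hu : ∀ i, 2 ≤ i → Measurable (u i))
    (hε : ∀ i, 2 ≤ i → Measurable (ε i)) {i : ℕ+} (hi : 2 ≤ i) :
    Measurable fun ω => fragLeft (fun i => u i ω) (fun i => ε i ω) (ε i ω) :=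
  measurable_partition fun a b => measurableSet_clusters (S := fun ω => {j | ε i ω ≤ ε j ω}) hu
    (fun j hj => measurableSet_le (hε i hi) (hε j hj)) a b

lemma measurable_cutPartition (hu : ∀ i, 2 ≤ i → Measurable (u i))
    (hε : ∀ i, 2 ≤ i → Measurable (ε i)) {i : ℕ+} (hi : 2 ≤ i) :
    Measurable fun ω => cutPartition (fun i => u i ω) (fun i => ε i ω) i := by
  refine measurable_partition fun a b => ?_
  have hB : ∀ a, Measurable fun ω =>
      enum (blockOf (fragLeft (fun i => u i ω) (fun i => ε i ω) (ε i ω)) i) a := fun a =>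
    measurable_from_nat.comp (measurable_nth (p := fun ω n => n.succPNat ∈
      blockOf (fragLeft (fun i => u i ω) (fun i => ε i ω) (ε i ω)) i)
      (fun m => measurableSet_rel (measurable_fragLeft hu hε hi) i m.succPNat) _)
  have : {ω | cutPartition (fun i => u i ω) (fun i => ε i ω) i a b} = ⋃ (c : ℕ+) (d : ℕ+),
      {ω | enum (blockOf (fragLeft (fun i => u i ω) (fun i => ε i ω) (ε i ω)) i) a = c} ∩
      ({ω | enum (blockOf (fragLeft (fun i => u i ω) (fun i => ε i ω) (ε i ω)) i) b = d} ∩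
      {ω | clusters (fun i => u i ω) ({j | ε i ω ≤ ε j ω} \ {i}) c d}) := by
    ext ω
    simp [Setoid.comap_rel]
  rw [this]
  refine .iUnion fun c => .iUnion fun d => (measurableSet_eq_fun (hB a) measurable_const).inter
    ((measurableSet_eq_fun (hB b) measurable_const).inter ?_)
  exact measurableSet_clusters (S := fun ω => {j | ε i ω ≤ ε j ω} \ {i}) hu
    (fun j hj => (measurableSet_le (hε i hi) (hε j hj)).inter
      (MeasurableSet.const (j ∉ ({i} : Set ℕ+)))) c d

lemma measurable_cutMeasure (hu : ∀ i, 2 ≤ i → Measurable (u i))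
    (hε : ∀ i, 2 ≤ i → Measurable (ε i)) :
    Measurable fun ω => cutMeasure (fun i => u i ω) (fun i => ε i ω) := by
  refine Measure.measurable_of_measurable_coe _ fun A hA => ?_
  simp only [cutMeasure, Measure.sum_apply _ hA]
  refine Measurable.tsum fun i => ?_
  exact (Measure.measurable_coe hA).comp (Measure.measurable_dirac.comp ((hε i i.2).prodMk
    ((measurable_cutPartition hu hε i.2).prodMk
      ((measurable_blockLabel i).comp (measurable_fragLeft hu hε i.2)))))

end MeasurableCut

/-! ### The configuration of a tree on the positive integers -/

/-- The configuration that corresponds to the parents `u i` and the times `ε i`, `i ≥ 2`. -/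
def toConfig (u : ℕ+ → ℕ+) (ε : ℕ+ → ℝ) : Config
  | 0 => (0, 0)
  | n + 1 => ((u (n + 1).succPNat).natPred, ε (n + 1).succPNat)

section Deterministic

variable {u : ℕ+ → ℕ+} {ε : ℕ+ → ℝ}

lemma toConfig_of_pos {n : ℕ} (hn : 1 ≤ n) :
    toConfig u ε n = ((u n.succPNat).natPred, ε n.succPNat) := by
  obtain ⟨m, rfl⟩ : ∃ m, n = m + 1 := ⟨n - 1, by omega⟩
  rfl

lemma two_le_iff {a : ℕ+} : 2 ≤ a ↔ 1 ≤ a.natPred := by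
  rw [← PNat.coe_le_coe, PNat.natPred]
  have := a.pos
  simp only [PNat.val_ofNat]
  omega

/-- Both ends of a present edge have the same root, and each vertex is joined to its root by the
descent; so connectedness amounts to equality of roots. -/
lemma clusters_iff (hx : ∀ n, 1 ≤ n → (toConfig u ε n).1 < n) {S : Set ℕ+} {S' : Set ℕ}
    (hS : ∀ n, 1 ≤ n → (n ∈ S' ↔ n.succPNat ∈ S)) (a b : ℕ+) :
    clusters u S a b ↔ root (fun j => (toConfig u ε j).1) S' a.natPred =
      root (fun j => (toConfig u ε j).1) S' b.natPred := by
  set p := fun j => (toConfig u ε j).1 with hp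
  have hpar : ∀ a : ℕ+, 2 ≤ a → p a.natPred = (u a).natPred := fun a ha => by
    rw [hp]
    simp only [toConfig_of_pos (two_le_iff.1 ha), PNat.succPNat_natPred]
  have hmem : ∀ a : ℕ+, 2 ≤ a → (a.natPred ∈ S' ↔ a ∈ S) := fun a ha => by
    rw [hS _ (two_le_iff.1 ha), PNat.succPNat_natPred]
  have hedge : ∀ a b : ℕ+, 2 ≤ a ∧ a ∈ S ∧ b = u a →
      root p S' a.natPred = root p S' b.natPred := by
    rintro a b ⟨h1, h2, rfl⟩
    rw [root_of_mem ((hmem a h1).2 h2) (hx _ (two_le_iff.1 h1))]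
    exact congrArg _ (hpar a h1)
  have hroot : ∀ (v : ℕ), (forest u S).Reachable v.succPNat (root p S' v).succPNat := by
    intro v
    induction v using Nat.strong_induction_on with
    | _ v ih =>
      by_cases h : v ∈ S' ∧ p v < v
      · rw [root_of_mem h.1 h.2]
        refine SimpleGraph.Reachable.trans (SimpleGraph.Adj.reachable ?_) (ih _ h.2)
        have hv : 1 ≤ v := by omega
        have hv2 : 2 ≤ v.succPNat := two_le_iff.2 (by simpa using hv)
        have hpv : (p v).succPNat = u v.succPNat := by
          have := hpar v.succPNat hv2
          rw [Nat.natPred_succPNat] at this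
          rw [this, PNat.succPNat_natPred]
        rw [forest, SimpleGraph.fromRel_adj]
        exact ⟨fun e => h.2.ne (Nat.succPNat_injective e).symm, .inl ⟨hv2, (hS v hv).1 h.1, hpv⟩⟩
      · rw [root.eq_1 p S', dif_neg h]
  constructor
  · intro h
    have h' : Relation.ReflTransGen (forest u S).Adj a b :=
      (SimpleGraph.reachable_iff_reflTransGen a b).1 h
    induction h' with
    | refl => rfl
    | @tail b c _ hbc ih =>
      refine (ih ((SimpleGraph.reachable_iff_reflTransGen a b).2 ‹_›)).trans ?_
      rw [forest, SimpleGraph.fromRel_adj] at hbc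
      rcases hbc.2 with h | h
      · exact hedge b c h
      · exact (hedge c b h).symm
  · intro h
    have ha := hroot a.natPred
    have hb := hroot b.natPred
    rw [PNat.succPNat_natPred] at ha hb
    rw [← h] at hb
    exact ha.trans hb.symm

/-- The function `r` sends a vertex to the least element of its block, so the least elements of
blocks are the fixed points of `r`, and the label counts those below `r i`. -/
lemma blockLabel_eq {π : Partition} {r : ℕ → ℕ} (hle : ∀ v, r v ≤ v) (hr : ∀ v, r (r v) = r v)
    (h : ∀ a b : ℕ+, π a b ↔ r a.natPred = r b.natPred) (i : ℕ+) :
    blockLabel π i = (Nat.count (fun m => r m = m) (r i.natPred)).succPNat := by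
  rw [blockLabel, Nat.count_eq_card_filter_range, ← Finset.card_map ⟨_, Nat.succPNat_injective⟩,
    ← Set.ncard_coe_finset]
  congr 2
  have hle' : ∀ {a b : ℕ+}, a ≤ b ↔ a.natPred ≤ b.natPred := PNat.natPred_le_natPred.symm
  ext m
  obtain ⟨m, rfl⟩ : ∃ m', m = Nat.succPNat m' := ⟨m.natPred, (PNat.succPNat_natPred m).symm⟩
  obtain ⟨i, rfl⟩ : ∃ i', i = Nat.succPNat i' := ⟨i.natPred, (PNat.succPNat_natPred i).symm⟩
  simp only [blockOf, Set.mem_ofPred_eq, h, Nat.natPred_succPNat, Finset.coe_map,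
    Function.Embedding.coeFn_mk, Set.mem_image, Finset.mem_coe, Finset.mem_filter,
    Finset.mem_range]
  constructor
  · rintro ⟨h1, h2⟩
    have h3 := h1 (r m).succPNat (by rw [Nat.natPred_succPNat, hr])
    have h4 := h2 (r i).succPNat (by rw [Nat.natPred_succPNat, hr])
    rw [Nat.succPNat_le_succPNat] at h3
    rw [Nat.succPNat_lt_succPNat] at h4
    exact ⟨m, ⟨h4, le_antisymm (hle m) h3⟩, rfl⟩
  · rintro ⟨m', ⟨h1, h2⟩, h3⟩
    obtain rfl := Nat.succPNat_injective h3
    constructor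
    · intro j hj
      rw [hle', Nat.natPred_succPNat, ← h2, hj]
      exact hle _
    · intro j hj
      rw [← PNat.natPred_lt_natPred, Nat.natPred_succPNat]
      exact h1.trans_le (hj ▸ hle _)

/-- The partition of the positive integers into two classes, given by a set of integers that
counts from zero. -/
@[reducible] def bin (R : Set ℕ) : Partition where
  r a b := a.natPred ∈ R ↔ b.natPred ∈ R
  iseqv := ⟨fun _ => Iff.rfl, fun h => h.symm, fun h h' => h.trans h'⟩

lemma bin_apply {R : Set ℕ} {a b : ℕ+} : bin R a b ↔ (a.natPred ∈ R ↔ b.natPred ∈ R) := Iff.rfl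

/-- The ranks of the vertices which are separated from the root at the removal of the edge
of `i`. -/
def cutSet (x : Config) (i : ℕ) : Set ℕ := {a | Cut x i (Nat.nth (InBlock x i) a)}

lemma fragLeft_iff (hx : IsGood (toConfig u ε)) {i : ℕ} (hi : 1 ≤ i) (a b : ℕ+) :
    fragLeft u ε (ε i.succPNat) a b ↔
      rootAt (toConfig u ε) (toConfig u ε i).2 a.natPred =
        rootAt (toConfig u ε) (toConfig u ε i).2 b.natPred := by
  refine clusters_iff hx.parent_lt (fun n hn => ?_) a b
  simp [alive, toConfig_of_pos hn, toConfig_of_pos hi]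

lemma cutLabel_eq (hx : IsGood (toConfig u ε)) {i : ℕ} (hi : 1 ≤ i) :
    cutLabel u ε i.succPNat = (label (toConfig u ε) (toConfig u ε i).2 i).succPNat := by
  rw [cutLabel, blockLabel_eq (r := rootAt (toConfig u ε) (toConfig u ε i).2)
    (fun v => rootAt_le _ _ v) (fun v => root_root _ _ v) (fragLeft_iff hx hi),
    Nat.natPred_succPNat]
  rfl

lemma enum_blockOf_eq (hx : IsGood (toConfig u ε)) {i : ℕ} (hi : 1 ≤ i) (a : ℕ+) :
    enum (blockOf (fragLeft u ε (ε i.succPNat)) i.succPNat) a =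
      (Nat.nth (InBlock (toConfig u ε) i) a.natPred).succPNat := by
  rw [enum]
  congr 2
  funext n
  rw [blockOf, Set.mem_ofPred_eq, fragLeft_iff hx hi, InBlock, Nat.natPred_succPNat,
    Nat.natPred_succPNat]
  exact propext eq_comm

lemma cutPartition_eq (hx : IsGood (toConfig u ε)) {i : ℕ} (hi : 1 ≤ i) :
    cutPartition u ε i.succPNat = bin (cutSet (toConfig u ε) i) := by
  ext a b
  rw [cutPartition, Setoid.comap_rel, enum_blockOf_eq hx hi, enum_blockOf_eq hx hi, bin_apply,
    clusters_iff hx.parent_lt (S' := alive (toConfig u ε) (toConfig u ε i).2 \ {i}),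
    Nat.natPred_succPNat, Nat.natPred_succPNat]
  · have hmem := fun a => Nat.nth_mem_of_infinite (hx.infinite_inBlock i) a
    have h1 := hmem a.natPred
    have h2 := hmem b.natPred
    simp only [cutSet, Set.mem_ofPred_eq]
    generalize Nat.nth (InBlock (toConfig u ε) i) a.natPred = v at *
    generalize Nat.nth (InBlock (toConfig u ε) i) b.natPred = w at *
    -- Separated vertices have root `i` after the cut; the others keep the root of the block, by
    -- `root_diff_singleton`.
    by_cases hv : Cut (toConfig u ε) i v <;> by_cases hw : Cut (toConfig u ε) i w
    · simp only [hv, hw, iff_self, iff_true]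
      exact hv.trans hw.symm
    · simp only [hv, hw, iff_false, not_true]
      exact fun h => hw (h.symm.trans hv)
    · simp only [hv, hw, iff_true]
      exact iff_false_intro fun h => hv (h.trans hw)
    · simp only [hv, hw, iff_self, iff_true]
      rw [root_diff_singleton hv, root_diff_singleton hw]
      exact h1.trans h2.symm
  · intro n hn
    simp [alive, toConfig_of_pos hn, toConfig_of_pos hi]

lemma urnPartition_eq (j : ℕ) (w : ℕ+ → ℕ+) :
    urnPartition j.succPNat w = bin {a | IsRed j.succPNat w a.succPNat} := by
  ext a b
  rw [bin_apply, Set.mem_ofPred_eq, Set.mem_ofPred_eq, PNat.succPNat_natPred, PNat.succPNat_natPred]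
  rfl

end Deterministic

/-! ### The law of the configuration -/

/-- On a box depending on finitely many coordinates, Fubini over the second family gives a product
of functions of distinct coordinates of the first, which are independent. -/
lemma infinitePi_prod_map {ι : Type*} {X Y : ι → Type*} [∀ i, MeasurableSpace (X i)]
    [∀ i, MeasurableSpace (Y i)] (μ : ∀ i, Measure (X i)) (ν : ∀ i, Measure (Y i))
    [∀ i, IsProbabilityMeasure (μ i)] [∀ i, IsProbabilityMeasure (ν i)] :
    ((Measure.infinitePi μ).prod (Measure.infinitePi ν)).map (fun q i => (q.1 i, q.2 i)) =
      Measure.infinitePi fun i => (μ i).prod (ν i) := by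
  have hm : Measurable fun (q : (∀ i, X i) × (∀ i, Y i)) (i : ι) => (q.1 i, q.2 i) := by fun_prop
  refine Measure.eq_infinitePi _ fun s t ht => ?_
  have hS : MeasurableSet (Set.pi (s : Set ι) t) := MeasurableSet.pi s.countable_toSet fun i _ => ht i
  rw [Measure.map_apply hm hS, Measure.prod_apply (hm hS)]
  have h1 : ∀ x : ∀ i, X i, Measure.infinitePi ν (Prod.mk x ⁻¹'
      ((fun (q : (∀ i, X i) × (∀ i, Y i)) (i : ι) => (q.1 i, q.2 i)) ⁻¹' Set.pi s t)) =
      ∏ i : s, ν i (Prod.mk (x i) ⁻¹' t i) := fun x => by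
    rw [Finset.prod_coe_sort s fun i => ν i (Prod.mk (x i) ⁻¹' t i),
      ← Measure.infinitePi_pi ν fun i _ => measurable_prodMk_left (ht i)]
    rfl
  simp only [h1]
  have h2 : iIndepFun (fun (i : s) (x : ∀ i, X i) => ν i (Prod.mk (x i) ⁻¹' t i))
      (Measure.infinitePi μ) :=
    (iIndepFun_infinitePi (X := fun i (x : X i) => ν i (Prod.mk x ⁻¹' t i))
      fun i => measurable_measure_prodMk_left (ht i)).precomp Subtype.val_injective
  have h3 := lintegral_prod_eq_prod_lintegral_of_indepFun Finset.univ
    (fun (i : s) (x : ∀ i, X i) => ν i (Prod.mk (x i) ⁻¹' t i)) h2 fun i =>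
      (measurable_measure_prodMk_left (ht i)).comp (measurable_pi_apply _)
  rw [h3, ← Finset.prod_coe_sort s fun i => ((μ i).prod (ν i)) (t i)]
  refine Finset.prod_congr rfl fun i _ => ?_
  rw [Measure.prod_apply (ht i), ← Measure.infinitePi_map_eval μ i, lintegral_map
    (measurable_measure_prodMk_left (ht i)) (measurable_pi_apply _)]

/-- The configuration with given values at positive indices. -/
def consConfig (y : ℕ → ℕ × ℝ) : Config
  | 0 => (0, 0)
  | n + 1 => y n

lemma measurable_consConfig : Measurable consConfig := by
  refine measurable_pi_lambda _ fun n => ?_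
  cases n with
  | zero => exact measurable_const
  | succ n => exact measurable_pi_apply n

/-- The coordinate `0` is almost surely the placeholder `(0, 0)`, so only the positive coordinates
carry randomness. -/
lemma configLaw_eq_map :
    configLaw = (Measure.infinitePi fun n => vertexLaw (n + 1)).map consConfig := by
  rw [← Measure.map_infinitePi_infinitePi_of_inj (P := vertexLaw) (add_left_injective 1),
    Measure.map_map measurable_consConfig (by fun_prop), ← configLaw]
  have h0 : ∀ᵐ x ∂configLaw, x 0 = (0, 0) := by
    have h := (measurePreserving_eval_infinitePi vertexLaw 0).map_eq
    have h2 : ∀ᵐ y ∂(vertexLaw 0), y = (0, 0) := by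
      exact (ae_dirac_iff (measurableSet_singleton _)).2 rfl
    rw [← h] at h2
    exact ae_of_ae_map (measurable_pi_apply 0).aemeasurable h2
  conv_lhs => rw [← Measure.map_id (μ := configLaw)]
  refine Measure.map_congr ?_
  filter_upwards [h0] with x hx
  funext n
  cases n with
  | zero => exact hx
  | succ n => rfl

section Law

variable {Ω : Type*} [MeasurableSpace Ω] {P : Measure Ω} [IsProbabilityMeasure P]
  {u : ℕ+ → Ω → ℕ+} {ε : ℕ+ → Ω → ℝ}

lemma natPred_image_Iio (n : ℕ) : PNat.natPred '' Set.Iio (n + 1).succPNat = Set.Iio (n + 1) := by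
  ext m
  constructor
  · rintro ⟨a, ha, rfl⟩
    have := PNat.natPred_lt_natPred.2 ha
    rwa [Nat.natPred_succPNat] at this
  · exact fun hm => ⟨m.succPNat, Nat.succPNat_lt_succPNat.2 hm, Nat.natPred_succPNat m⟩

lemma measurable_toConfig (hu_meas : ∀ i : ℕ+, 2 ≤ i → Measurable (u i))
    (hε_meas : ∀ i : ℕ+, 2 ≤ i → Measurable (ε i)) :
    Measurable fun ω => toConfig (fun i => u i ω) (fun i => ε i ω) := by
  refine measurable_pi_lambda _ fun n => ?_
  cases n with
  | zero => exact measurable_const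
  | succ n =>
    have h2 : 2 ≤ (n + 1).succPNat := two_le_iff.2 (by simp)
    exact ((Measurable.of_discrete (f := PNat.natPred)).comp (hu_meas _ h2)).prodMk (hε_meas _ h2)

/-- The hypotheses give the law of the sequence of parents, that of the sequence of times, and their
independence; pairing the two product laws coordinatewise gives the law of a configuration. -/
theorem map_toConfig
    (hu_meas : ∀ i : ℕ+, 2 ≤ i → Measurable (u i))
    (hε_meas : ∀ i : ℕ+, 2 ≤ i → Measurable (ε i))
    (hu_law : ∀ i : ℕ+, 2 ≤ i → P.map (u i) = uniformOn (Set.Iio i))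
    (hu_indep : iIndepFun (fun (i : {i : ℕ+ // 2 ≤ i}) => u i) P)
    (hε_law : ∀ i : ℕ+, 2 ≤ i → P.map (ε i) = expMeasure 1)
    (hε_indep : iIndepFun (fun (i : {i : ℕ+ // 2 ≤ i}) => ε i) P)
    (huε_indep : IndepFun (fun ω (i : {i : ℕ+ // 2 ≤ i}) => u i ω)
      (fun ω (i : {i : ℕ+ // 2 ≤ i}) => ε i ω) P) :
    P.map (fun ω => toConfig (fun i => u i ω) (fun i => ε i ω)) = configLaw := by
  have h2 : ∀ n : ℕ, 2 ≤ (n + 1).succPNat := fun n => two_le_iff.2 (by simp)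
  let κ : ℕ → {i : ℕ+ // 2 ≤ i} := fun n => ⟨(n + 1).succPNat, h2 n⟩
  have hκ : Function.Injective κ := fun m n h =>
    Nat.succ_injective (Nat.succPNat_injective (congrArg Subtype.val h))
  have hpm : Measurable PNat.natPred := .of_discrete
  let U : Ω → ℕ → ℕ := fun ω n => (u (n + 1).succPNat ω).natPred
  let T : Ω → ℕ → ℝ := fun ω n => ε (n + 1).succPNat ω
  have hUm : ∀ n, Measurable fun ω => U ω n := fun n => hpm.comp (hu_meas _ (h2 n))
  have hTm : ∀ n, Measurable fun ω => T ω n := fun n => hε_meas _ (h2 n)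
  have hU : P.map U = Measure.infinitePi fun n => uniformOn (Set.Iio (n + 1)) := by
    have hi : iIndepFun (fun n ω => U ω n) P :=
      (hu_indep.precomp hκ).comp (fun _ => PNat.natPred) fun _ => hpm
    rw [show U = fun ω n => U ω n from rfl, hi.map_fun_eq_infinitePi_map hUm]
    congr 1
    funext n
    have : (fun ω => U ω n) = PNat.natPred ∘ u (n + 1).succPNat := rfl
    rw [this, ← Measure.map_map hpm (hu_meas _ (h2 n)), hu_law _ (h2 n), ← natPred_image_Iio]
    exact uniformOn_map_equiv shiftEquiv.symm _
  have hT : P.map T = Measure.infinitePi fun _ => expMeasure 1 := by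
    have hi : iIndepFun (fun n ω => T ω n) P := hε_indep.precomp hκ
    rw [show T = fun ω n => T ω n from rfl, hi.map_fun_eq_infinitePi_map hTm]
    congr 1
    funext n
    exact hε_law _ (h2 n)
  have hUT : IndepFun U T P :=
    huε_indep.comp
      (φ := fun (f : {i : ℕ+ // 2 ≤ i} → ℕ+) (n : ℕ) => (f (κ n)).natPred)
      (ψ := fun (f : {i : ℕ+ // 2 ≤ i} → ℝ) (n : ℕ) => f (κ n))
      (measurable_pi_lambda _ fun n => hpm.comp (measurable_pi_apply (κ n)))
      (measurable_pi_lambda _ fun n => measurable_pi_apply (κ n))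
  have hmU : Measurable U := measurable_pi_lambda _ hUm
  have hmT : Measurable T := measurable_pi_lambda _ hTm
  have hpair := hUT.map_prod_eq_prod_map_map hmU.aemeasurable hmT.aemeasurable
  rw [hU, hT] at hpair
  have hmp : Measurable fun (q : (ℕ → ℕ) × (ℕ → ℝ)) (n : ℕ) => (q.1 n, q.2 n) := by fun_prop
  have : (fun ω => toConfig (fun i => u i ω) (fun i => ε i ω)) =
      consConfig ∘ (fun (q : (ℕ → ℕ) × (ℕ → ℝ)) (n : ℕ) => (q.1 n, q.2 n)) ∘
        fun ω => (U ω, T ω) := by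
    funext ω n
    cases n <;> rfl
  rw [this, ← Measure.map_map measurable_consConfig (hmp.comp (hmU.prodMk hmT)),
    ← Measure.map_map hmp (hmU.prodMk hmT), hpair, infinitePi_prod_map, configLaw_eq_map]
  rfl

end Law

/-! ### Local sets and windows -/

/-- Two partitions which have the same restriction to the first `J` positive integers. -/
def SameBelow (J : ℕ) (π η : Partition) : Prop :=
  ∀ a b : ℕ+, a.natPred < J → b.natPred < J → (π a b ↔ η a b)

lemma SameBelow.mono {J J' : ℕ} {π η : Partition} (h : SameBelow J' π η) (hJ : J ≤ J') :
    SameBelow J π η := fun a b ha hb => h a b (ha.trans_le hJ) (hb.trans_le hJ)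

lemma SameBelow.symm {J : ℕ} {π η : Partition} (h : SameBelow J π η) : SameBelow J η π :=
  fun a b ha hb => (h a b ha hb).symm

lemma SameOn.sameBelow {J : ℕ} {π η : Partition} (h : SameOn J.succPNat π η) : SameBelow J π η := by
  have : ∀ a : ℕ+, a.natPred < J → a ≤ J.succPNat := fun a ha =>
    PNat.natPred_le_natPred.1 (by rw [Nat.natPred_succPNat]; exact ha.le)
  exact fun a b ha hb => h a b (this a ha) (this b hb)

lemma SameBelow.sameOn {n : ℕ+} {π η : Partition} (h : SameBelow n π η) : SameOn n π η := by
  have : ∀ a : ℕ+, a ≤ n → a.natPred < n := fun a ha => by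
    have h1 := PNat.coe_le_coe a n |>.2 ha
    have h2 := a.pos
    rw [PNat.natPred]
    omega
  exact fun a b ha hb => h a b (this a ha) (this b hb)

lemma sameBelow_bin {J : ℕ} {R R' : Set ℕ} (h : ∀ a < J, a ∈ R ↔ a ∈ R') :
    SameBelow J (bin R) (bin R') := fun a b ha hb => by
  rw [bin_apply, bin_apply, h _ ha, h _ hb]

/-- The partition does not separate the first `J` positive integers. -/
abbrev TrivialBelow (J : ℕ) (π : Partition) : Prop :=
  ∀ a b : ℕ+, a.natPred < J → b.natPred < J → π a b

lemma SameBelow.trivialBelow_iff {J : ℕ} {π η : Partition} (h : SameBelow J π η) :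
    TrivialBelow J π ↔ TrivialBelow J η :=
  forall_congr' fun a => forall_congr' fun b => forall_congr' fun ha => forall_congr' fun hb =>
    h a b ha hb

lemma trivialBelow_bin {J : ℕ} {R : Set ℕ} (h : ∀ a < J, a ∉ R) : TrivialBelow J (bin R) :=
  fun a b ha hb => by rw [bin_apply]; exact iff_of_false (h _ ha) (h _ hb)

lemma measurableSet_of_sameBelow {J : ℕ} {A : Set Partition}
    (hA : ∀ π η, SameBelow J π η → (π ∈ A ↔ η ∈ A)) : MeasurableSet A :=
  measurableSet_of_sameOn (n := J.succPNat) fun π η h => hA π η h.sameBelow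

lemma measurableSet_trivialBelow (J : ℕ) : MeasurableSet {π | TrivialBelow J π} :=
  measurableSet_of_sameBelow (J := J) fun _ _ h => h.trivialBelow_iff

/-- The state space of the point measure. -/
abbrev Mark : Type := ℝ × Partition × ℕ+

/-- A set of marks which depends on the partition through its restriction to the first `J`
positive integers only. -/
def IsLocal (J : ℕ) (A : Set Mark) : Prop :=
  ∀ t π η k, SameBelow J π η → ((t, π, k) ∈ A ↔ (t, η, k) ∈ A)

lemma IsLocal.mono {J J' : ℕ} {A : Set Mark} (h : IsLocal J A) (hJ : J ≤ J') : IsLocal J' A :=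
  fun t π η k hs => h t π η k (hs.mono hJ)

lemma IsLocal.inter {J : ℕ} {A B : Set Mark} (hA : IsLocal J A) (hB : IsLocal J B) :
    IsLocal J (A ∩ B) := fun t π η k h => and_congr (hA t π η k h) (hB t π η k h)

/-- The algebra of the measurable local sets. -/
def localSets : Set (Set Mark) := {A | MeasurableSet A ∧ ∃ J, IsLocal J A}

lemma isSetAlgebra_localSets : IsSetAlgebra localSets where
  empty_mem := ⟨.empty, 0, fun _ _ _ _ _ => Iff.rfl⟩
  compl_mem := fun _ ⟨h, J, hJ⟩ => ⟨h.compl, J, fun t π η k hs => not_congr (hJ t π η k hs)⟩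
  union_mem := fun _ _ ⟨h, J, hJ⟩ ⟨h', J', hJ'⟩ => ⟨h.union h', max J J', fun t π η k hs =>
    or_congr (hJ.mono (le_max_left _ _) t π η k hs) (hJ'.mono (le_max_right _ _) t π η k hs)⟩

/-- The three projections are already measurable for the generated sigma-field: balls of partitions
are local, and time and label are local with `J = 0`. -/
lemma generateFrom_localSets :
    (inferInstance : MeasurableSpace Mark) = MeasurableSpace.generateFrom localSets := by
  refine le_antisymm ?_ (MeasurableSpace.generateFrom_le fun A hA => hA.1)
  have h1 : @Measurable Mark ℝ (MeasurableSpace.generateFrom localSets) _ Prod.fst :=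
    fun B hB => MeasurableSpace.measurableSet_generateFrom
      ⟨measurable_fst hB, 0, fun _ _ _ _ _ => Iff.rfl⟩
  have h2 : @Measurable Mark Partition (MeasurableSpace.generateFrom localSets) _
      fun y => y.2.1 := by
    refine @measurable_generateFrom _ _ (MeasurableSpace.generateFrom localSets) _ _ ?_
    rintro _ ⟨n, π, rfl⟩
    refine MeasurableSpace.measurableSet_generateFrom ⟨?_, n, fun t η θ k h => ?_⟩
    · exact (measurable_fst.comp measurable_snd)
        (MeasurableSpace.measurableSet_generateFrom ⟨n, π, rfl⟩)
    · exact ⟨fun h' => SameOn.trans h' h.sameOn, fun h' => SameOn.trans h' h.symm.sameOn⟩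
  have h3 : @Measurable Mark ℕ+ (MeasurableSpace.generateFrom localSets) _ fun y => y.2.2 :=
    fun B hB => MeasurableSpace.measurableSet_generateFrom
      ⟨(measurable_snd.comp measurable_snd) hB, 0, fun _ _ _ _ _ => Iff.rfl⟩
  have h : @Measurable Mark Mark (MeasurableSpace.generateFrom localSets) _ id :=
    h1.prodMk (h2.prodMk h3)
  exact fun s hs => h hs

/-- The marks with time and label at most `m` and a partition that separates two of the first `m`
positive integers. -/
def window (m : ℕ) : Set Mark :=
  Set.Icc (0 : ℝ) m ×ˢ ({π | TrivialBelow m π}ᶜ ×ˢ {k | k.natPred < m})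

lemma measurableSet_window (m : ℕ) : MeasurableSet (window m) :=
  measurableSet_Icc.prod ((measurableSet_trivialBelow m).compl.prod .of_discrete)

lemma isLocal_window (m : ℕ) : IsLocal m (window m) := fun t π η k h => by
  simp only [window, Set.mem_prod, Set.mem_compl_iff, Set.mem_ofPred_eq, h.trivialBelow_iff]

lemma monotone_window : Monotone window := fun m m' h y hy => by
  refine ⟨⟨hy.1.1, hy.1.2.trans (by exact_mod_cast h)⟩, fun h' => hy.2.1 fun a b ha hb => ?_,
    lt_of_lt_of_le hy.2.2 h⟩
  exact h' a b (ha.trans_le h) (hb.trans_le h)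

/-! ### The splitting measure -/

lemma measurable_urnPartition (k : ℕ+) : Measurable (urnPartition k) := by
  refine measurable_partition fun a b => ?_
  have : {w | urnPartition k w a b} = ({w | IsRed k w a} ∩ {w | IsRed k w b}) ∪
      ({w | IsRed k w a}ᶜ ∩ {w | IsRed k w b}ᶜ) := by
    ext w
    change (IsRed k w a ↔ IsRed k w b) ↔ _
    simp only [Set.mem_union, Set.mem_inter_iff, Set.mem_compl_iff, Set.mem_ofPred_eq]
    tauto
  rw [this]
  exact ((measurableSet_isRed k a).inter (measurableSet_isRed k b)).union
    ((measurableSet_isRed k a).compl.inter (measurableSet_isRed k b).compl)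

instance (k : ℕ+) : IsProbabilityMeasure (urnLaw k) :=
  Measure.isProbabilityMeasure_map (measurable_urnPartition k).aemeasurable

instance : SFinite splittingRate := by unfold splittingRate; infer_instance

/-- The enumeration of the vertices other than the root. -/
def vertexEquiv : ℕ ≃ {i : ℕ+ // 2 ≤ i} where
  toFun n := ⟨(n + 1).succPNat, two_le_iff.2 (by simp)⟩
  invFun i := i.1.natPred - 1
  left_inv n := by simp
  right_inv i := by
    have := two_le_iff.1 i.2
    ext1
    simp only
    rw [Nat.sub_add_cancel this, PNat.succPNat_natPred]

lemma vertexEquiv_coe (n : ℕ) : (vertexEquiv n : ℕ+) = (n + 1).succPNat := rfl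

lemma lintegral_splittingRate (f : Partition → ℝ≥0∞) :
    ∫⁻ π, f π ∂splittingRate = ∑' j : ℕ, ∫⁻ π, f π ∂(urnLaw (j + 1).succPNat) := by
  rw [splittingRate, lintegral_sum_measure, ← vertexEquiv.tsum_eq]
  rfl

lemma sameBelow_urnPartition (J j : ℕ) (w : ℕ+ → ℕ+) :
    SameBelow J (urnPartition j.succPNat w) (bin (urnReds j w J : Set ℕ)) := by
  rw [urnPartition_eq]
  exact sameBelow_bin fun a ha => by simp [urnReds, ha]

/-- The first red ball has number `j ≥ J` from zero, so the first `J` balls are all black. -/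
lemma urnLaw_trivialBelow_compl {J j : ℕ} (h : J ≤ j) :
    urnLaw j.succPNat {π | TrivialBelow J π}ᶜ = 0 := by
  rw [urnLaw, Measure.map_apply (measurable_urnPartition _) (measurableSet_trivialBelow J).compl]
  convert measure_empty (μ := drawLaw)
  ext w
  simp only [Set.mem_preimage, Set.mem_compl_iff, Set.mem_empty_iff_false, iff_false, not_not,
    Set.mem_ofPred_eq]
  rw [(sameBelow_urnPartition J j w).trivialBelow_iff, urnReds_of_le h]
  exact trivialBelow_bin (by simp)

/-- Only finitely many of the probability measures `p_k` charge the partitions that separate the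
first `J` integers. This is why the windows have finite intensity although `r` is infinite. -/
lemma splittingRate_trivialBelow_compl_lt_top (J : ℕ) :
    splittingRate {π | TrivialBelow J π}ᶜ < ∞ := by
  rw [← lintegral_indicator_one (measurableSet_trivialBelow J).compl, lintegral_splittingRate]
  simp only [lintegral_indicator_one (measurableSet_trivialBelow J).compl]
  rw [tsum_eq_sum (s := Finset.range J)]
  · exact ENNReal.sum_lt_top.2 fun j _ => measure_lt_top _ _
  · exact fun j hj => urnLaw_trivialBelow_compl (by simp at hj; omega)

lemma ae_splittingRate_exists_not : ∀ᵐ π ∂splittingRate, ∃ J, ¬ TrivialBelow J π := by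
  have hm : MeasurableSet {π | ∃ J, ¬ TrivialBelow J π} := by
    have : {π | ∃ J, ¬ TrivialBelow J π} = ⋃ J, {π | TrivialBelow J π}ᶜ := by ext π; simp
    rw [this]
    exact .iUnion fun J => (measurableSet_trivialBelow J).compl
  rw [splittingRate, Measure.ae_sum_iff]
  intro k
  obtain ⟨j, rfl⟩ := vertexEquiv.surjective k
  rw [vertexEquiv_coe, urnLaw, ae_map_iff (measurable_urnPartition _).aemeasurable hm]
  refine .of_forall fun w => ⟨j + 2, fun h => ?_⟩
  rw [(sameBelow_urnPartition _ _ w).trivialBelow_iff] at h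
  have h1 := h (0 : ℕ).succPNat (j + 1).succPNat (by simp) (by simp)
  rw [bin_apply, Nat.natPred_succPNat, Nat.natPred_succPNat] at h1
  have h2 : urnReds (j + 1) w (j + 2) = {j + 1} := urnReds_init (j + 1) w
  simp [h2] at h1

/-- The intensity of the point measure. -/
abbrev intensity : Measure Mark :=
  (volume.restrict (Set.Ici (0 : ℝ))).prod (splittingRate.prod Measure.count)

lemma intensity_window_ne_top (m : ℕ) : intensity (window m) ≠ ∞ := by
  rw [window, Measure.prod_prod, Measure.prod_prod]
  have h1 := splittingRate_trivialBelow_compl_lt_top m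
  have h2 : (Measure.count : Measure ℕ+) {k | k.natPred < m} < ∞ := by
    refine Measure.count_apply_lt_top.2 ((Set.finite_Iio m).preimage ?_)
    exact PNat.natPred_injective.injOn
  refine ENNReal.mul_ne_top ?_ (ENNReal.mul_ne_top h1.ne h2.ne)
  exact ((Measure.restrict_apply_le _ _).trans_lt (by simp)).ne

lemma intensity_compl_iUnion_window : intensity (⋃ m, window m)ᶜ = 0 := by
  have h1 : ∀ᵐ y ∂intensity, 0 ≤ y.1 :=
    Measure.quasiMeasurePreserving_fst.ae (ae_restrict_mem measurableSet_Ici)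
  have h2 : ∀ᵐ y ∂intensity, ∃ J, ¬ TrivialBelow J y.2.1 :=
    Measure.quasiMeasurePreserving_snd.ae
      (Measure.quasiMeasurePreserving_fst.ae ae_splittingRate_exists_not)
  have h3 : ∀ᵐ y ∂intensity, y ∈ ⋃ m, window m := by
    filter_upwards [h1, h2] with y hy1 ⟨J, hJ⟩
    refine Set.mem_iUnion.2 ⟨max ⌈y.1⌉₊ (max J (y.2.2.natPred + 1)), ⟨hy1, ?_⟩, ?_, ?_⟩
    · exact (Nat.le_ceil _).trans (by exact_mod_cast le_max_left _ _)
    · exact fun h => hJ fun a b ha hb => h a b (ha.trans_le (by simp)) (hb.trans_le (by simp))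
    · rw [Set.mem_ofPred_eq]
      omega
  exact h3

/-! ### The marks of the cuts -/

/-- The mark of the cut of `i`. -/
def cutMark (x : Config) (i : ℕ) : Mark :=
  ((x i).2, bin (cutSet x i), (label x (x i).2 i).succPNat)

lemma cutMeasure_apply {u : ℕ+ → ℕ+} {ε : ℕ+ → ℝ} (hx : IsGood (toConfig u ε)) {A : Set Mark}
    (hA : MeasurableSet A) :
    cutMeasure u ε A = ∑' i, A.indicator 1 (cutMark (toConfig u ε) (i + 1)) := by
  rw [cutMeasure, Measure.sum_apply _ hA, ← vertexEquiv.tsum_eq]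
  refine tsum_congr fun i => ?_
  rw [Measure.dirac_apply' _ hA, vertexEquiv_coe, cutPartition_eq hx (Nat.le_add_left 1 i),
    cutLabel_eq hx (Nat.le_add_left 1 i)]
  rfl

/-- If the rank of `i` were at least `m`, no separated vertex would have rank below `m`, and the
partition would be trivial there. -/
lemma relevant_of_mem_window {x : Config} (hx : IsGood x) {m i : ℕ} (hi : 1 ≤ i)
    (h : cutMark x i ∈ window m) : Relevant m x i := by
  obtain ⟨⟨-, h1⟩, h2, h3⟩ := h
  refine ⟨hi, ⟨hx.time_pos i hi, h1⟩, Finset.mem_product.2 ⟨?_, Finset.mem_Ico.2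
    ⟨blockSize_pos hi le_rfl hx, ?_⟩⟩⟩
  · simpa [cutMark, place] using h3
  · by_contra hlt
    refine h2 (trivialBelow_bin fun a ha hc => hlt ?_)
    have h4 : i ≤ Nat.nth (InBlock x i) a := Cut.le hc
    have h5 := Nat.count_monotone (InBlock x i) h4
    rw [Nat.count_nth_of_infinite (hx.infinite_inBlock i)] at h5
    exact lt_of_le_of_lt h5 ha

/-- The rank of `i` and the rank zero of the root lie in different classes, so the partition is
non-trivial once both ranks are visible. -/
lemma exists_mem_window {x : Config} (hx : IsGood x) {i : ℕ} (hi : 1 ≤ i) :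
    cutMark x i ∈ ⋃ m, window m := by
  set a := Nat.count (InBlock x i) i with ha
  refine Set.mem_iUnion.2 ⟨max ⌈(x i).2⌉₊ (max (a + 1) (label x (x i).2 i + 1)),
    ⟨(hx.time_pos i hi).le, ?_⟩, ?_, ?_⟩
  · exact (Nat.le_ceil _).trans (by exact_mod_cast le_max_left _ _)
  · intro h
    have h1 := h a.succPNat (0 : ℕ).succPNat (by simp) (by simp)
    rw [cutMark, bin_apply, Nat.natPred_succPNat, Nat.natPred_succPNat] at h1
    have h2 : a ∈ cutSet x i := by
      rw [cutSet, Set.mem_ofPred_eq, ha, Nat.nth_count (show InBlock x i i from rfl)]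
      exact cut_self x i
    have h3 : i ≤ Nat.nth (InBlock x i) 0 := Cut.le (h1.1 h2)
    have h4 := Nat.count_monotone (InBlock x i) h3
    rw [Nat.count_nth_of_infinite (hx.infinite_inBlock i)] at h4
    have h5 : 1 ≤ Nat.count (InBlock x i) i := blockSize_pos hi le_rfl hx
    omega
  · simp [cutMark]

/-! ### The Laplace functional on local sets -/

/-- The ranks below `J` of the vertices which are separated depend measurably on the
configuration. -/
lemma measurable_cutFin (J i : ℕ) : @Measurable Config (Finset ℕ) _ ⊤ fun x => cutFin J x i := by
  let _ : MeasurableSpace (Finset ℕ) := ⊤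
  have hid : Measurable fun x : Config => x := measurable_id
  induction J with
  | zero => simp [cutFin]
  | succ J ih =>
    have : (fun x => cutFin (J + 1) x i) = fun x =>
        if Cut x i (Nat.nth (InBlock x i) J) then insert J (cutFin J x i) else cutFin J x i := by
      funext x
      rw [cutFin, Finset.range_add_one, Finset.filter_insert]
      rfl
    rw [this]
    have hn : Measurable fun x : Config => Nat.nth (InBlock x i) J :=
      measurable_nth (p := fun x n => InBlock x i n) (fun m => measurableSet_inBlock hid i m) J
    have hc : MeasurableSet {x : Config | Cut x i (Nat.nth (InBlock x i) J)} := by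
      have : {x : Config | Cut x i (Nat.nth (InBlock x i) J)} =
          ⋃ w, {x : Config | Nat.nth (InBlock x i) J = w} ∩ {x | Cut x i w} := by
        ext x; simp
      rw [this]
      exact .iUnion fun w => (measurableSet_eq_fun hn measurable_const).inter
        (measurableSet_cut hid i w)
    exact Measurable.ite hc
      (Measurable.comp (g := fun R : Finset ℕ => insert J R) (fun _ _ => trivial) ih) ih

lemma measurable_cut_functional {L : ℝ → ℕ → Finset ℕ → ℝ≥0∞}
    (hL : ∀ k R, Measurable fun t => L t k R) (J i : ℕ) :
    Measurable fun x : Config => L (x i).2 (label x (x i).2 i) (cutFin J x i) := by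
  let _ : MeasurableSpace (Finset ℕ) := ⊤
  have : MeasurableSingletonClass (Finset ℕ) := ⟨fun _ => trivial⟩
  have hid : Measurable fun x : Config => x := measurable_id
  refine measurable_eval_countable (H := fun R (x : Config) => L (x i).2 (label x (x i).2 i) R)
    (measurable_cutFin J i) fun R => ?_
  refine measurable_eval_countable (H := fun k (x : Config) => L (x i).2 k R)
    (measurable_label hid (measurable_snd_apply hid i) i) fun k => ?_
  exact (hL k R).comp (measurable_snd_apply hid i)

/-- A functional of the marks which is a test function. -/
structure IsLocalWeight (W : Mark → ℝ≥0∞) (J : ℕ) (C : ℝ≥0∞) : Prop where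
  meas : Measurable W
  ne_top : C ≠ ∞
  le : ∀ y, W y ≤ C
  eq_zero : ∀ y, y ∉ window J → W y = 0
  congr : ∀ t π η k, SameBelow J π η → W (t, π, k) = W (t, η, k)

/-- A functional of the marks as a function of the time, the label and the set of ranks. -/
abbrev weightFun (W : Mark → ℝ≥0∞) (t : ℝ) (k : ℕ) (R : Finset ℕ) : ℝ≥0∞ :=
  W (t, bin R, k.succPNat)

namespace IsLocalWeight

variable {W : Mark → ℝ≥0∞} {J : ℕ} {C : ℝ≥0∞}

lemma measurable_weightFun (hW : IsLocalWeight W J C) (k : ℕ) (R : Finset ℕ) :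
    Measurable fun t => weightFun W t k R :=
  hW.meas.comp (measurable_id.prodMk measurable_const)

lemma isTest (hW : IsLocalWeight W J C) :
    IsTest (fun t k R => expNeg (weightFun W t k R)) J (expNeg C) where
  pos := lt_of_le_of_ne (expNeg_nonneg _) fun h => hW.ne_top (expNeg_eq_zero.1 h.symm)
  le _ _ _ := expNeg_antitone (hW.le _)
  le_one _ _ _ := expNeg_le_one _
  meas k R := continuous_expNeg.measurable.comp (hW.measurable_weightFun k R)
  congr t k R R' h := by
    simp only [weightFun]
    rw [hW.congr t _ _ _ (sameBelow_bin (R := R) (R' := R') fun a ha => by simpa using h a ha)]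
  one_of_time t k R h := by
    simp only [weightFun]
    rw [hW.eq_zero _ fun h' => h h'.1, expNeg_zero]
  one_of_label t k R h := by
    simp only [weightFun]
    rw [hW.eq_zero _ fun h' => ?_, expNeg_zero]
    have : k < J := by simpa using h'.2.2
    omega
  one_of_red t k R h := by
    have h0 : TrivialBelow J (bin R) := trivialBelow_bin fun a ha => by simpa using h a ha
    have h1 : ((t, bin R, k.succPNat) : Mark) ∉ window J := fun h' => h'.2.1 h0
    simp only [weightFun]
    rw [hW.eq_zero _ h1, expNeg_zero]

lemma cutMark_eq (hW : IsLocalWeight W J C) (x : Config) (i : ℕ) :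
    W (cutMark x i) = weightFun W (x i).2 (label x (x i).2 i) (cutFin J x i) :=
  hW.congr _ _ _ _ (sameBelow_bin fun a ha => by simp [cutSet, cutFin, ha])

lemma integral_expNeg_cutMark (hW : IsLocalWeight W J C) :
    ∫ x, expNeg (∑' i, W (cutMark x (i + 1))) ∂configLaw =
      Real.exp (-∫ t in Set.Ioc (0 : ℝ) J,
        totalRate (fun t k R => expNeg (weightFun W t k R)) J t) := by
  simp only [hW.cutMark_eq]
  exact integral_expNeg_tsum hW.isTest

lemma measurable_tsum_cutMark (hW : IsLocalWeight W J C) :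
    Measurable fun x : Config => ∑' i, W (cutMark x (i + 1)) := by
  simp only [hW.cutMark_eq]
  exact Measurable.tsum fun i => measurable_cut_functional hW.measurable_weightFun J (i + 1)

/-- The meeting point of the two urns: `rate`, defined by the recursion of the growing block, is the
mean of the test function under the law `p_{j+1}` of the statement, `j` being counted from zero. -/
lemma lintegral_urnLaw (hW : IsLocalWeight W J C) (t : ℝ) (k j : ℕ) :
    ∫⁻ π, ENNReal.ofReal (1 - expNeg (W (t, π, k.succPNat))) ∂(urnLaw j.succPNat) =
      ENNReal.ofReal (1 - rate (fun t k R => expNeg (weightFun W t k R)) J t k j) := by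
  have hm : Measurable fun π : Partition => ENNReal.ofReal (1 - expNeg (W (t, π, k.succPNat))) :=
    ENNReal.measurable_ofReal.comp (measurable_const.sub (continuous_expNeg.measurable.comp
      (hW.meas.comp (measurable_const.prodMk (measurable_id.prodMk measurable_const)))))
  have h1 := hW.isTest
  rw [urnLaw, lintegral_map hm (measurable_urnPartition _), rate,
    ← integral_urnReds h1.pos.le (h1.le t k) (h1.le_one t k) (h1.congr t k) j]
  have hint : Integrable (fun w => expNeg (weightFun W t k (urnReds j w J))) drawLaw :=
    Integrable.of_bound (measurable_comp_urnReds j J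
      fun R => expNeg (weightFun W t k R)).aestronglyMeasurable 1 (.of_forall fun w => by
        rw [Real.norm_of_nonneg (expNeg_nonneg _)]; exact expNeg_le_one _)
  have h2 : 1 - ∫ w, expNeg (weightFun W t k (urnReds j w J)) ∂drawLaw =
      ∫ w, (1 - expNeg (weightFun W t k (urnReds j w J))) ∂drawLaw := by
    rw [integral_sub (integrable_const _) hint]
    simp
  have h3 := ofReal_integral_eq_lintegral_ofReal ((integrable_const (1 : ℝ)).sub hint)
    (.of_forall fun w => sub_nonneg.2 (expNeg_le_one _))
  simp only [Pi.sub_apply] at h3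
  rw [h2, h3]
  refine lintegral_congr fun w => ?_
  rw [hW.congr _ _ _ _ (sameBelow_urnPartition J j w)]

/-- The double series reduces to the relevant places. The shift `j + 1` reflects that ranks of cut
vertices start at one, as the `p_k` start at `k = 2`. -/
lemma tsum_rate (hW : IsLocalWeight W J C) (t : ℝ) :
    ∑' (k : ℕ) (j : ℕ), ENNReal.ofReal
        (1 - rate (fun t k R => expNeg (weightFun W t k R)) J t k (j + 1)) =
      ENNReal.ofReal (totalRate (fun t k R => expNeg (weightFun W t k R)) J t) := by
  have h1 := hW.isTest
  rw [totalRate, ENNReal.ofReal_sum_of_nonneg fun q _ => sub_nonneg.2 (h1.rate_mem t q.1 q.2).2,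
    places, Finset.sum_product, tsum_eq_sum (s := Finset.range J)]
  · refine Finset.sum_congr rfl fun k _ => ?_
    rw [tsum_eq_sum (s := Finset.range (J - 1)), Finset.sum_Ico_eq_sum_range]
    · exact Finset.sum_congr rfl fun j _ => by rw [add_comm]
    · intro j hj
      rw [h1.rate_eq_one_of_rank _ _ (by simp at hj; omega), sub_self, ENNReal.ofReal_zero]
  · intro k hk
    simp [h1.rate_eq_one_of_label t (not_lt.1 fun h => hk (Finset.mem_range.2 h))]

lemma lintegral_intensity (hW : IsLocalWeight W J C) :
    ∫⁻ y, ENNReal.ofReal (1 - expNeg (W y)) ∂intensity =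
      ∫⁻ t in Set.Ioc (0 : ℝ) J,
        ENNReal.ofReal (totalRate (fun t k R => expNeg (weightFun W t k R)) J t) := by
  have hm : Measurable fun y : Mark => ENNReal.ofReal (1 - expNeg (W y)) :=
    ENNReal.measurable_ofReal.comp (measurable_const.sub
      (continuous_expNeg.measurable.comp hW.meas))
  rw [intensity, lintegral_prod _ hm.aemeasurable]
  have h1 : ∀ t : ℝ, ∫⁻ z, ENNReal.ofReal (1 - expNeg (W (t, z)))
      ∂(splittingRate.prod (Measure.count : Measure ℕ+)) =
      ENNReal.ofReal (totalRate (fun t k R => expNeg (weightFun W t k R)) J t) := by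
    intro t
    have hmt : Measurable fun z : Partition × ℕ+ => ENNReal.ofReal (1 - expNeg (W (t, z))) :=
      hm.comp measurable_prodMk_left
    rw [lintegral_prod_symm _ hmt.aemeasurable, lintegral_count, ← hW.tsum_rate t,
      ← shiftEquiv.toEquiv.tsum_eq]
    refine tsum_congr fun k => ?_
    rw [lintegral_splittingRate]
    exact tsum_congr fun j => hW.lintegral_urnLaw t k (j + 1)
  simp only [h1]
  have h2 : ∀ t, t ∉ Set.Icc (0 : ℝ) J →
      totalRate (fun t k R => expNeg (weightFun W t k R)) J t = 0 := fun t ht =>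
    Finset.sum_eq_zero fun q _ => by rw [hW.isTest.rate_eq_one_of_time ht, sub_self]
  -- The time `0` belongs to the intensity but not to the interval of the compensators; it is
  -- Lebesgue-null.
  rw [← setLIntegral_congr (Ioi_ae_eq_Ici (a := (0 : ℝ)))]
  rw [← lintegral_indicator measurableSet_Ioi, ← lintegral_indicator measurableSet_Ioc]
  refine lintegral_congr fun t => ?_
  by_cases ht : t ∈ Set.Icc (0 : ℝ) J
  · have : t ∈ Set.Ioi (0 : ℝ) ↔ t ∈ Set.Ioc (0 : ℝ) J := ⟨fun h => ⟨h, ht.2⟩, fun h => h.1⟩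
    simp only [Set.indicator, this]
  · simp [Set.indicator, h2 t ht]

lemma integral_intensity (hW : IsLocalWeight W J C) :
    ∫ y, (1 - expNeg (W y)) ∂intensity =
      ∫ t in Set.Ioc (0 : ℝ) J, totalRate (fun t k R => expNeg (weightFun W t k R)) J t := by
  rw [integral_eq_lintegral_of_nonneg_ae (.of_forall fun y => sub_nonneg.2 (expNeg_le_one _))
      (measurable_const.sub (continuous_expNeg.measurable.comp hW.meas)).aestronglyMeasurable,
    integral_eq_lintegral_of_nonneg_ae (.of_forall fun t => (totalRate_mem hW.isTest t).1)
      (measurable_totalRate hW.isTest).aestronglyMeasurable, hW.lintegral_intensity]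

end IsLocalWeight

/-- The weight that gives the mass `n l` to the part of `A l` in a window. -/
def windowWeight {r : ℕ} (n : Fin r → ℕ) (A : Fin r → Set Mark) (m : ℕ) (y : Mark) : ℝ≥0∞ :=
  ∑ l, n l * (A l ∩ window m).indicator 1 y

lemma exists_isLocalWeight {r : ℕ} (n : Fin r → ℕ) {A : Fin r → Set Mark}
    (hA : ∀ l, A l ∈ localSets) (m : ℕ) :
    ∃ J, IsLocalWeight (windowWeight n A m) J (∑ l, (n l : ℝ≥0∞)) := by
  choose hm J hJ using hA
  -- One bound on ranks that exceeds the window size and the range of dependence of every `A l`.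
  refine ⟨m + ∑ l, J l, ?_, ENNReal.sum_ne_top.2 fun _ _ => ENNReal.natCast_ne_top _, fun y => ?_, fun y hy => ?_, fun t π η k h => ?_⟩
  · exact Finset.measurable_sum _ fun l _ => (measurable_const.indicator
      ((hm l).inter (measurableSet_window m))).const_mul _
  · refine Finset.sum_le_sum fun l _ => ?_
    by_cases h : y ∈ A l ∩ window m <;> simp [h]
  · refine Finset.sum_eq_zero fun l _ => ?_
    rw [Set.indicator_of_notMem fun h => hy (monotone_window (Nat.le_add_right _ _) h.2), mul_zero]
  · refine Finset.sum_congr rfl fun l _ => ?_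
    have hl : J l ≤ m + ∑ l, J l :=
      (Finset.single_le_sum (f := J) (fun _ _ => Nat.zero_le _) (Finset.mem_univ l)).trans
        (Nat.le_add_left _ _)
    have := (((hJ l).mono hl).inter ((isLocal_window m).mono (Nat.le_add_right _ _))) t π η k h
    by_cases h' : (t, η, k) ∈ A l ∩ window m
    · rw [Set.indicator_of_mem (this.2 h'), Set.indicator_of_mem h']
      rfl
    · rw [Set.indicator_of_notMem (mt this.1 h'), Set.indicator_of_notMem h']

lemma setIntegral_window {r : ℕ} (n : Fin r → ℕ) (A : Fin r → Set Mark) (m : ℕ) :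
    ∫ y in window m, (1 - Real.exp (-∑ l, (n l : ℝ) * (A l).indicator (1 : Mark → ℝ) y))
      ∂intensity = ∫ y, (1 - expNeg (windowWeight n A m y)) ∂intensity := by
  rw [← integral_indicator (measurableSet_window m)]
  refine integral_congr_ae (.of_forall fun y => ?_)
  by_cases hy : y ∈ window m
  · have h0 : ∀ l, 0 ≤ (n l : ℝ) * (A l).indicator (1 : Mark → ℝ) y := fun l =>
      mul_nonneg (Nat.cast_nonneg _) (Set.indicator_nonneg (fun _ _ => zero_le_one) _)
    have : windowWeight n A m y =
        ENNReal.ofReal (∑ l, (n l : ℝ) * (A l).indicator (1 : Mark → ℝ) y) := by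
      rw [ENNReal.ofReal_sum_of_nonneg fun l _ => h0 l]
      refine Finset.sum_congr rfl fun l _ => ?_
      by_cases hl : y ∈ A l <;> simp [hl, hy]
    simp only [Set.indicator_of_mem hy]
    rw [this, expNeg_ofReal (Finset.sum_nonneg fun l _ => h0 l)]
  · have : windowWeight n A m y = 0 :=
      Finset.sum_eq_zero fun l _ => by
        rw [Set.indicator_of_notMem fun h => hy h.2, mul_zero]
    simp [Set.indicator_of_notMem hy, this]

end RecursiveTree

end

/-! ### The Poisson property of the cuts. -/

theorem proposition4 {Ω : Type*} [MeasurableSpace Ω] (P : Measure Ω) [IsProbabilityMeasure P]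
    (u : ℕ+ → Ω → ℕ+) (ε : ℕ+ → Ω → ℝ)
    (hu_meas : ∀ i : ℕ+, 2 ≤ i → Measurable (u i))
    (hε_meas : ∀ i : ℕ+, 2 ≤ i → Measurable (ε i))
    (hu_law : ∀ i : ℕ+, 2 ≤ i → P.map (u i) = uniformOn (Set.Iio i))
    (hu_indep : iIndepFun (fun (i : {i : ℕ+ // 2 ≤ i}) => u i) P)
    (hε_law : ∀ i : ℕ+, 2 ≤ i → P.map (ε i) = expMeasure 1)
    (hε_indep : iIndepFun (fun (i : {i : ℕ+ // 2 ≤ i}) => ε i) P)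
    (huε_indep : IndepFun (fun ω (i : {i : ℕ+ // 2 ≤ i}) => u i ω)
      (fun ω (i : {i : ℕ+ // 2 ≤ i}) => ε i ω) P) :
    RecursiveTree.IsPoissonRandomMeasure
      (fun ω => RecursiveTree.cutMeasure (fun i => u i ω) (fun i => ε i ω))
      ((volume.restrict (Set.Ici (0 : ℝ))).prod
        (RecursiveTree.splittingRate.prod (Measure.count : Measure ℕ+)))
      P := by
  open RecursiveTree in
  classical
  have hM := measurable_cutMeasure hu_meas hε_meas
  have hXm := measurable_toConfig hu_meas hε_meas
  have hX := map_toConfig hu_meas hε_meas hu_law hu_indep hε_law hε_indep huε_indep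
  have hgood : ∀ᵐ ω ∂P, IsGood (toConfig (fun i => u i ω) (fun i => ε i ω)) :=
    ae_of_ae_map hXm.aemeasurable (hX.symm ▸ ae_isGood)
  refine isPoissonRandomMeasure_of_laplace P hM fun r n A hA hdisj =>
    laplace_of_algebra P hM isSetAlgebra_localSets generateFrom_localSets measurableSet_window
      monotone_window intensity_window_ne_top ?_ intensity_compl_iUnion_window ?_ ?_ n A hA hdisj
  -- Finite mean mass of a window: its cuts are relevant, and the mean number of relevant cuts is
  -- finite.
  · intro m
    refine ne_top_of_le_ne_top ?_ (b := ∫⁻ ω, ∑' i,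
      (if Relevant m (toConfig (fun i => u i ω) (fun i => ε i ω)) (i + 1) then 1 else 0) ∂P) ?_
    · rw [← lintegral_map' (f := fun x : Config => ∑' i, (if Relevant m x (i + 1) then 1 else 0))
        (hX.symm ▸ aemeasurable_tsum_relevant m) hXm.aemeasurable, hX]
      exact ne_top_of_le_ne_top (by finiteness) (lintegral_tsum_relevant m)
    · refine lintegral_mono_ae ?_
      filter_upwards [hgood] with ω hω
      rw [cutMeasure_apply hω (measurableSet_window m)]
      refine ENNReal.tsum_le_tsum fun i => ?_
      by_cases h : cutMark (toConfig (fun i => u i ω) (fun i => ε i ω)) (i + 1) ∈ window m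
      · rw [Set.indicator_of_mem h, if_pos (relevant_of_mem_window hω (Nat.le_add_left 1 i) h)]
        rfl
      · rw [Set.indicator_of_notMem h]
        exact zero_le
  · filter_upwards [hgood] with ω hω
    rw [cutMeasure_apply hω (MeasurableSet.iUnion measurableSet_window).compl,
      ENNReal.tsum_eq_zero]
    exact fun i => Set.indicator_of_notMem
      (Set.notMem_compl_iff.2 (exists_mem_window hω (Nat.le_add_left 1 i))) _
  -- For local sets inside a window, both sides are expressed through one local weight, and the
  -- formula for `configLaw` is transported by `toConfig`.
  · intro m r n A hA
    obtain ⟨J, hW⟩ := exists_isLocalWeight n hA m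
    rw [setIntegral_window, hW.integral_intensity, ← hW.integral_expNeg_cutMark, ← hX]
    refine Eq.trans (integral_congr_ae ?_) (integral_map hXm.aemeasurable
      (continuous_expNeg.measurable.comp hW.measurable_tsum_cutMark).aestronglyMeasurable).symm
    filter_upwards [hgood] with ω hω
    simp only [windowWeight, Function.comp_apply]
    rw [Summable.tsum_finsetSum fun _ _ => ENNReal.summable]
    congr 1
    refine Finset.sum_congr rfl fun l _ => ?_
    rw [cutMeasure_apply hω ((hA l).1.inter (measurableSet_window m)), ENNReal.tsum_mul_left]
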